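/- Let $n\ge 0$ be an integer and $I=[0,1]$. **Definitions.** $\mathsf{L}_n$ is the Hecke–Kiselman monoid of the linearly oriented chain $A_n$: generators $x_1,\dots,x_n$, relations $x_i^2=x_i$; $x_ix_j=x_jx_i$ for $i-j>1$; $x_ix_{i+1}x_i=x_{i+1}x_ix_{i+1}=x_ix_{i+1}$ for $1\le i<n$. An *$n$-diagram* consists of $n+1$ strands in $\mathbb{R}\times I$, each of which is the graph of a continuous function of the height, such that the strands join the points $(1,0),\dots,(n+1,0)$ bijectively to the points $(1,1),\dots,(n+1,1)$, and are disjoint except for finitely many interior double points, at which the two strands cross. An *isotopy* is a continuous deformation through $n$-diagrams during which no crossings are created, destroyed or merged. Diagrams are composed by stacking and shrinking; in $dd'$ the diagram $d'$ is put on top of $d$, so that products are read from bottom to top. The *elementary diagram* $d_i$ has a single crossing, of the strands starting at $(i,0)$ and $(i+1,0)$, its other strands being vertical. A *$2$-move* replaces a bigon (two strands crossing twice) by a single crossing, or conversely. A *$3$-move* interchanges any two of the following three patterns of three strands, which represent $d_id_{i+1}d_i$, $d_{i+1}d_id_{i+1}$ and $d_id_{i+1}$. Both take place inside a box that meets no other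 strand and that the two (resp. three) strands enter through the bottom and leave through the top; the drawing outside the box is unchanged. $\mathsf{DL}_n$ is the set of $n$-diagrams modulo isotopy, $2$-moves and $3$-moves. An *$n$-web* is an $n$-diagram in which any two strands meet at most once and no three strands meet pairwise; $\mathsf{WL}_n$ is the set of $n$-webs up to isotopy, and $\iota\colon\mathsf{WL}_n\to\mathsf{DL}_n$ is induced by the inclusion of webs into diagrams. The map $\pi$ sends an $n$-web to the permutation of $\{1,\dots,n+1\}$ taking the lower endpoint of each strand to its upper endpoint. $\operatorname{II}_n$ is the set of couples of integer sequences $((a_1,\dots,a_k),(b_1,\dots,b_k))$, $k\ge 0$, with $1\le a_1<\dots<a_k$, $b_1<\dots<b_k\le n+1$ and $a_t<b_t$ for all $t$. The map $\rho$ sends a $321$-avoiding permutation $s$ to the couple consisting of the increasing sequence $(a_t)$ of all $i$ with $s(i)>i$ and of the sequence $b_t=s(a_t)$. Let the words in the $x_i$ act on $\mathbb{N}^{n+1}$, their letters being applied successively from left to right, where $x_i$ replaces the $(i+1)$-st entry by the $i$-th one. This is an action of $\mathsf{L}_n$. For $x\in\mathsf{L}_n$ let $y$ be the result of letting $x$ act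 on $(1,2,\dots,n+1)$, let $(a_t)$ be the increasing sequence of the values present in $y$, and let $b_t$ be the place of the rightmost occurrence of $a_t$ in $y$; discard all pairs with $a_t=b_t$, and call the remaining couple of sequences $\varphi(x)$. **Theorem.** For every $n$: 1. composition of diagrams makes $\mathsf{DL}_n$ a monoid whose unit is the class of the diagram with $n+1$ vertical strands, and there is a monoid homomorphism $\varepsilon\colon\mathsf{L}_n\to\mathsf{DL}_n$ with $\varepsilon(x_i)=d_i$ for all $i$; it is bijective; 2. $\iota\colon\mathsf{WL}_n\to\mathsf{DL}_n$ is bijective; 3. the permutations $\pi(w)$, $w\in\mathsf{WL}_n$, are $321$-avoiding, and $\rho\circ\pi$ is a bijection from $\mathsf{WL}_n$ onto $\operatorname{II}_n$; 4. $\varphi$ is a bijection from $\mathsf{L}_n$ onto $\operatorname{II}_n$, and $\varphi\circ\varepsilon^{-1}\circ\iota=\rho\circ\pi$. In particular $\mathsf{L}_n$, $\mathsf{WL}_n$ and $\operatorname{II}_n$ are in bijection. Moreover, $\varphi$ is computable in linear time: there are a single random access machine program (whose arithmetic consists only of the successor and the predecessor, with unit cost) and a constant $C$ such that, for all $n$ and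 all words $w$ in $x_1,\dots,x_n$, the program, given $n$, the length of $w$ and the letters of $w$, halts after at most $C\,(\max\{n,\operatorname{length}(w)\}+1)$ steps with the output $a_1,b_1,a_2,b_2,\dots$, where $((a_t),(b_t))=\varphi(x)$ and $x\in\mathsf{L}_n$ is the element represented by $w$. -/

import Mathlib

open scoped unitInterval

namespace HeckeKiselman

/-! ### The monoid `L_n` -/

/-- Defining relations of the Hecke-Kiselman monoid of the linearly oriented chain `A_n`.
The generators `x_1, …, x_n` are indexed by `Fin n`, with `x_(i+1)` given by the index `i`. -/
inductive HKRel (n : ℕ) : FreeMonoid (Fin n) → FreeMonoid (Fin n) → Prop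
  | idem (i : Fin n) : HKRel n (.of i * .of i) (.of i)
  | comm (i j : Fin n) (h : (j : ℕ) + 1 < i) : HKRel n (.of i * .of j) (.of j * .of i)
  | braid (i j : Fin n) (h : (j : ℕ) = i + 1) :
      HKRel n (.of i * .of j * .of i) (.of j * .of i * .of j)
  | kiselman (i j : Fin n) (h : (j : ℕ) = i + 1) :
      HKRel n (.of j * .of i * .of j) (.of i * .of j)

/-- The Hecke-Kiselman monoid `L_n`. -/
abbrev LMonoid (n : ℕ) : Type := PresentedMonoid (HKRel n)

/-- The generator `x_(i+1)`. -/
def gen {n : ℕ} (i : Fin n) : LMonoid n := PresentedMonoid.of (HKRel n) i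

/-- The element of `L_n` represented by a word in the generators. -/
def wordValue {n : ℕ} (w : List (Fin n)) : LMonoid n := (w.map gen).prod

/-! ### Diagrams -/

/-- The function `f - g` changes sign from negative to positive values at the height `y`:
followed upwards, `f` crosses `g` from left to right. -/
def CrossesAt (f g : I → ℝ) (y : I) : Prop :=
  ∃ a b : I, a < y ∧ y < b ∧ (∀ z ∈ Set.Ioo a y, f z < g z) ∧ (∀ z ∈ Set.Ioo y b, g z < f z)

/-- An `n`-diagram (positive braid diagram) in the strip `ℝ × I`. As each strand projects
bijectively onto the vertical interval `I`, it is the graph of a continuous function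
`height ↦ x-coordinate`. The strands are numbered by their lower endpoints: with indices starting
at `0`, strand `i` goes from `(i + 1, 0)` to `(perm i + 1, 1)`. Distinct strands meet in finitely
many points, at most two strands meet at a point, and where they meet they cross. -/
structure Diagram (n : ℕ) where
  perm : Equiv.Perm (Fin (n + 1))
  strand : Fin (n + 1) → C(I, ℝ)
  bottom : ∀ i, strand i 0 = (i : ℝ) + 1
  top : ∀ i, strand i 1 = (perm i : ℝ) + 1
  finite_meet : ∀ i j, i ≠ j → {y : I | strand i y = strand j y}.Finite
  no_triple : ∀ i j k, i ≠ j → j ≠ k → i ≠ k → ∀ y : I,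
    ¬ (strand i y = strand j y ∧ strand j y = strand k y)
  crossing : ∀ i j, i ≠ j → ∀ y : I, strand i y = strand j y →
    CrossesAt (strand i) (strand j) y ∨ CrossesAt (strand j) (strand i) y

/-- The crossings (double points) of a diagram: the two strands and the height. -/
def Diagram.crossings {n : ℕ} (d : Diagram n) : Set (Fin (n + 1) × Fin (n + 1) × I) :=
  {c | c.1 < c.2.1 ∧ d.strand c.1 c.2.2 = d.strand c.2.1 c.2.2}

/-- Isotopy of `n`-diagrams: a continuous deformation through `n`-diagrams along which no
crossings are created, destroyed or merged, that is, an isotopy of embedded `4`-valent graphs with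
monotone strands. As crossings are transverse and isolated, it suffices to ask that the number of
crossings be constant. -/
def Isotopic {n : ℕ} (d e : Diagram n) : Prop :=
  ∃ F : I → Diagram n, F 0 = d ∧ F 1 = e ∧
    (∀ i, Continuous fun p : I × I => (F p.1).strand i p.2) ∧
    ∀ t, (F t).crossings.ncard = d.crossings.ncard

/-- The part of `d` formed by the `m` strands `j 0, …, j (m - 1)`, between the heights `u` and `v`,
realises the pattern `P`: these strands are ordered from left to right at the height `u`, and the
list of all the crossings between them, read upwards, is `P`. The pair `(s, t)` with `s < t` in `P`
stands for a crossing of `j s` and `j t`. -/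
def LocalPattern {n m : ℕ} (d : Diagram n) (j : Fin m → Fin (n + 1)) (u v : I)
    (P : List (Fin m × Fin m)) : Prop :=
  (∀ s t, s < t → d.strand (j s) u < d.strand (j t) u) ∧
  ∃ h : Fin P.length → I, StrictMono h ∧ (∀ q, u < h q ∧ h q < v) ∧
    ∀ s t, s < t → ∀ y ∈ Set.Icc u v,
      (d.strand (j s) y = d.strand (j t) y ↔ ∃ q, h q = y ∧ P.get q = (s, t))

/-- `e` is obtained from `d` by replacing the pattern `P` with the pattern `Q` inside a box
`(l, r) × [u, v]` which the strands `j 0, …, j (m - 1)` enter through the bottom and leave through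
the top, and which meets no other strand. Outside the box the two drawings coincide;
since a strand leaving the box at a given point may have entered it at different points in `d` and
`e`, the parts of the strands above the box are matched by a permutation `τ`. -/
def LocalMove {n m : ℕ} (P Q : List (Fin m × Fin m)) (d e : Diagram n) : Prop :=
  ∃ (j : Fin m → Fin (n + 1)) (u v : I) (l r : ℝ) (τ : Equiv.Perm (Fin (n + 1))),
    u < v ∧ l < r ∧ Function.Injective j ∧
    (∀ s, ∀ y ∈ Set.Icc u v,
      d.strand (j s) y ∈ Set.Ioo l r ∧ e.strand (j s) y ∈ Set.Ioo l r) ∧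
    (∀ k ∉ Set.range j, ∀ y ∈ Set.Icc u v,
      d.strand k y ∉ Set.Icc l r ∧ e.strand k y = d.strand k y) ∧
    (∀ k, ∀ y ≤ u, e.strand k y = d.strand k y) ∧
    (∀ k ∉ Set.range j, τ k = k) ∧
    (∀ k, ∀ y, v ≤ y → e.strand k y = d.strand (τ k) y) ∧
    LocalPattern d j u v P ∧ LocalPattern e j u v Q

/-- The elementary modifications of diagrams: isotopies, the `2`-move (a bigon becomes a crossing),
and the `3`-moves (the two triangles and the triangle-free pattern in which the leftmost of three
strands passes to the right of the two others). -/
inductive Move {n : ℕ} : Diagram n → Diagram n → Prop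
  | isotopy {d e : Diagram n} : Isotopic d e → Move d e
  | two {d e : Diagram n} : LocalMove (m := 2) [(0, 1), (0, 1)] [(0, 1)] d e → Move d e
  | three {d e : Diagram n} :
      LocalMove (m := 3) [(0, 1), (0, 2), (1, 2)] [(1, 2), (0, 2), (0, 1)] d e → Move d e
  | three' {d e : Diagram n} :
      LocalMove (m := 3) [(1, 2), (0, 2), (0, 1)] [(0, 1), (0, 2)] d e → Move d e

/-- The set `DL_n` of `n`-diagrams up to isotopy, `2`- and `3`-moves. (`Quot` is the quotient by the
equivalence relation generated by `Move`.) -/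
def DL (n : ℕ) : Type := Quot (Move (n := n))

/-- The class of a diagram in `DL_n`. -/
def DL.mk {n : ℕ} (d : Diagram n) : DL n := Quot.mk _ d

/-! ### Straight-line diagrams -/

/-- `321`-avoiding permutations. -/
def Avoids321 {m : ℕ} (s : Equiv.Perm (Fin m)) : Prop :=
  ¬ ∃ i j k, i < j ∧ j < k ∧ s i > s j ∧ s j > s k

/-- The straight segment from `(a, 0)` to `(b, 1)`. -/
noncomputable def segment (a b : ℝ) : C(I, ℝ) where
  toFun y := (1 - (y : ℝ)) * a + y * b

theorem segment_val (a b : ℝ) (y : I) : segment a b y = (1 - (y : ℝ)) * a + y * b := rfl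

theorem straight_inv {m : ℕ} (s : Equiv.Perm (Fin m)) {i j : Fin m} (hij : i < j) {y : I}
    (h : segment ((i : ℝ) + 1) ((s i : ℝ) + 1) y =
      segment ((j : ℝ) + 1) ((s j : ℝ) + 1) y) : s j < s i := by
  by_contra hc
  have hc : s i < s j := lt_of_le_of_ne (not_lt.mp hc) (fun h' => hij.ne (s.injective h'))
  rw [segment_val, segment_val] at h
  have h1 : (i : ℝ) + 1 ≤ (j : ℝ) := by exact_mod_cast hij
  have h2 : (s i : ℝ) + 1 ≤ (s j : ℝ) := by exact_mod_cast hc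
  nlinarith [y.2.1, y.2.2]

theorem straight_cross {m : ℕ} (s : Equiv.Perm (Fin m)) {i j : Fin m} (hij : i < j) {y : I}
    (h : segment ((i : ℝ) + 1) ((s i : ℝ) + 1) y =
      segment ((j : ℝ) + 1) ((s j : ℝ) + 1) y) :
    CrossesAt (segment ((i : ℝ) + 1) ((s i : ℝ) + 1))
      (segment ((j : ℝ) + 1) ((s j : ℝ) + 1)) y := by
  have hs := straight_inv s hij h
  have h1 : (i : ℝ) + 1 ≤ (j : ℝ) := by exact_mod_cast hij
  have h2 : (s j : ℝ) + 1 ≤ (s i : ℝ) := by exact_mod_cast hs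
  rw [segment_val, segment_val] at h
  refine ⟨0, 1, ?_, ?_, ?_, ?_⟩
  · rw [← Subtype.coe_lt_coe]
    rcases eq_or_lt_of_le y.2.1 with h0 | h0
    · rw [← h0] at h; linarith
    · exact h0
  · rw [← Subtype.coe_lt_coe]
    rcases eq_or_lt_of_le y.2.2 with h0 | h0
    · rw [h0] at h; linarith
    · exact h0
  · rintro z ⟨-, hz⟩
    have hz : (z : ℝ) < y := hz
    rw [segment_val, segment_val]
    nlinarith
  · rintro z ⟨hz, -⟩
    have hz : (y : ℝ) < z := hz
    rw [segment_val, segment_val]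
    nlinarith

theorem straight_unique {m : ℕ} (s : Equiv.Perm (Fin m)) {i j : Fin m} (hij : i < j) {y z : I}
    (h : segment ((i : ℝ) + 1) ((s i : ℝ) + 1) y =
      segment ((j : ℝ) + 1) ((s j : ℝ) + 1) y)
    (h' : segment ((i : ℝ) + 1) ((s i : ℝ) + 1) z =
      segment ((j : ℝ) + 1) ((s j : ℝ) + 1) z) : y = z := by
  have hs := straight_inv s hij h
  have h1 : (i : ℝ) + 1 ≤ (j : ℝ) := by exact_mod_cast hij
  have h2 : (s j : ℝ) + 1 ≤ (s i : ℝ) := by exact_mod_cast hs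
  rw [segment_val, segment_val] at h h'
  have h3 : ((y : ℝ) - z) * (((j : ℝ) - i) + ((s i : ℝ) - s j)) = 0 := by linarith
  rcases mul_eq_zero.mp h3 with h4 | h4
  · exact Subtype.ext (by linarith)
  · linarith

/-- The diagram formed by the straight segments from `(i + 1, 0)` to `(s i + 1, 1)`. -/
noncomputable def straight {n : ℕ} (s : Equiv.Perm (Fin (n + 1))) (hs : Avoids321 s) :
    Diagram n where
  perm := s
  strand i := segment ((i : ℝ) + 1) ((s i : ℝ) + 1)
  bottom i := by simp [segment_val]
  top i := by simp [segment_val]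
  finite_meet i j hij := by
    refine Set.Subsingleton.finite fun y hy z hz => ?_
    rcases lt_or_gt_of_ne hij with h | h
    · exact straight_unique s h hy hz
    · exact straight_unique s h (Eq.symm hy) (Eq.symm hz)
  no_triple := by
    have key : ∀ i j k : Fin (n + 1), i < j → j < k → ∀ y : I,
        segment ((i : ℝ) + 1) ((s i : ℝ) + 1) y =
          segment ((j : ℝ) + 1) ((s j : ℝ) + 1) y →
        segment ((j : ℝ) + 1) ((s j : ℝ) + 1) y =
          segment ((k : ℝ) + 1) ((s k : ℝ) + 1) y → False :=
      fun i j k hij hjk y h h' =>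
        hs ⟨i, j, k, hij, hjk, straight_inv s hij h, straight_inv s hjk h'⟩
    rintro i j k hij hjk hik y ⟨h, h'⟩
    rcases lt_or_gt_of_ne hij with a | a <;> rcases lt_or_gt_of_ne hjk with b | b <;>
      rcases lt_or_gt_of_ne hik with c | c
    · exact key i j k a b y h h'
    · exact absurd (a.trans b) c.asymm
    · exact key i k j c b y (h.trans h') h'.symm
    · exact key k i j c a y (h.trans h').symm h
    · exact key j i k a c y h.symm (h.trans h')
    · exact key j k i b c y h' (h.trans h').symm
    · exact absurd (b.trans a) c.asymm
    · exact key k j i b a y h'.symm h.symm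
  crossing i j hij y h := by
    rcases lt_or_gt_of_ne hij with a | a
    · exact Or.inl (straight_cross s a h)
    · exact Or.inr (straight_cross s a h.symm)

theorem avoids321_one (m : ℕ) : Avoids321 (1 : Equiv.Perm (Fin m)) := by
  rintro ⟨i, j, k, hij, -, h, -⟩
  exact absurd hij h.asymm

theorem avoids321_swap {n : ℕ} (i : Fin n) :
    Avoids321 (Equiv.swap i.castSucc i.succ : Equiv.Perm (Fin (n + 1))) := by
  rintro ⟨a, b, c, hab, hbc, h1, h2⟩
  have h1' : (Equiv.swap i.castSucc i.succ b).val < (Equiv.swap i.castSucc i.succ a).val := h1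
  have h2' : (Equiv.swap i.castSucc i.succ c).val < (Equiv.swap i.castSucc i.succ b).val := h2
  have hab' : a.val < b.val := hab
  have hbc' : b.val < c.val := hbc
  have hv : ∀ x : Fin (n + 1), (Equiv.swap i.castSucc i.succ x).val =
      if x.val = i.val then i.val + 1 else if x.val = i.val + 1 then i.val else x.val := by
    intro x
    simp only [Equiv.swap_apply_def, Fin.ext_iff, Fin.val_castSucc, Fin.val_succ]
    split_ifs <;> simp
  rw [hv, hv] at h1' h2'
  split_ifs at h1' h2' <;> omega

/-- The trivial diagram, with `n + 1` vertical strands. -/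
noncomputable def trivialDiagram (n : ℕ) : Diagram n := straight 1 (avoids321_one _)

/-- The elementary diagram `d_(i+1)`: the strands starting at `i + 1` and `i + 2` cross once, and
the other strands are vertical. -/
noncomputable def elementary {n : ℕ} (i : Fin n) : Diagram n :=
  straight (Equiv.swap i.castSucc i.succ) (avoids321_swap i)

/-! ### Composition -/

/-- The lower half of the interval. -/
noncomputable def lo (y : I) : I := ⟨(y : ℝ) / 2, by constructor <;> linarith [y.2.1, y.2.2]⟩

/-- The upper half of the interval. -/
noncomputable def hi (y : I) : I :=
  ⟨(1 + (y : ℝ)) / 2, by constructor <;> linarith [y.2.1, y.2.2]⟩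

/-- The function given by `f` on the lower half of the interval and by `g` on the upper half. -/
noncomputable def glue (f g : C(I, ℝ)) (h : f 1 = g 0) : C(I, ℝ) :=
  (Path.trans (⟨f, rfl, h⟩ : Path (f 0) (g 0)) (⟨g, rfl, rfl⟩ : Path (g 0) (g 1))).toContinuousMap

theorem glue_lo (f g : C(I, ℝ)) (hfg : f 1 = g 0) (y : I) : glue f g hfg (lo y) = f y := by
  change Path.trans _ _ _ = _
  have h : ((lo y : I) : ℝ) ≤ 1 / 2 := by simp only [lo]; linarith [y.2.2]
  rw [Path.trans_apply, dif_pos h]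
  change f _ = f _
  congr 1
  exact Subtype.ext (by simp only [lo]; ring)

theorem glue_hi (f g : C(I, ℝ)) (hfg : f 1 = g 0) (y : I) : glue f g hfg (hi y) = g y := by
  by_cases hy : (y : ℝ) = 0
  · have hy' : y = 0 := Subtype.ext hy
    have h1 : hi y = lo 1 := Subtype.ext (by simp [hi, lo, hy])
    rw [h1, glue_lo, hy', hfg]
  · have h : ¬ ((hi y : I) : ℝ) ≤ 1 / 2 := by
      have : 0 < (y : ℝ) := lt_of_le_of_ne y.2.1 (Ne.symm hy)
      simp only [hi]; linarith
    change Path.trans _ _ _ = _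
    rw [Path.trans_apply, dif_neg h]
    change g _ = g _
    congr 1
    exact Subtype.ext (by simp only [hi]; ring)

theorem lo_or_hi (y : I) : (∃ z, z ≠ 1 ∧ y = lo z) ∨ ∃ z, y = hi z := by
  by_cases h : (y : ℝ) < 1 / 2
  · refine Or.inl ⟨⟨2 * y, by constructor <;> linarith [y.2.1]⟩, ?_, ?_⟩
    · intro h'
      have : (2 * y : ℝ) = 1 := congrArg Subtype.val h'
      linarith
    · exact Subtype.ext (by simp [lo])
  · refine Or.inr ⟨⟨2 * y - 1, by constructor <;> linarith [y.2.2]⟩, ?_⟩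
    exact Subtype.ext (by simp [hi])

theorem crossesAt_lo (γ δ γ' δ' : C(I, ℝ)) (e : γ 1 = δ 0) (e' : γ' 1 = δ' 0) {y : I}
    (h : CrossesAt γ γ' y) : CrossesAt (glue γ δ e) (glue γ' δ' e') (lo y) := by
  obtain ⟨p, q, hp, hq, h1, h2⟩ := h
  have hp : (p : ℝ) < y := hp
  have hq : (y : ℝ) < q := hq
  have hlt : ∀ {s t : I}, ((s : ℝ) < t) → lo s < lo t := fun {s t} hst => by
    rw [← Subtype.coe_lt_coe]; simp only [lo]; linarith
  have key : ∀ z : I, z < lo q → ∃ w : I, z = lo w := fun z hz => by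
    have hz : (z : ℝ) < (q : ℝ) / 2 := hz
    refine ⟨⟨2 * z, ?_, ?_⟩, Subtype.ext (by simp [lo])⟩
    · linarith [z.2.1]
    · linarith [q.2.2]
  refine ⟨lo p, lo q, hlt hp, hlt hq, ?_, ?_⟩
  · rintro z ⟨hz, hz'⟩
    obtain ⟨w, rfl⟩ := key z (hz'.trans (hlt hq))
    rw [glue_lo, glue_lo]
    rw [← Subtype.coe_lt_coe] at hz hz'
    simp only [lo] at hz hz'
    exact h1 w ⟨Subtype.coe_lt_coe.mp (by linarith), Subtype.coe_lt_coe.mp (by linarith)⟩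
  · rintro z ⟨hz, hz'⟩
    obtain ⟨w, rfl⟩ := key z hz'
    rw [glue_lo, glue_lo]
    rw [← Subtype.coe_lt_coe] at hz hz'
    simp only [lo] at hz hz'
    exact h2 w ⟨Subtype.coe_lt_coe.mp (by linarith), Subtype.coe_lt_coe.mp (by linarith)⟩

theorem crossesAt_hi (γ δ γ' δ' : C(I, ℝ)) (e : γ 1 = δ 0) (e' : γ' 1 = δ' 0) {y : I}
    (h : CrossesAt δ δ' y) : CrossesAt (glue γ δ e) (glue γ' δ' e') (hi y) := by
  obtain ⟨p, q, hp, hq, h1, h2⟩ := h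
  have hp : (p : ℝ) < y := hp
  have hq : (y : ℝ) < q := hq
  have hlt : ∀ {s t : I}, ((s : ℝ) < t) → hi s < hi t := fun {s t} hst => by
    rw [← Subtype.coe_lt_coe]; simp only [hi]; linarith
  have key : ∀ z : I, hi p < z → ∃ w : I, z = hi w := fun z hz => by
    have hz : (1 + (p : ℝ)) / 2 < (z : ℝ) := hz
    refine ⟨⟨2 * z - 1, ?_, ?_⟩, Subtype.ext (by simp [hi])⟩
    · linarith [p.2.1]
    · linarith [z.2.2]
  refine ⟨hi p, hi q, hlt hp, hlt hq, ?_, ?_⟩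
  · rintro z ⟨hz, hz'⟩
    obtain ⟨w, rfl⟩ := key z hz
    rw [glue_hi, glue_hi]
    rw [← Subtype.coe_lt_coe] at hz hz'
    simp only [hi] at hz hz'
    exact h1 w ⟨Subtype.coe_lt_coe.mp (by linarith), Subtype.coe_lt_coe.mp (by linarith)⟩
  · rintro z ⟨hz, hz'⟩
    obtain ⟨w, rfl⟩ := key z ((hlt hp).trans hz)
    rw [glue_hi, glue_hi]
    rw [← Subtype.coe_lt_coe] at hz hz'
    simp only [hi] at hz hz'
    exact h2 w ⟨Subtype.coe_lt_coe.mp (by linarith), Subtype.coe_lt_coe.mp (by linarith)⟩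

/-- Stack-and-shrink composition: `d` is drawn at the bottom and `e` on top of it. Thus a product of
elementary diagrams, read from left to right, describes the diagram from bottom to top. -/
noncomputable def Diagram.comp {n : ℕ} (d e : Diagram n) : Diagram n where
  perm := d.perm.trans e.perm
  strand i := glue (d.strand i) (e.strand (d.perm i)) (by rw [d.top, e.bottom])
  bottom i := by
    have h : (0 : I) = lo 0 := Subtype.ext (by simp [lo])
    exact (congrArg _ h).trans ((glue_lo _ _ _ 0).trans (d.bottom i))
  top i := by
    have h : (1 : I) = hi 1 := Subtype.ext (by norm_num [hi])
    exact (congrArg _ h).trans ((glue_hi _ _ _ 1).trans (e.top _))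
  finite_meet i j hij := by
    refine (((d.finite_meet i j hij).image lo).union
      ((e.finite_meet _ _ (d.perm.injective.ne hij)).image hi)).subset fun y hy => ?_
    rcases lo_or_hi y with ⟨z, -, rfl⟩ | ⟨z, rfl⟩
    · exact Or.inl ⟨z, by simpa only [Set.mem_ofPred_eq, glue_lo] using hy, rfl⟩
    · exact Or.inr ⟨z, by simpa only [Set.mem_ofPred_eq, glue_hi] using hy, rfl⟩
  no_triple i j k hij hjk hik y := by
    rcases lo_or_hi y with ⟨z, -, rfl⟩ | ⟨z, rfl⟩
    · simpa only [glue_lo] using d.no_triple i j k hij hjk hik z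
    · simpa only [glue_hi] using e.no_triple _ _ _ (d.perm.injective.ne hij)
        (d.perm.injective.ne hjk) (d.perm.injective.ne hik) z
  crossing i j hij y h := by
    rcases lo_or_hi y with ⟨z, -, rfl⟩ | ⟨z, rfl⟩
    · rw [glue_lo, glue_lo] at h
      exact (d.crossing i j hij z h).imp (crossesAt_lo _ _ _ _ _ _) (crossesAt_lo _ _ _ _ _ _)
    · rw [glue_hi, glue_hi] at h
      exact (e.crossing _ _ (d.perm.injective.ne hij) z h).imp
        (crossesAt_hi _ _ _ _ _ _) (crossesAt_hi _ _ _ _ _ _)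

/-! ### Webs, and the maps `ι` and `π` -/

/-- An `n`-web: any two strands intersect at most once (no bigons), and no three strands intersect
pairwise (no triangles). -/
def Diagram.IsWeb {n : ℕ} (d : Diagram n) : Prop :=
  (∀ i j, i ≠ j → {y : I | d.strand i y = d.strand j y}.Subsingleton) ∧
  ¬ ∃ i j k, i ≠ j ∧ j ≠ k ∧ i ≠ k ∧ (∃ y, d.strand i y = d.strand j y) ∧
    (∃ y, d.strand j y = d.strand k y) ∧ (∃ y, d.strand i y = d.strand k y)

/-- The set `WL_n` of `n`-webs up to isotopy. -/
def WL (n : ℕ) : Type :=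
  Quot (fun w w' : {d : Diagram n // d.IsWeb} => Isotopic w.1 w'.1)

/-- The map `ι : WL_n → DL_n` induced by the inclusion of webs into diagrams. -/
def iota {n : ℕ} : WL n → DL n :=
  Quot.lift (fun w => DL.mk w.1) fun _ _ h => Quot.sound (Move.isotopy h)

theorem Isotopic.perm_eq {n : ℕ} {d e : Diagram n} (h : Isotopic d e) : d.perm = e.perm := by
  obtain ⟨F, rfl, rfl, hF, -⟩ := h
  ext i
  have hc : Continuous fun t : I => (((F t).perm i : ℕ) : ℝ) := by
    have h1 : Continuous fun t : I => (F t).strand i 1 - 1 :=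
      ((hF i).comp (continuous_id.prodMk continuous_const)).sub continuous_const
    exact h1.congr fun t => by rw [(F t).top]; ring
  have hn : Continuous fun t : I => ((F t).perm i : ℕ) :=
    Nat.isClosedEmbedding_coe_real.isInducing.continuous_iff.mpr hc
  exact PreconnectedSpace.constant inferInstance hn

/-- The map `π : WL_n → S_(n+1)`, sending lower endpoints of strands to their upper endpoints. -/
def webPerm {n : ℕ} : WL n → Equiv.Perm (Fin (n + 1)) :=
  Quot.lift (fun w => w.1.perm) fun _ _ h => h.perm_eq

/-! ### Sequence couples, and the maps `ρ` and `φ` -/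

/-- The set `II_n` of couples of sequences `((a_1, …, a_k), (b_1, …, b_k))` of integers satisfying
`1 ≤ a_1 < ⋯ < a_k`, `b_1 < ⋯ < b_k ≤ n + 1`, and `a_t < b_t` for all `t`. -/
def II (n : ℕ) : Set (List ℕ × List ℕ) :=
  {c | c.1.Pairwise (· < ·) ∧ c.2.Pairwise (· < ·) ∧ List.Forall₂ (· < ·) c.1 c.2 ∧
    (∀ a ∈ c.1, 1 ≤ a) ∧ (∀ b ∈ c.2, b ≤ n + 1)}

/-- The right sequence couple of a permutation `s` of `{1, …, n + 1}`: the increasing sequence of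
all `a` with `a < s a`, and the sequence of their images. (The elements of `Fin (n + 1)` are shifted
by `1`.) -/
def rightCouple {n : ℕ} (s : Equiv.Perm (Fin (n + 1))) : List ℕ × List ℕ :=
  let A := (List.finRange (n + 1)).filter fun i => i < s i
  (A.map fun i => (i : ℕ) + 1, A.map fun i => (s i : ℕ) + 1)

/-- The action of the generator `x_(i+1)` on `ℕ^(n+1)`: `(…, a, b, …) ↦ (…, a, a, …)`, at the
positions `i + 1`, `i + 2`. -/
def propagate {n : ℕ} (i : Fin n) (y : Fin (n + 1) → ℕ) : Fin (n + 1) → ℕ :=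
  Function.update y i.succ (y i.castSucc)

/-- The generator `x_(i+1)` acting on `ℕ^(n+1)`, as an element of the monoid in which the product
of two maps applies the left factor first. -/
def genAct {n : ℕ} (i : Fin n) : (Function.End (Fin (n + 1) → ℕ))ᵐᵒᵖ :=
  MulOpposite.op (propagate i)

theorem genAct_unop {n : ℕ} (i : Fin n) (y : Fin (n + 1) → ℕ) :
    (genAct i).unop y = propagate i y := rfl

theorem mul_unop_apply {α : Type*} (f g : (Function.End α)ᵐᵒᵖ) (y : α) :
    (f * g).unop y = g.unop (f.unop y) := rfl

theorem genAct_rel {n : ℕ} (a b : FreeMonoid (Fin n)) (hab : HKRel n a b) :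
    FreeMonoid.lift genAct a = FreeMonoid.lift genAct b := by
  apply MulOpposite.unop_injective
  funext y k
  rcases hab with i | ⟨i, j, h⟩ | ⟨i, j, h⟩ | ⟨i, j, h⟩ <;>
    simp only [map_mul, FreeMonoid.lift_eval_of, mul_unop_apply, genAct_unop, propagate,
      Function.update_apply, Fin.ext_iff, Fin.val_castSucc, Fin.val_succ] <;>
    split_ifs <;> first | rfl | omega

/-- The action of `L_n` on `ℕ^(n+1)`: a word acts by applying its letters one after the other, from
left to right. -/
def act (n : ℕ) : LMonoid n →* (Function.End (Fin (n + 1) → ℕ))ᵐᵒᵖ :=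
  PresentedMonoid.lift genAct genAct_rel

/-- The couple read off `y ∈ ℕ^(n+1)`: the `a`'s are the values present in `y`, in increasing
order, and the `b` corresponding to `a` is the place of the rightmost occurrence of `a` in `y`;
the pairs with `a = b` are thrown away. -/
def coupleOf {n : ℕ} (y : Fin (n + 1) → ℕ) : List ℕ × List ℕ :=
  ((((Finset.univ.image y).sort (· ≤ ·)).map fun a =>
    (a, (Finset.univ.filter fun j => y j = a).sup fun j => (j : ℕ) + 1)).filter
      fun c => c.1 ≠ c.2).unzip

/-- The map `φ`, given by the action on `(1, 2, …, n + 1)`. -/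
def phi {n : ℕ} (x : LMonoid n) : List ℕ × List ℕ :=
  coupleOf ((act n x).unop fun k => (k : ℕ) + 1)

/-! ### Running time

Algorithms are programs for a random access machine whose memory cells hold natural numbers, with
a read-only input list and a write-only output list. The arithmetic is limited to the successor and
the predecessor, so that unit costs are realistic. -/

/-- Instructions. `mem r` is the content of the memory cell `r`. -/
inductive Instr
  /-- `mem r := c` -/
  | const (r c : ℕ)
  /-- `mem r := mem s` -/
  | copy (r s : ℕ)
  /-- `mem r := mem r + 1` -/
  | inc (r : ℕ)
  /-- `mem r := mem r - 1` (truncated at `0`) -/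
  | dec (r : ℕ)
  /-- `mem r := mem (mem s)` -/
  | load (r s : ℕ)
  /-- `mem (mem r) := mem s` -/
  | store (r s : ℕ)
  /-- move the next input symbol to `mem r` (`0` if the input is exhausted) -/
  | read (r : ℕ)
  /-- append `mem r` to the output -/
  | write (r : ℕ)
  /-- jump to instruction `l` if `mem r = mem s` -/
  | jumpEq (r s l : ℕ)

/-- Configurations of the machine. -/
structure Config where
  pc : ℕ
  mem : ℕ → ℕ
  input : List ℕ
  output : List ℕ

/-- The effect of one instruction. -/
def Instr.exec (c : Config) : Instr → Config
  | .const r k => { c with pc := c.pc + 1, mem := Function.update c.mem r k }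
  | .copy r s => { c with pc := c.pc + 1, mem := Function.update c.mem r (c.mem s) }
  | .inc r => { c with pc := c.pc + 1, mem := Function.update c.mem r (c.mem r + 1) }
  | .dec r => { c with pc := c.pc + 1, mem := Function.update c.mem r (c.mem r - 1) }
  | .load r s => { c with pc := c.pc + 1, mem := Function.update c.mem r (c.mem (c.mem s)) }
  | .store r s => { c with pc := c.pc + 1, mem := Function.update c.mem (c.mem r) (c.mem s) }
  | .read r => { c with
      pc := c.pc + 1, mem := Function.update c.mem r (c.input.headD 0), input := c.input.tail }
  | .write r => { c with pc := c.pc + 1, output := c.output ++ [c.mem r] }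
  | .jumpEq r s l => { c with pc := if c.mem r = c.mem s then l else c.pc + 1 }

/-- One step of the program `P`; the machine stands still once the program counter has left `P`. -/
def step (P : List Instr) (c : Config) : Config :=
  match P[c.pc]? with
  | some i => i.exec c
  | none => c

/-- On the input `inp`, the program `P` halts after at most `T` steps with the output `out`. -/
def HaltsWithin (P : List Instr) (inp out : List ℕ) (T : ℕ) : Prop :=
  ∃ t ≤ T, P.length ≤ ((step P)^[t] ⟨0, fun _ => 0, inp, []⟩).pc ∧
    ((step P)^[t] ⟨0, fun _ => 0, inp, []⟩).output = out

/-- The input encoding of a word in the generators of `L_n`: `n`, the length of the word, and the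
indices (from `1` to `n`) of its letters. -/
def encodeWord {n : ℕ} (w : List (Fin n)) : List ℕ :=
  n :: w.length :: w.map fun i => (i : ℕ) + 1

/-- The output encoding `a_1, b_1, a_2, b_2, …` of a sequence couple. -/
def encodeCouple (c : List ℕ × List ℕ) : List ℕ :=
  (c.1.zip c.2).flatMap fun p => [p.1, p.2]

end HeckeKiselman

/-!
The defining relations of `L_n` hold in `DL_n` up to isotopy, `2`-moves and `3`-moves, so that there
is a homomorphism `ε` (`eps`). It is surjective: the topmost crossings of a diagram can be split
off, up to isotopy, as a product of disjoint elementary diagrams (`Diagram.exists_peel`). The same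
induction shows that a web is isotopic to the diagram of straight strands with the same endpoints
(`Diagram.IsWeb.isotopic_straight`), so that webs up to isotopy correspond to `321`-avoiding
permutations. All isotopies are built from two constructions. A diagram can be reparametrized and
its strands moved as long as their left-to-right order at each height is kept (`isotopic_of_order`),
and two strands of a straight diagram may be drawn with a bend (`isotopic_straight_comp`).

Injectivity of `ε` and of `ι` comes from an invariant of diagrams, `Diagram.Trace`: it tells how far
to the right one can climb from the `a`-th lower endpoint, if one may change strands at crossings.
It is invariant under the local moves, because in each of their patterns one can go from every
strand entering the box to the strand that leaves it as the rightmost one. It is invariant under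
isotopy, because the set of times at which a given endpoint can be reached with at most `M` changes
of strands is closed by compactness and open by the stability of crossings (`isClosed_reachN`,
`isOpen_reachStrict`). The trace of `ε x` is equivalent to the sequence `vec x` obtained by the
action of `x` on `(1, …, n + 1)` (`trace_eps`), and an element of `L_n` is determined by this
sequence, as it equals a normal form that is written in terms of the sequence (`eq_normalForm`).

The trace of a straight diagram is read off from its permutation `s`: the entry of the sequence at
the place `k` is the smallest `i` with `k ≤ s i` (`trace_straight`). Every sequence `vec x` is given
in this way by some `321`-avoiding `s` (`exists_avoids321_represents`), which proves the
surjectivity of `ι`. For such `s` the couple of the sequence is the couple of excedances of `s`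
(`coupleOf_eq_rightCouple`). Since `321`-avoiding permutations are determined by their excedances,
which can be prescribed arbitrarily in `II_n` (`Avoids321.eq_of_excedances`,
`exists_rightCouple`), all the maps in question are bijections.

The sequences `vec x` are weakly increasing, so that the couple can be written out in one pass over
the sequence; this is what the program does (`program_computes_phi`).
-/

namespace HeckeKiselman

/-! ### Constructing isotopies -/

theorem Diagram.ext_of {n : ℕ} {d e : Diagram n} (hp : d.perm = e.perm)
    (hs : ∀ i y, d.strand i y = e.strand i y) : d = e := by
  have hs' : d.strand = e.strand := funext fun i => ContinuousMap.ext (hs i)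
  cases d
  cases e
  simp only at hp hs'
  subst hp
  subst hs'
  rfl

theorem Diagram.bottom_ne {n : ℕ} (d : Diagram n) {i j : Fin (n + 1)} (h : i ≠ j) :
    d.strand i 0 ≠ d.strand j 0 := by
  rw [d.bottom, d.bottom]
  intro h'
  exact h (Fin.ext (by exact_mod_cast add_right_cancel h'))

theorem Diagram.top_ne {n : ℕ} (d : Diagram n) {i j : Fin (n + 1)} (h : i ≠ j) :
    d.strand i 1 ≠ d.strand j 1 := by
  rw [d.top, d.top]
  intro h'
  exact h (d.perm.injective (Fin.ext (by exact_mod_cast add_right_cancel h')))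

/-- The height of a meeting point of two distinct strands lies strictly between `0` and `1`. -/
theorem Diagram.meet_pos {n : ℕ} (d : Diagram n) {i j : Fin (n + 1)} (h : i ≠ j) {y : I}
    (hy : d.strand i y = d.strand j y) : 0 < y ∧ y < 1 := by
  constructor
  · refine lt_of_le_of_ne y.2.1 ?_
    rintro rfl
    exact d.bottom_ne h hy
  · refine lt_of_le_of_ne y.2.2 ?_
    rintro rfl
    exact d.top_ne h hy

theorem Diagram.crossings_finite {n : ℕ} (d : Diagram n) : d.crossings.Finite := by
  have h : (⋃ i : Fin (n + 1), ⋃ j : Fin (n + 1), ⋃ _ : i ≠ j,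
      (fun y => (i, j, y)) '' {y : I | d.strand i y = d.strand j y}).Finite :=
    Set.finite_iUnion fun i => Set.finite_iUnion fun j => Set.finite_iUnion fun hij =>
      (d.finite_meet i j hij).image _
  refine h.subset ?_
  rintro ⟨i, j, y⟩ ⟨h1, h2⟩
  simp only [Set.mem_iUnion]
  exact ⟨i, j, ne_of_lt h1, y, h2, rfl⟩

/-- Sign changes survive a monotone change of heights that is strict at the crossing. -/
theorem CrossesAt.pull {f f' e e' : I → ℝ} {g : I → I} (hg : Continuous g) {y : I}
    (hlt : ∀ z, z < y → g z < g y) (hgt : ∀ z, y < z → g y < g z) (h0 : 0 < y) (h1 : y < 1)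
    (ho : ∀ z, f (g z) < f' (g z) → e z < e' z) (ho' : ∀ z, f' (g z) < f (g z) → e' z < e z)
    (h : CrossesAt f f' (g y)) : CrossesAt e e' y := by
  obtain ⟨a, b, ha, hb, h2, h3⟩ := h
  have ha' : {z | a < g z} ∈ nhds y := (isOpen_lt continuous_const hg).mem_nhds ha
  have hb' : {z | g z < b} ∈ nhds y := (isOpen_lt hg continuous_const).mem_nhds hb
  obtain ⟨a', ha1, ha2⟩ := exists_Ioc_subset_of_mem_nhds ha' ⟨0, h0⟩
  obtain ⟨b', hb1, hb2⟩ := exists_Ico_subset_of_mem_nhds hb' ⟨1, h1⟩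
  refine ⟨a', b', ha1, hb1, fun z hz => ho z (h2 _ ⟨ha2 ⟨hz.1, hz.2.le⟩, hlt z hz.2⟩),
    fun z hz => ho' z (h3 _ ⟨hgt z hz.1, hb2 ⟨hz.1.le, hz.2⟩⟩)⟩

theorem eq_iff_of_order {ι : Type*} {a b : ι → ℝ} (h : ∀ i j, a i < a j ↔ b i < b j) (i j : ι) :
    a i = a j ↔ b i = b j := by
  rw [le_antisymm_iff, le_antisymm_iff, ← not_lt, ← not_lt, h, h, not_lt, not_lt]

/-- The diagram with strands `e i` whose left-to-right order at the height `y` is the order of the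
strands of `d` at the height `g y`. The monotone map `g` is injective except over the two ends. -/
def Diagram.pull {n : ℕ} (d : Diagram n) (g : C(I, I)) (hm : Monotone g)
    (hs : ∀ y z, y < z → g y = g z → g y = 0 ∨ g y = 1) (p : Equiv.Perm (Fin (n + 1)))
    (e : Fin (n + 1) → C(I, ℝ)) (bottom : ∀ i, e i 0 = (i : ℝ) + 1)
    (top : ∀ i, e i 1 = (p i : ℝ) + 1)
    (ord : ∀ y i j, e i y < e j y ↔ d.strand i (g y) < d.strand j (g y)) : Diagram n where
  perm := p
  strand := e
  bottom := bottom
  top := top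
  finite_meet i j hij := by
    have h : {y : I | e i y = e j y} = g ⁻¹' {y | d.strand i y = d.strand j y} := by
      ext y
      exact eq_iff_of_order (ord y) i j
    rw [h]
    refine (d.finite_meet i j hij).preimage fun y hy z hz hyz => ?_
    have hy' := d.meet_pos hij hy
    have hz' := d.meet_pos hij hz
    rcases lt_trichotomy y z with hlt | heq | hlt
    · rcases hs y z hlt hyz with h | h
      · exact absurd h hy'.1.ne'
      · exact absurd h hy'.2.ne
    · exact heq
    · rcases hs z y hlt hyz.symm with h | h
      · exact absurd h hz'.1.ne'
      · exact absurd h hz'.2.ne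
  no_triple i j k hij hjk hik y := by
    rw [eq_iff_of_order (ord y), eq_iff_of_order (ord y)]
    exact d.no_triple i j k hij hjk hik (g y)
  crossing i j hij y hy := by
    have hy2 := (eq_iff_of_order (ord y) i j).1 hy
    have hgy := d.meet_pos hij hy2
    have key : ∀ z w, z < w → (z = y ∨ w = y) → g z < g w := by
      intro z w hzw hor
      refine lt_of_le_of_ne (hm hzw.le) fun heq => ?_
      have h01 := hs z w hzw heq
      have hz : g z = g y := by rcases hor with rfl | rfl <;> simp [heq]
      rw [hz] at h01
      rcases h01 with h | h
      · exact hgy.1.ne' h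
      · exact hgy.2.ne h
    have h0 : 0 < y := by
      refine lt_of_le_of_ne y.2.1 ?_
      rintro rfl
      rw [bottom, bottom] at hy
      exact hij (Fin.ext (by exact_mod_cast add_right_cancel hy))
    have h1 : y < 1 := by
      refine lt_of_le_of_ne y.2.2 ?_
      rintro rfl
      rw [top, top] at hy
      exact hij (p.injective (Fin.ext (by exact_mod_cast add_right_cancel hy)))
    refine (d.crossing i j hij _ hy2).imp ?_ ?_
    · exact CrossesAt.pull g.continuous (fun z hz => key z y hz (Or.inr rfl))
        (fun z hz => key y z hz (Or.inl rfl)) h0 h1 (fun z => (ord z i j).2) fun z => (ord z j i).2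
    · exact CrossesAt.pull g.continuous (fun z hz => key z y hz (Or.inr rfl))
        (fun z hz => key y z hz (Or.inl rfl)) h0 h1 (fun z => (ord z j i).2) fun z => (ord z i j).2

theorem surjective_of_ends {g : C(I, I)} (h0 : g 0 = 0) (h1 : g 1 = 1) : Function.Surjective g := by
  intro y
  have h := intermediate_value_univ (f := g) 0 1 g.continuous
  rw [h0, h1] at h
  exact h ⟨y.2.1, y.2.2⟩

/-- A diagram with the same shape, up to a reparametrization of the heights, has the same number of
crossings. -/
theorem ncard_crossings_of_order {n : ℕ} {d e : Diagram n} {g : C(I, I)}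
    (hs : ∀ y z, y < z → g y = g z → g y = 0 ∨ g y = 1) (h0 : g 0 = 0) (h1 : g 1 = 1)
    (ord : ∀ y i j, e.strand i y < e.strand j y ↔ d.strand i (g y) < d.strand j (g y)) :
    e.crossings.ncard = d.crossings.ncard := by
  have him : (fun c : Fin (n + 1) × Fin (n + 1) × I => (c.1, c.2.1, g c.2.2)) '' e.crossings =
      d.crossings := by
    ext ⟨i, j, y⟩
    constructor
    · rintro ⟨⟨i', j', y'⟩, ⟨h, h'⟩, heq⟩
      simp only [Prod.mk.injEq] at heq
      obtain ⟨rfl, rfl, rfl⟩ := heq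
      exact ⟨h, (eq_iff_of_order (ord y') _ _).1 h'⟩
    · rintro ⟨h, h'⟩
      obtain ⟨z, rfl⟩ := surjective_of_ends h0 h1 y
      exact ⟨(i, j, z), ⟨h, (eq_iff_of_order (ord z) _ _).2 h'⟩, rfl⟩
  rw [← him, Set.InjOn.ncard_image]
  rintro ⟨i, j, y⟩ ⟨h, h'⟩ ⟨i', j', y'⟩ ⟨k, k'⟩ heq
  simp only [Prod.mk.injEq] at heq h h' k k' ⊢
  obtain ⟨rfl, rfl, heq⟩ := heq
  have hy := d.meet_pos (ne_of_lt h) ((eq_iff_of_order (ord y) _ _).1 h')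
  refine ⟨rfl, rfl, ?_⟩
  rcases lt_trichotomy y y' with hlt | heq' | hlt
  · rcases hs y y' hlt heq with h | h
    · exact absurd h hy.1.ne'
    · exact absurd h hy.2.ne
  · exact heq'
  · rcases hs y' y hlt heq.symm with h | h
    · exact absurd (heq.trans h) hy.1.ne'
    · exact absurd (heq.trans h) hy.2.ne

/-- Linear interpolation between two functions of the height. -/
noncomputable def lerp (f g : C(I, ℝ)) (t : I) : C(I, ℝ) where
  toFun y := (1 - (t : ℝ)) * f y + t * g y

theorem lerp_apply (f g : C(I, ℝ)) (t y : I) :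
    lerp f g t y = (1 - (t : ℝ)) * f y + t * g y := rfl

theorem continuous_lerp (f g : C(I, ℝ)) : Continuous fun p : I × I => lerp f g p.1 p.2 := by
  simp only [lerp_apply]
  fun_prop

theorem lerp_lt {a b a' b' : ℝ} (t : I) (h : a < b) (h' : a' < b') :
    (1 - (t : ℝ)) * a + t * a' < (1 - (t : ℝ)) * b + t * b' := by
  rcases eq_or_lt_of_le t.2.1 with h0 | h0
  · rw [← h0]; simpa
  · nlinarith [t.2.2]

theorem lerp_lt_iff {ι : Type*} {a b : ι → ℝ} (h : ∀ i j, b i < b j ↔ a i < a j) (t : I)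
    (i j : ι) : (1 - (t : ℝ)) * a i + t * b i < (1 - (t : ℝ)) * a j + t * b j ↔ a i < a j := by
  constructor
  · intro hlt
    by_contra hc
    rcases eq_or_lt_of_le (not_lt.1 hc) with he | hl
    · have := (eq_iff_of_order h j i).2 he
      rw [he, this] at hlt
      exact hlt.false
    · exact (lerp_lt t hl ((h j i).2 hl)).asymm hlt
  · intro hlt
    exact lerp_lt t hlt ((h i j).2 hlt)

/-- Interpolation between the identity and a map from the interval to itself. -/
noncomputable def lerpI (g : C(I, I)) (t : I) : C(I, I) where
  toFun y := ⟨(1 - (t : ℝ)) * y + t * g y,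
    by nlinarith [t.2.1, t.2.2, y.2.1, (g y).2.1, mul_nonneg (sub_nonneg.2 t.2.2) y.2.1,
      mul_nonneg t.2.1 (g y).2.1],
    by nlinarith [t.2.1, t.2.2, y.2.2, (g y).2.2,
      mul_nonneg (sub_nonneg.2 t.2.2) (sub_nonneg.2 y.2.2),
      mul_nonneg t.2.1 (sub_nonneg.2 (g y).2.2)]⟩
  continuous_toFun := by fun_prop

theorem lerpI_val (g : C(I, I)) (t y : I) :
    ((lerpI g t y : I) : ℝ) = (1 - (t : ℝ)) * y + t * g y := rfl

theorem Isotopic.trans {n : ℕ} {d e f : Diagram n} (h : Isotopic d e) (h' : Isotopic e f) :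
    Isotopic d f := by
  obtain ⟨F, hF0, hF1, hFc, hFn⟩ := h
  obtain ⟨G, hG0, hG1, hGc, hGn⟩ := h'
  refine ⟨fun t => if (t : ℝ) ≤ 1 / 2 then F (Set.projIcc 0 1 zero_le_one (2 * (t : ℝ)))
    else G (Set.projIcc 0 1 zero_le_one (2 * (t : ℝ) - 1)), ?_, ?_, ?_, ?_⟩
  · simp [hF0]
  · norm_num [hG1]
  · intro i
    have : (fun p : I × I => (if (p.1 : ℝ) ≤ 1 / 2 then
        F (Set.projIcc 0 1 zero_le_one (2 * (p.1 : ℝ)))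
        else G (Set.projIcc 0 1 zero_le_one (2 * (p.1 : ℝ) - 1))).strand i p.2) =
        fun p : I × I => if (p.1 : ℝ) ≤ 1 / 2 then
          (F (Set.projIcc 0 1 zero_le_one (2 * (p.1 : ℝ)))).strand i p.2
          else (G (Set.projIcc 0 1 zero_le_one (2 * (p.1 : ℝ) - 1))).strand i p.2 := by
      funext p
      split_ifs <;> rfl
    rw [this]
    refine Continuous.if_le ?_ ?_ (by fun_prop) (by fun_prop) ?_
    · exact (hFc i).comp (((continuous_projIcc (h := zero_le_one)).comp (by fun_prop)).prodMk
        continuous_snd)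
    · exact (hGc i).comp (((continuous_projIcc (h := zero_le_one)).comp (by fun_prop)).prodMk
        continuous_snd)
    · intro p hp
      rw [hp]
      norm_num [hF1, hG0]
  · intro t
    have hde : e.crossings.ncard = d.crossings.ncard := by rw [← hFn 1, hF1]
    simp only
    split_ifs
    · exact hFn _
    · rw [hGn, hde]

theorem Isotopic.refl {n : ℕ} (d : Diagram n) : Isotopic d d :=
  ⟨fun _ => d, rfl, rfl, fun i => by fun_prop, fun _ => rfl⟩

/-- A diagram of the same shape as `d`, up to a reparametrization of the heights, is isotopic to
`d`: reparametrize first and then interpolate linearly between the strands. -/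
theorem isotopic_of_order {n : ℕ} {d e : Diagram n} (hp : e.perm = d.perm) (g : C(I, I))
    (hm : Monotone g) (hs : ∀ y z, y < z → g y = g z → g y = 0 ∨ g y = 1) (h0 : g 0 = 0)
    (h1 : g 1 = 1)
    (ord : ∀ y i j, e.strand i y < e.strand j y ↔ d.strand i (g y) < d.strand j (g y)) :
    Isotopic d e := by
  have hm' : ∀ t, Monotone (lerpI g t) := by
    intro t y z hyz
    have h2 : (y : ℝ) ≤ z := hyz
    have h3 : ((g y : I) : ℝ) ≤ g z := hm hyz
    rw [← Subtype.coe_le_coe, lerpI_val, lerpI_val]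
    have := mul_le_mul_of_nonneg_left h2 (sub_nonneg.2 t.2.2)
    have := mul_le_mul_of_nonneg_left h3 t.2.1
    linarith
  have hs' : ∀ t y z, y < z → lerpI g t y = lerpI g t z →
      lerpI g t y = 0 ∨ lerpI g t y = 1 := by
    intro t y z hyz heq
    have h2 : (y : ℝ) < z := hyz
    have h3 : ((g y : I) : ℝ) ≤ g z := hm hyz.le
    have heq' := congrArg Subtype.val heq
    rw [lerpI_val, lerpI_val] at heq'
    have h4 := mul_le_mul_of_nonneg_left h3 t.2.1
    have h5 := mul_le_mul_of_nonneg_left h2.le (sub_nonneg.2 t.2.2)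
    have ht : (t : ℝ) = 1 := by
      by_contra hc
      have h6 : 0 < 1 - (t : ℝ) := sub_pos.2 (lt_of_le_of_ne t.2.2 hc)
      have := mul_lt_mul_of_pos_left h2 h6
      linarith
    have hl : ∀ w, lerpI g t w = g w := fun w => Subtype.ext (by rw [lerpI_val, ht]; ring)
    rw [hl, hl] at heq
    rw [hl]
    exact hs y z hyz heq
  have hl0 : ∀ t, lerpI g t 0 = 0 := fun t => Subtype.ext (by rw [lerpI_val, h0]; simp)
  have hl1 : ∀ t, lerpI g t 1 = 1 := fun t => Subtype.ext (by rw [lerpI_val, h1]; simp)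
  let F : I → Diagram n := fun t => d.pull (lerpI g t) (hm' t) (hs' t) d.perm
    (fun i => (d.strand i).comp (lerpI g t)) (fun i => by simp [hl0, d.bottom])
    (fun i => by simp [hl1, d.top]) (fun y i j => Iff.rfl)
  let G : I → Diagram n := fun t => d.pull g hm hs d.perm
    (fun i => lerp ((d.strand i).comp g) (e.strand i) t)
    (fun i => by rw [lerp_apply, ContinuousMap.comp_apply, h0, d.bottom, e.bottom]; ring)
    (fun i => by rw [lerp_apply, ContinuousMap.comp_apply, h1, d.top, e.top, hp]; ring)
    (fun y i j => lerp_lt_iff (a := fun i => d.strand i (g y)) (b := fun i => e.strand i y)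
      (ord y) t i j)
  have hFG : F 1 = G 0 := by
    refine Diagram.ext_of rfl fun i y => ?_
    change d.strand i (lerpI g 1 y) = (1 - ((0 : I) : ℝ)) * d.strand i (g y) + (0 : I) * e.strand i y
    have : lerpI g 1 y = g y := Subtype.ext (by rw [lerpI_val]; simp)
    rw [this]; simp
  refine Isotopic.trans (e := F 1) ⟨F, ?_, rfl, ?_, ?_⟩ ⟨G, hFG.symm, ?_, ?_, ?_⟩
  · refine Diagram.ext_of rfl fun i y => ?_
    change d.strand i (lerpI g 0 y) = _
    have : lerpI g 0 y = y := Subtype.ext (by rw [lerpI_val]; simp)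
    rw [this]
  · intro i
    change Continuous fun p : I × I => d.strand i (lerpI g p.1 p.2)
    refine (d.strand i).continuous.comp (Continuous.subtype_mk ?_ _)
    fun_prop
  · intro t
    exact ncard_crossings_of_order (hs' t) (hl0 t) (hl1 t) fun y i j => Iff.rfl
  · refine Diagram.ext_of hp.symm fun i y => ?_
    change (1 - ((1 : I) : ℝ)) * d.strand i (g y) + (1 : I) * e.strand i y = _
    simp
  · intro i
    exact continuous_lerp _ _
  · intro t
    rw [hFG]
    have hG : ∀ t, (G t).crossings.ncard = d.crossings.ncard := fun t =>
      ncard_crossings_of_order hs h0 h1 fun y i j =>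
        lerp_lt_iff (a := fun i => d.strand i (g y)) (b := fun i => e.strand i y) (ord y) t i j
    rw [hG, hG]

theorem isotopic_of_same_order {n : ℕ} {d e : Diagram n} (hp : e.perm = d.perm)
    (ord : ∀ y i j, e.strand i y < e.strand j y ↔ d.strand i y < d.strand j y) :
    Isotopic d e :=
  isotopic_of_order hp (.id I) monotone_id (fun _ _ h h' => absurd h' h.ne) rfl rfl ord

theorem Isotopic.symm {n : ℕ} {d e : Diagram n} (h : Isotopic d e) : Isotopic e d := by
  obtain ⟨F, hF0, hF1, hFc, hFn⟩ := h
  refine ⟨fun t => F (σ t), by simp [hF1], by simp [hF0], fun i => ?_, fun t => ?_⟩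
  · exact (hFc i).comp ((unitInterval.continuous_symm.comp continuous_fst).prodMk continuous_snd)
  · rw [hFn, ← hF1, hFn]

/-! ### Isotopies and composition -/

theorem comp_strand_lo {n : ℕ} (d e : Diagram n) (i : Fin (n + 1)) (y : I) :
    (d.comp e).strand i (lo y) = d.strand i y := glue_lo _ _ _ y

theorem comp_strand_hi {n : ℕ} (d e : Diagram n) (i : Fin (n + 1)) (y : I) :
    (d.comp e).strand i (hi y) = e.strand (d.perm i) y := glue_hi _ _ _ y

theorem comp_perm {n : ℕ} (d e : Diagram n) : (d.comp e).perm = d.perm.trans e.perm := rfl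

theorem comp_perm_apply {n : ℕ} (d e : Diagram n) (i : Fin (n + 1)) :
    (d.comp e).perm i = e.perm (d.perm i) := rfl

theorem lo_one : lo 1 = hi 0 := Subtype.ext (by simp [lo, hi])
theorem lo_zero : lo 0 = 0 := Subtype.ext (by simp [lo])
theorem hi_one : hi 1 = 1 := Subtype.ext (by norm_num [hi])

theorem lo_val (y : I) : ((lo y : I) : ℝ) = y / 2 := rfl
theorem hi_val (y : I) : ((hi y : I) : ℝ) = (1 + y) / 2 := rfl

theorem lo_strictMono : StrictMono lo := fun y z h => by
  have h : (y : ℝ) < z := h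
  rw [← Subtype.coe_lt_coe, lo_val, lo_val]
  linarith

theorem hi_strictMono : StrictMono hi := fun y z h => by
  have h : (y : ℝ) < z := h
  rw [← Subtype.coe_lt_coe, hi_val, hi_val]
  linarith

theorem lo_eq_hi {y z : I} (h : lo y = hi z) : y = 1 ∧ z = 0 := by
  have h := congrArg Subtype.val h
  rw [lo_val, hi_val] at h
  constructor
  · exact Subtype.ext (le_antisymm y.2.2 (by change (1 : ℝ) ≤ y; linarith [z.2.1]))
  · exact Subtype.ext (le_antisymm (by change (z : ℝ) ≤ 0; linarith [y.2.2]) z.2.1)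

theorem comp_strand_eq_ite {n : ℕ} (d e : Diagram n) (i : Fin (n + 1)) (y : I) :
    (d.comp e).strand i y = if (y : ℝ) ≤ 1 / 2 then
      d.strand i (Set.projIcc 0 1 zero_le_one (2 * (y : ℝ))) else
      e.strand (d.perm i) (Set.projIcc 0 1 zero_le_one (2 * (y : ℝ) - 1)) := by
  rcases lo_or_hi y with ⟨z, -, rfl⟩ | ⟨z, rfl⟩
  · have h1 : ((lo z : I) : ℝ) ≤ 1 / 2 := by rw [lo_val]; linarith [z.2.2]
    have h2 : 2 * ((lo z : I) : ℝ) = z := by rw [lo_val]; ring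
    rw [if_pos h1, h2, Set.projIcc_val, comp_strand_lo]
  · by_cases hz : (z : ℝ) = 0
    · obtain rfl : z = 0 := Subtype.ext hz
      rw [comp_strand_hi]
      norm_num [hi_val, e.bottom, d.top]
    · have h0 : 0 < (z : ℝ) := lt_of_le_of_ne z.2.1 (Ne.symm hz)
      have h1 : ¬ ((hi z : I) : ℝ) ≤ 1 / 2 := by rw [hi_val]; linarith
      have h2 : 2 * ((hi z : I) : ℝ) - 1 = z := by rw [hi_val]; ring
      rw [if_neg h1, h2, Set.projIcc_val, comp_strand_hi]

/-- The crossings of a diagram, each counted with both orders of the two strands. -/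
def Diagram.crossings₂ {n : ℕ} (d : Diagram n) : Set (Fin (n + 1) × Fin (n + 1) × I) :=
  {c | c.1 ≠ c.2.1 ∧ d.strand c.1 c.2.2 = d.strand c.2.1 c.2.2}

theorem Diagram.crossings₂_eq {n : ℕ} (d : Diagram n) : d.crossings₂ = d.crossings ∪
    (fun c : Fin (n + 1) × Fin (n + 1) × I => (c.2.1, c.1, c.2.2)) '' d.crossings := by
  ext ⟨i, j, y⟩
  constructor
  · rintro ⟨h, h'⟩
    rcases lt_or_gt_of_ne h with h | h
    · exact Or.inl ⟨h, h'⟩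
    · exact Or.inr ⟨(j, i, y), ⟨h, h'.symm⟩, rfl⟩
  · rintro (⟨h, h'⟩ | ⟨⟨i', j', y'⟩, ⟨h, h'⟩, heq⟩)
    · exact ⟨ne_of_lt h, h'⟩
    · simp only [Prod.mk.injEq] at heq
      obtain ⟨rfl, rfl, rfl⟩ := heq
      exact ⟨(ne_of_lt h).symm, h'.symm⟩

theorem Diagram.crossings₂_finite {n : ℕ} (d : Diagram n) : d.crossings₂.Finite := by
  rw [d.crossings₂_eq]
  exact d.crossings_finite.union (d.crossings_finite.image _)

theorem Diagram.ncard_crossings₂ {n : ℕ} (d : Diagram n) :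
    d.crossings₂.ncard = 2 * d.crossings.ncard := by
  rw [d.crossings₂_eq, Set.ncard_union_eq _ d.crossings_finite (d.crossings_finite.image _),
    Set.ncard_image_of_injective, two_mul]
  · rintro ⟨i, j, y⟩ ⟨i', j', y'⟩ h
    simp only [Prod.mk.injEq] at h ⊢
    exact ⟨h.2.1, h.1, h.2.2⟩
  · rw [Set.disjoint_left]
    rintro ⟨i, j, y⟩ ⟨h, -⟩ ⟨⟨i', j', y'⟩, ⟨h', -⟩, heq⟩
    simp only [Prod.mk.injEq] at heq h h'
    obtain ⟨rfl, rfl, -⟩ := heq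
    exact h.asymm h'

theorem crossings₂_comp {n : ℕ} (d e : Diagram n) : (d.comp e).crossings₂ =
    (fun c : Fin (n + 1) × Fin (n + 1) × I => (c.1, c.2.1, lo c.2.2)) '' d.crossings₂ ∪
    (fun c : Fin (n + 1) × Fin (n + 1) × I =>
      (d.perm.symm c.1, d.perm.symm c.2.1, hi c.2.2)) '' e.crossings₂ := by
  ext ⟨i, j, y⟩
  constructor
  · rintro ⟨h, h'⟩
    simp only at h h'
    rcases lo_or_hi y with ⟨z, -, rfl⟩ | ⟨z, rfl⟩
    · rw [comp_strand_lo, comp_strand_lo] at h'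
      exact Or.inl ⟨(i, j, z), ⟨h, h'⟩, rfl⟩
    · rw [comp_strand_hi, comp_strand_hi] at h'
      exact Or.inr ⟨(d.perm i, d.perm j, z), ⟨d.perm.injective.ne h, h'⟩, by simp⟩
  · rintro (⟨⟨i', j', y'⟩, ⟨h, h'⟩, heq⟩ | ⟨⟨i', j', y'⟩, ⟨h, h'⟩, heq⟩)
    · simp only [Prod.mk.injEq] at heq
      obtain ⟨rfl, rfl, rfl⟩ := heq
      exact ⟨h, by simpa only [comp_strand_lo] using h'⟩
    · simp only [Prod.mk.injEq] at heq
      obtain ⟨rfl, rfl, rfl⟩ := heq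
      exact ⟨d.perm.symm.injective.ne h,
        by simpa only [comp_strand_hi, Equiv.apply_symm_apply] using h'⟩

theorem ncard_crossings_comp {n : ℕ} (d e : Diagram n) :
    (d.comp e).crossings.ncard = d.crossings.ncard + e.crossings.ncard := by
  have h : (d.comp e).crossings₂.ncard = d.crossings₂.ncard + e.crossings₂.ncard := by
    rw [crossings₂_comp, Set.ncard_union_eq _ (d.crossings₂_finite.image _)
      (e.crossings₂_finite.image _), Set.ncard_image_of_injective, Set.ncard_image_of_injective]
    · rintro ⟨i, j, y⟩ ⟨i', j', y'⟩ h
      simp only [Prod.mk.injEq, EmbeddingLike.apply_eq_iff_eq] at h ⊢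
      exact ⟨h.1, h.2.1, hi_strictMono.injective h.2.2⟩
    · rintro ⟨i, j, y⟩ ⟨i', j', y'⟩ h
      simp only [Prod.mk.injEq] at h ⊢
      exact ⟨h.1, h.2.1, lo_strictMono.injective h.2.2⟩
    · rw [Set.disjoint_left]
      rintro _ ⟨⟨i, j, y⟩, ⟨h, h'⟩, rfl⟩ ⟨⟨i', j', y'⟩, ⟨k, k'⟩, heq⟩
      simp only [Prod.mk.injEq] at heq
      have hy := (lo_eq_hi heq.2.2.symm).1
      exact (d.meet_pos h h').2.ne hy
  rw [Diagram.ncard_crossings₂, Diagram.ncard_crossings₂, Diagram.ncard_crossings₂] at h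
  linarith

theorem perm_eq_of_continuous {n : ℕ} {F : I → Diagram n}
    (hF : ∀ i, Continuous fun p : I × I => (F p.1).strand i p.2) (s t : I) :
    (F s).perm = (F t).perm := by
  ext i
  have hc : Continuous fun t : I => (((F t).perm i : ℕ) : ℝ) := by
    have h1 : Continuous fun t : I => (F t).strand i 1 - 1 :=
      ((hF i).comp (continuous_id.prodMk continuous_const)).sub continuous_const
    exact h1.congr fun t => by rw [(F t).top]; ring
  have hn : Continuous fun t : I => ((F t).perm i : ℕ) :=
    Nat.isClosedEmbedding_coe_real.isInducing.continuous_iff.mpr hc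
  exact PreconnectedSpace.constant inferInstance hn

theorem Isotopic.comp {n : ℕ} {d d' e e' : Diagram n} (h : Isotopic d d') (h' : Isotopic e e') :
    Isotopic (d.comp e) (d'.comp e') := by
  obtain ⟨F, hF0, hF1, hFc, hFn⟩ := h
  obtain ⟨G, hG0, hG1, hGc, hGn⟩ := h'
  refine ⟨fun t => (F t).comp (G t), by simp only [hF0, hG0], by simp only [hF1, hG1],
    fun i => ?_, fun t => ?_⟩
  · simp only [comp_strand_eq_ite]
    refine Continuous.if_le ?_ ?_ (by fun_prop) (by fun_prop) ?_
    · exact (hFc i).comp (continuous_fst.prodMk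
        ((continuous_projIcc (h := zero_le_one)).comp (by fun_prop)))
    · have hp : ∀ t, (F t).perm i = (F 0).perm i := fun t => by
        rw [perm_eq_of_continuous hFc t 0]
      simp only [hp]
      exact (hGc _).comp (continuous_fst.prodMk
        ((continuous_projIcc (h := zero_le_one)).comp (by fun_prop)))
    · intro p hp
      rw [hp]
      norm_num [(F p.1).top, (G p.1).bottom]
  · rw [ncard_crossings_comp, ncard_crossings_comp, hFn, hGn]

/-! ### The monoid of diagrams -/

theorem exists_lo_of_le {y v : I} (h : y ≤ lo v) : ∃ z, z ≤ v ∧ lo z = y := by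
  have h : (y : ℝ) ≤ v / 2 := h
  refine ⟨⟨2 * y, ?_, ?_⟩, ?_, Subtype.ext ?_⟩
  · linarith [y.2.1]
  · linarith [v.2.2]
  · change (2 : ℝ) * y ≤ v
    linarith
  · rw [lo_val]
    ring

theorem exists_hi_of_le {y u : I} (h : hi u ≤ y) : ∃ z, u ≤ z ∧ hi z = y := by
  have h : (1 + (u : ℝ)) / 2 ≤ y := h
  refine ⟨⟨2 * y - 1, ?_, ?_⟩, ?_, Subtype.ext ?_⟩
  · linarith [u.2.1]
  · linarith [y.2.2]
  · change (u : ℝ) ≤ 2 * y - 1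
    linarith
  · rw [hi_val]
    ring

theorem LocalPattern.map {n m : ℕ} {d d' : Diagram n} {j j' : Fin m → Fin (n + 1)} {u v : I}
    {P : List (Fin m × Fin m)} (φ : I → I) (hφ : StrictMono φ)
    (him : ∀ y ∈ Set.Icc (φ u) (φ v), ∃ z ∈ Set.Icc u v, φ z = y)
    (hs : ∀ s y, d'.strand (j' s) (φ y) = d.strand (j s) y) (h : LocalPattern d j u v P) :
    LocalPattern d' j' (φ u) (φ v) P := by
  obtain ⟨h1, x, hx, hx', h2⟩ := h
  refine ⟨fun s t hst => by rw [hs, hs]; exact h1 s t hst, fun q => φ (x q), hφ.comp hx,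
    fun q => ⟨hφ (hx' q).1, hφ (hx' q).2⟩, fun s t hst y hy => ?_⟩
  obtain ⟨z, hz, rfl⟩ := him y hy
  rw [hs, hs, h2 s t hst z hz]
  simp only [hφ.injective.eq_iff]

theorem LocalMove.comp_right {n m : ℕ} {P Q : List (Fin m × Fin m)} {d d' : Diagram n}
    (h : LocalMove P Q d d') (e : Diagram n) : LocalMove P Q (d.comp e) (d'.comp e) := by
  obtain ⟨j, u, v, l, r, τ, huv, hlr, hj, hin, hout, hlow, hτ, hup, hP, hQ⟩ := h
  have him : ∀ y ∈ Set.Icc (lo u) (lo v), ∃ z ∈ Set.Icc u v, lo z = y := by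
    rintro y ⟨h1, h2⟩
    obtain ⟨z, hz, rfl⟩ := exists_lo_of_le h2
    exact ⟨z, ⟨lo_strictMono.le_iff_le.1 h1, hz⟩, rfl⟩
  have hperm : ∀ k, d'.perm k = d.perm (τ k) := by
    intro k
    have h := hup k 1 v.2.2
    rw [d'.top, d.top] at h
    exact Fin.ext (by exact_mod_cast add_right_cancel h)
  refine ⟨j, lo u, lo v, l, r, τ, lo_strictMono huv, hlr, hj, ?_, ?_, ?_, hτ, ?_,
    hP.map lo lo_strictMono him (fun s y => comp_strand_lo _ _ _ _),
    hQ.map lo lo_strictMono him (fun s y => comp_strand_lo _ _ _ _)⟩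
  · intro s y hy
    obtain ⟨z, hz, rfl⟩ := him y hy
    rw [comp_strand_lo, comp_strand_lo]
    exact hin s z hz
  · intro k hk y hy
    obtain ⟨z, hz, rfl⟩ := him y hy
    rw [comp_strand_lo, comp_strand_lo]
    exact hout k hk z hz
  · intro k y hy
    obtain ⟨z, hz, rfl⟩ := exists_lo_of_le hy
    rw [comp_strand_lo, comp_strand_lo]
    exact hlow k z hz
  · intro k y hy
    rcases lo_or_hi y with ⟨z, -, rfl⟩ | ⟨z, rfl⟩
    · rw [comp_strand_lo, comp_strand_lo]
      exact hup k z (lo_strictMono.le_iff_le.1 hy)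
    · rw [comp_strand_hi, comp_strand_hi, hperm]

theorem LocalMove.comp_left {n m : ℕ} {P Q : List (Fin m × Fin m)} {e e' : Diagram n}
    (h : LocalMove P Q e e') (d : Diagram n) : LocalMove P Q (d.comp e) (d.comp e') := by
  obtain ⟨j, u, v, l, r, τ, huv, hlr, hj, hin, hout, hlow, hτ, hup, hP, hQ⟩ := h
  have him : ∀ y ∈ Set.Icc (hi u) (hi v), ∃ z ∈ Set.Icc u v, hi z = y := by
    rintro y ⟨h1, h2⟩
    obtain ⟨z, hz, rfl⟩ := exists_hi_of_le h1
    exact ⟨z, ⟨hz, hi_strictMono.le_iff_le.1 h2⟩, rfl⟩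
  have hk' : ∀ k, k ∉ Set.range (fun s => d.perm.symm (j s)) → d.perm k ∉ Set.range j := by
    rintro k hk ⟨s, hs⟩
    exact hk ⟨s, by simp [hs]⟩
  refine ⟨fun s => d.perm.symm (j s), hi u, hi v, l, r, (d.perm.trans τ).trans d.perm.symm,
    hi_strictMono huv, hlr, d.perm.symm.injective.comp hj, ?_, ?_, ?_, ?_, ?_,
    hP.map hi hi_strictMono him (fun s y => ?_), hQ.map hi hi_strictMono him (fun s y => ?_)⟩
  · intro s y hy
    obtain ⟨z, hz, rfl⟩ := him y hy
    rw [comp_strand_hi, comp_strand_hi, Equiv.apply_symm_apply]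
    exact hin s z hz
  · intro k hk y hy
    obtain ⟨z, hz, rfl⟩ := him y hy
    rw [comp_strand_hi, comp_strand_hi]
    exact hout _ (hk' k hk) z hz
  · intro k y hy
    rcases lo_or_hi y with ⟨z, -, rfl⟩ | ⟨z, rfl⟩
    · rw [comp_strand_lo, comp_strand_lo]
    · rw [comp_strand_hi, comp_strand_hi]
      exact hlow _ z (hi_strictMono.le_iff_le.1 hy)
  · intro k hk
    simp [hτ _ (hk' k hk)]
  · intro k y hy
    obtain ⟨z, hz, rfl⟩ := exists_hi_of_le hy
    rw [comp_strand_hi, comp_strand_hi, hup _ z hz]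
    simp
  · rw [comp_strand_hi, Equiv.apply_symm_apply]
  · rw [comp_strand_hi, Equiv.apply_symm_apply]

theorem Move.comp_right {n : ℕ} {d d' : Diagram n} (h : Move d d') (e : Diagram n) :
    Move (d.comp e) (d'.comp e) := by
  rcases h with h | h | h | h
  · exact .isotopy (h.comp (.refl e))
  · exact .two (h.comp_right e)
  · exact .three (h.comp_right e)
  · exact .three' (h.comp_right e)

theorem Move.comp_left {n : ℕ} {e e' : Diagram n} (h : Move e e') (d : Diagram n) :
    Move (d.comp e) (d.comp e') := by
  rcases h with h | h | h | h
  · exact .isotopy ((Isotopic.refl d).comp h)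
  · exact .two (h.comp_left d)
  · exact .three (h.comp_left d)
  · exact .three' (h.comp_left d)

theorem DL.mk_eq_of_isotopic {n : ℕ} {d e : Diagram n} (h : Isotopic d e) : DL.mk d = DL.mk e :=
  Quot.sound (.isotopy h)

theorem trivialDiagram_strand {n : ℕ} (i : Fin (n + 1)) (y : I) :
    (trivialDiagram n).strand i y = (i : ℝ) + 1 := by
  change (1 - (y : ℝ)) * ((i : ℝ) + 1) + y * ((i : ℝ) + 1) = _
  ring

theorem isotopic_comp_trivial {n : ℕ} (d : Diagram n) :
    Isotopic d (d.comp (trivialDiagram n)) := by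
  let g : C(I, I) := ⟨fun y => ⟨min (2 * (y : ℝ)) 1, le_min (by linarith [y.2.1]) zero_le_one,
    min_le_right _ _⟩, by fun_prop⟩
  have hg : ∀ y, ((g y : I) : ℝ) = min (2 * (y : ℝ)) 1 := fun y => rfl
  refine isotopic_of_order ?_ g ?_ ?_ ?_ ?_ ?_
  · rw [comp_perm]
    rfl
  · intro y z hyz
    have hyz : (y : ℝ) ≤ z := hyz
    rw [← Subtype.coe_le_coe, hg, hg]
    exact min_le_min_right _ (by linarith)
  · intro y z hyz heq
    have hyz : (y : ℝ) < z := hyz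
    have heq := congrArg Subtype.val heq
    rw [hg, hg] at heq
    right
    apply Subtype.ext
    rw [hg]
    change min (2 * (y : ℝ)) 1 = 1
    rw [min_eq_right_iff]
    by_contra hc
    rw [min_eq_left (not_le.1 hc).le] at heq
    rcases min_cases (2 * (z : ℝ)) 1 with h | h <;> linarith
  · exact Subtype.ext (by rw [hg]; simp)
  · exact Subtype.ext (by rw [hg]; norm_num)
  · have key : ∀ y i, (d.comp (trivialDiagram n)).strand i y = d.strand i (g y) := by
      intro y i
      rcases lo_or_hi y with ⟨z, -, rfl⟩ | ⟨z, rfl⟩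
      · have : g (lo z) = z := Subtype.ext (by
          rw [hg, lo_val, min_eq_left (by linarith [z.2.2])]
          ring)
        rw [comp_strand_lo, this]
      · have : g (hi z) = 1 := Subtype.ext (by
          rw [hg, hi_val, min_eq_right (by linarith [z.2.1])]
          rfl)
        rw [comp_strand_hi, this, trivialDiagram_strand, d.top]
    intro y i j
    rw [key, key]

theorem isotopic_trivial_comp {n : ℕ} (d : Diagram n) :
    Isotopic d ((trivialDiagram n).comp d) := by
  let g : C(I, I) := ⟨fun y => ⟨max (2 * (y : ℝ) - 1) 0, le_max_right _ _,
    max_le (by linarith [y.2.2]) zero_le_one⟩, by fun_prop⟩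
  have hg : ∀ y, ((g y : I) : ℝ) = max (2 * (y : ℝ) - 1) 0 := fun y => rfl
  refine isotopic_of_order ?_ g ?_ ?_ ?_ ?_ ?_
  · rw [comp_perm]
    rfl
  · intro y z hyz
    have hyz : (y : ℝ) ≤ z := hyz
    rw [← Subtype.coe_le_coe, hg, hg]
    exact max_le_max_right _ (by linarith)
  · intro y z hyz heq
    have hyz : (y : ℝ) < z := hyz
    have heq := congrArg Subtype.val heq
    rw [hg, hg] at heq
    left
    apply Subtype.ext
    rw [hg]
    change max (2 * (y : ℝ) - 1) 0 = 0
    rw [max_eq_right_iff]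
    by_contra hc
    rw [max_eq_left (not_le.1 hc).le] at heq
    rcases max_cases (2 * (z : ℝ) - 1) 0 with h | h <;> linarith
  · exact Subtype.ext (by rw [hg]; simp)
  · exact Subtype.ext (by rw [hg]; norm_num)
  · have key : ∀ y i, ((trivialDiagram n).comp d).strand i y = d.strand i (g y) := by
      intro y i
      rcases lo_or_hi y with ⟨z, -, rfl⟩ | ⟨z, rfl⟩
      · have : g (lo z) = 0 := Subtype.ext (by
          rw [hg, lo_val, max_eq_right (by linarith [z.2.2])]
          rfl)
        rw [comp_strand_lo, this, trivialDiagram_strand, d.bottom]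
      · have : g (hi z) = z := Subtype.ext (by
          rw [hg, hi_val, max_eq_left (by linarith [z.2.1])]
          ring)
        rw [comp_strand_hi, this]
        rfl
    intro y i j
    rw [key, key]

theorem isotopic_comp_assoc {n : ℕ} (d e f : Diagram n) :
    Isotopic (d.comp (e.comp f)) ((d.comp e).comp f) := by
  let g : C(I, I) := ⟨fun y => ⟨min (min (2 * (y : ℝ)) (y + 1 / 4)) ((1 + y) / 2),
    le_min (le_min (by linarith [y.2.1]) (by linarith [y.2.1])) (by linarith [y.2.1]),
    (min_le_right _ _).trans (by linarith [y.2.2])⟩, by fun_prop⟩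
  have hg : ∀ y, ((g y : I) : ℝ) = min (min (2 * (y : ℝ)) (y + 1 / 4)) ((1 + y) / 2) :=
    fun y => rfl
  have hmono : StrictMono g := by
    intro y z hyz
    have hyz : (y : ℝ) < z := hyz
    rw [← Subtype.coe_lt_coe, hg, hg]
    exact min_lt_min (min_lt_min (by linarith) (by linarith)) (by linarith)
  refine isotopic_of_order rfl g hmono.monotone ?_ ?_ ?_ ?_
  · intro y z hyz heq
    exact absurd heq (hmono hyz).ne
  · exact Subtype.ext (by rw [hg]; norm_num)
  · exact Subtype.ext (by rw [hg]; norm_num)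
  · have key : ∀ y i, ((d.comp e).comp f).strand i y = (d.comp (e.comp f)).strand i (g y) := by
      intro y i
      rcases lo_or_hi y with ⟨z, -, rfl⟩ | ⟨z, rfl⟩
      · rcases lo_or_hi z with ⟨w, -, rfl⟩ | ⟨w, rfl⟩
        · have : g (lo (lo w)) = lo w := Subtype.ext (by
            have := w.2.1
            have := w.2.2
            rw [hg, lo_val, lo_val, min_eq_left, min_eq_left] <;>
              (try rw [min_eq_left]) <;> linarith)
          rw [comp_strand_lo, comp_strand_lo, this, comp_strand_lo]
        · have : g (lo (hi w)) = hi (lo w) := Subtype.ext (by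
            have := w.2.1
            have := w.2.2
            rw [hg, lo_val, hi_val, hi_val, lo_val, min_eq_left, min_eq_right] <;>
              (try rw [min_eq_right]) <;> linarith)
          rw [comp_strand_lo, comp_strand_hi, this, comp_strand_hi, comp_strand_lo]
      · have : g (hi z) = hi (hi z) := Subtype.ext (by
          have := z.2.1
          have := z.2.2
          rw [hg, hi_val, hi_val, hi_val, min_eq_right]
          rw [min_eq_right] <;> linarith)
        rw [comp_strand_hi, this, comp_strand_hi, comp_strand_hi]
        rfl
    intro y i j
    rw [key, key]

/-- Stacking of classes of diagrams. -/
noncomputable instance DL.instMonoid (n : ℕ) : Monoid (DL n) where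
  mul := Quot.map₂ Diagram.comp (fun d _ _ h => h.comp_left d) (fun _ _ e h => h.comp_right e)
  one := DL.mk (trivialDiagram n)
  mul_assoc := by
    rintro ⟨d⟩ ⟨e⟩ ⟨f⟩
    exact (DL.mk_eq_of_isotopic (isotopic_comp_assoc d e f)).symm
  one_mul := by
    rintro ⟨d⟩
    exact (DL.mk_eq_of_isotopic (isotopic_trivial_comp d)).symm
  mul_one := by
    rintro ⟨d⟩
    exact (DL.mk_eq_of_isotopic (isotopic_comp_trivial d)).symm

theorem DL.mk_mul_mk {n : ℕ} (d e : Diagram n) : DL.mk d * DL.mk e = DL.mk (d.comp e) := rfl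

theorem DL.one_def {n : ℕ} : (1 : DL n) = DL.mk (trivialDiagram n) := rfl

theorem DL.exists_mk {n : ℕ} (x : DL n) : ∃ d, DL.mk d = x := Quot.exists_rep x

/-! ### Diagrams of straight strands -/

theorem swap_val {n : ℕ} (i : Fin n) (x : Fin (n + 1)) :
    (Equiv.swap i.castSucc i.succ x).val =
      if x.val = i.val then i.val + 1 else if x.val = i.val + 1 then i.val else x.val := by
  simp only [Equiv.swap_apply_def, Fin.ext_iff, Fin.val_castSucc, Fin.val_succ]
  split_ifs <;> simp

theorem straight_strand {n : ℕ} {s : Equiv.Perm (Fin (n + 1))} (hs : Avoids321 s)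
    (i : Fin (n + 1)) (y : I) :
    (straight s hs).strand i y = (1 - (y : ℝ)) * ((i : ℝ) + 1) + y * ((s i : ℝ) + 1) := rfl

theorem fin_cast_lt {n : ℕ} {i j : Fin n} (h : i < j) : (i : ℝ) + 1 < (j : ℝ) + 1 := by
  have : (i : ℝ) < (j : ℝ) := by exact_mod_cast h
  linarith

theorem straight_lt {n : ℕ} {s : Equiv.Perm (Fin (n + 1))} (hs : Avoids321 s) {i j : Fin (n + 1)}
    (hij : i < j) (h : s i < s j) (y : I) :
    (straight s hs).strand i y < (straight s hs).strand j y :=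
  lerp_lt y (fin_cast_lt hij) (fin_cast_lt h)

/-- The strands `i` and `j` change sides exactly once, at the height `z`, where the strand `i` goes
from left to right. -/
def CrossOnce (f g : I → ℝ) (z : I) : Prop :=
  (∀ y < z, f y < g y) ∧ f z = g z ∧ ∀ y, z < y → g y < f y

theorem CrossOnce.eq_iff {f g : I → ℝ} {z : I} (h : CrossOnce f g z) (y : I) :
    f y = g y ↔ y = z := by
  constructor
  · intro hy
    rcases lt_trichotomy y z with h' | h' | h'
    · exact absurd hy (h.1 y h').ne
    · exact h'
    · exact absurd hy (h.2.2 y h').ne'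
  · rintro rfl
    exact h.2.1

/-- A family of strands that realizes a `321`-avoiding permutation with as few crossings as
possible is a diagram. -/
def Diagram.ofReduced {n : ℕ} (p : Equiv.Perm (Fin (n + 1))) (hp : Avoids321 p)
    (c : Fin (n + 1) → C(I, ℝ)) (bottom : ∀ i, c i 0 = (i : ℝ) + 1)
    (top : ∀ i, c i 1 = (p i : ℝ) + 1)
    (hlt : ∀ i j, i < j → p i < p j → ∀ y, c i y < c j y)
    (hcr : ∀ i j, i < j → p j < p i → ∃ z, CrossOnce (c i) (c j) z) : Diagram n :=
  have inv : ∀ i j y, i < j → c i y = c j y → p j < p i := fun i j y hij h => by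
    by_contra hc
    exact (hlt i j hij (lt_of_le_of_ne (not_lt.1 hc) (p.injective.ne hij.ne)) y).ne h
  have tri : ∀ i j k, i < j → j < k → ∀ y, c i y = c j y → c j y = c k y → False :=
    fun i j k hij hjk y h h' => hp ⟨i, j, k, hij, hjk, inv i j y hij h, inv j k y hjk h'⟩
  { perm := p
    strand := c
    bottom := bottom
    top := top
    finite_meet := by
      intro i j hij
      refine Set.Subsingleton.finite fun y hy z hz => ?_
      have hy : c i y = c j y := hy
      have hz : c i z = c j z := hz
      rcases lt_or_gt_of_ne hij with h | h
      · obtain ⟨w, hw⟩ := hcr i j h (inv i j y h hy)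
        rw [(hw.eq_iff y).1 hy, (hw.eq_iff z).1 hz]
      · obtain ⟨w, hw⟩ := hcr j i h (inv j i y h hy.symm)
        rw [(hw.eq_iff y).1 hy.symm, (hw.eq_iff z).1 hz.symm]
    no_triple := by
      rintro i j k hij hjk hik y ⟨h, h'⟩
      rcases lt_or_gt_of_ne hij with a | a <;> rcases lt_or_gt_of_ne hjk with b | b <;>
        rcases lt_or_gt_of_ne hik with e | e
      · exact tri i j k a b y h h'
      · exact absurd (a.trans b) e.asymm
      · exact tri i k j e b y (h.trans h') h'.symm
      · exact tri k i j e a y (h.trans h').symm h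
      · exact tri j i k a e y h.symm (h.trans h')
      · exact tri j k i b e y h' (h.trans h').symm
      · exact absurd (b.trans a) e.asymm
      · exact tri k j i b a y h'.symm h.symm
    crossing := by
      have key : ∀ i j y, i < j → c i y = c j y → CrossesAt (c i) (c j) y := by
        intro i j y hij h
        obtain ⟨w, hw⟩ := hcr i j hij (inv i j y hij h)
        obtain rfl := (hw.eq_iff y).1 h
        have h0 : 0 < y := by
          refine lt_of_le_of_ne y.2.1 ?_
          rintro rfl
          rw [bottom, bottom] at h
          exact (fin_cast_lt hij).ne h
        have h1 : y < 1 := by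
          refine lt_of_le_of_ne y.2.2 ?_
          rintro rfl
          rw [top, top] at h
          exact (fin_cast_lt (inv i j 1 hij (by rw [top, top, h]))).ne' h
        exact ⟨0, 1, h0, h1, fun z hz => hw.1 z hz.2, fun z hz => hw.2.2 z hz.1⟩
      intro i j hij y h
      rcases lt_or_gt_of_ne hij with a | a
      · exact Or.inl (key i j y a h)
      · exact Or.inr (key j i y a h.symm) }

/-- The inversions of a permutation. -/
def inversions {m : ℕ} (s : Equiv.Perm (Fin m)) : Finset (Fin m × Fin m) :=
  Finset.univ.filter fun c => c.1 < c.2 ∧ s c.2 < s c.1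

theorem mem_inversions {m : ℕ} {s : Equiv.Perm (Fin m)} {i j : Fin m} :
    (i, j) ∈ inversions s ↔ i < j ∧ s j < s i := by
  simp [inversions]

theorem Diagram.ncard_ofReduced {n : ℕ} (p : Equiv.Perm (Fin (n + 1))) (hp : Avoids321 p)
    (c : Fin (n + 1) → C(I, ℝ)) (bottom : ∀ i, c i 0 = (i : ℝ) + 1)
    (top : ∀ i, c i 1 = (p i : ℝ) + 1)
    (hlt : ∀ i j, i < j → p i < p j → ∀ y, c i y < c j y)
    (hcr : ∀ i j, i < j → p j < p i → ∃ z, CrossOnce (c i) (c j) z) :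
    (Diagram.ofReduced p hp c bottom top hlt hcr).crossings.ncard = (inversions p).card := by
  have inv : ∀ i j y, i < j → c i y = c j y → p j < p i := fun i j y hij h => by
    by_contra hc
    exact (hlt i j hij (lt_of_le_of_ne (not_lt.1 hc) (p.injective.ne hij.ne)) y).ne h
  have him : (fun c : Fin (n + 1) × Fin (n + 1) × I => (c.1, c.2.1)) ''
      (Diagram.ofReduced p hp c bottom top hlt hcr).crossings = (inversions p : Set _) := by
    ext ⟨i, j⟩
    rw [Finset.mem_coe, mem_inversions]
    constructor
    · rintro ⟨⟨i', j', y⟩, ⟨h, h'⟩, heq⟩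
      simp only [Prod.mk.injEq] at heq
      obtain ⟨rfl, rfl⟩ := heq
      exact ⟨h, inv _ _ y h h'⟩
    · rintro ⟨h, h'⟩
      obtain ⟨z, hz⟩ := hcr i j h h'
      exact ⟨(i, j, z), ⟨h, hz.2.1⟩, rfl⟩
  rw [← Set.ncard_coe_finset, ← him, Set.InjOn.ncard_image]
  rintro ⟨i, j, y⟩ ⟨h, h'⟩ ⟨i', j', y'⟩ ⟨-, k'⟩ heq
  simp only [Prod.mk.injEq] at heq
  obtain ⟨rfl, rfl⟩ := heq
  have h' : c i y = c j y := h'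
  have k' : c i y' = c j y' := k'
  obtain ⟨w, hw⟩ := hcr i j h (inv _ _ y h h')
  rw [(hw.eq_iff y).1 h', (hw.eq_iff y').1 k']

/-- A function that is linear on both halves of the interval, positive at the bottom and negative at
the top, changes sign exactly once. -/
theorem exists_zero_of_two_pieces {D : I → ℝ} {A M B : ℝ} (hA : 0 < A) (hB : B < 0)
    (hlo : ∀ z : I, D (lo z) = (1 - (z : ℝ)) * A + z * M)
    (hhi : ∀ z : I, D (hi z) = (1 - (z : ℝ)) * M + z * B) :
    ∃ w, (∀ y < w, 0 < D y) ∧ D w = 0 ∧ ∀ y, w < y → D y < 0 := by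
  rcases le_or_gt M 0 with hM | hM
  · have hAM : 0 < A - M := by linarith
    have hz0 : 0 ≤ A / (A - M) := by positivity
    have hz1 : A / (A - M) ≤ 1 := by rw [div_le_one hAM]; linarith
    have hw : A / (A - M) * (A - M) = A := div_mul_cancel₀ _ hAM.ne'
    refine ⟨lo ⟨A / (A - M), hz0, hz1⟩, fun y hy => ?_, ?_, fun y hy => ?_⟩
    · obtain ⟨z, -, rfl⟩ := exists_lo_of_le hy.le
      have hz : (z : ℝ) < A / (A - M) := lo_strictMono.lt_iff_lt.1 hy
      rw [hlo]
      nlinarith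
    · rw [hlo]
      simp only
      nlinarith
    · rcases lo_or_hi y with ⟨z, -, rfl⟩ | ⟨z, rfl⟩
      · have hz : A / (A - M) < (z : ℝ) := lo_strictMono.lt_iff_lt.1 hy
        rw [hlo]
        nlinarith
      · rw [hhi]
        rcases eq_or_lt_of_le z.2.1 with h0 | h0
        · rw [← h0]
          have hne : M ≠ 0 := by
            rintro rfl
            have hz : A / (A - 0) / 2 < (1 + (z : ℝ)) / 2 := hy
            rw [sub_zero, div_self hA.ne', ← h0] at hz
            linarith
          have : M < 0 := lt_of_le_of_ne hM hne
          linarith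
        · nlinarith [mul_nonneg (sub_nonneg.2 z.2.2) (neg_nonneg.2 hM), mul_pos h0 (neg_pos.2 hB)]
  · have hMB : 0 < M - B := by linarith
    have hz0 : 0 ≤ M / (M - B) := by positivity
    have hz1 : M / (M - B) ≤ 1 := by rw [div_le_one hMB]; linarith
    have hw : M / (M - B) * (M - B) = M := div_mul_cancel₀ _ hMB.ne'
    refine ⟨hi ⟨M / (M - B), hz0, hz1⟩, fun y hy => ?_, ?_, fun y hy => ?_⟩
    · rcases lo_or_hi y with ⟨z, -, rfl⟩ | ⟨z, rfl⟩
      · rw [hlo]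
        have h1 := mul_nonneg (sub_nonneg.2 z.2.2) hA.le
        have h2 := mul_nonneg z.2.1 hM.le
        rcases eq_or_lt_of_le z.2.1 with h0 | h0
        · rw [← h0]
          linarith
        · have := mul_pos h0 hM
          linarith
      · have hz : (z : ℝ) < M / (M - B) := hi_strictMono.lt_iff_lt.1 hy
        rw [hhi]
        nlinarith
    · rw [hhi]
      simp only
      nlinarith
    · obtain ⟨z, -, rfl⟩ := exists_hi_of_le hy.le
      have hz : M / (M - B) < (z : ℝ) := hi_strictMono.lt_iff_lt.1 hy
      rw [hhi]
      nlinarith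

/-- If the product of `s` and `s'` avoids `321` and no inversion of `s` is undone by `s'`, then the
straight diagram of the product is the composite of the straight diagrams: interpolate linearly.
Throughout the interpolation the difference of two strands is linear on both halves of the interval,
so that it has at most one sign change. -/
theorem isotopic_straight_comp {n : ℕ} {s s' : Equiv.Perm (Fin (n + 1))} (hs : Avoids321 s)
    (hs' : Avoids321 s') (hp : Avoids321 (s.trans s'))
    (hadd : ∀ i j, i < j → s j < s i → s' (s j) < s' (s i)) :
    Isotopic (straight (s.trans s') hp) ((straight s hs).comp (straight s' hs')) := by
  set e := (straight s hs).comp (straight s' hs') with he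
  set d := straight (s.trans s') hp with hd
  have hbot : ∀ t i, lerp (d.strand i) (e.strand i) t 0 = (i : ℝ) + 1 := fun t i => by
    rw [lerp_apply, d.bottom, e.bottom]
    ring
  have htop : ∀ t i, lerp (d.strand i) (e.strand i) t 1 = ((s.trans s') i : ℝ) + 1 := fun t i => by
    rw [lerp_apply, d.top, e.top, hd, he, comp_perm]
    change (1 - (t : ℝ)) * (((s.trans s') i : ℝ) + 1) + t * (((s.trans s') i : ℝ) + 1) = _
    ring
  have hlt : ∀ t i j, i < j → (s.trans s') i < (s.trans s') j → ∀ y,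
      lerp (d.strand i) (e.strand i) t y < lerp (d.strand j) (e.strand j) t y := by
    intro t i j hij h y
    refine lerp_lt t (straight_lt hp hij h y) ?_
    have hsij : s i < s j := by
      by_contra hc
      exact (hadd i j hij (lt_of_le_of_ne (not_lt.1 hc) (s.injective.ne hij.ne'))).asymm h
    rcases lo_or_hi y with ⟨z, -, rfl⟩ | ⟨z, rfl⟩
    · rw [he, comp_strand_lo, comp_strand_lo]
      exact straight_lt hs hij hsij z
    · rw [he, comp_strand_hi, comp_strand_hi]
      exact straight_lt hs' hsij h z
  have hcr : ∀ t i j, i < j → (s.trans s') j < (s.trans s') i →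
      ∃ z, CrossOnce (lerp (d.strand i) (e.strand i) t) (lerp (d.strand j) (e.strand j) t) z := by
    intro t i j hij h
    obtain ⟨w, h1, h2, h3⟩ := exists_zero_of_two_pieces
      (D := fun y => lerp (d.strand j) (e.strand j) t y - lerp (d.strand i) (e.strand i) t y)
      (A := ((j : ℝ) + 1) - ((i : ℝ) + 1))
      (B := ((s' (s j) : ℝ) + 1) - ((s' (s i) : ℝ) + 1))
      (M := (1 - (t : ℝ)) * (((j : ℝ) + s' (s j)) / 2 - ((i : ℝ) + s' (s i)) / 2)
        + t * ((s j : ℝ) - s i))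
      (by have := fin_cast_lt hij; linarith)
      (by have := fin_cast_lt h; simp only [Equiv.trans_apply] at this; linarith)
      (fun z => by
        simp only [lerp_apply, he, hd, comp_strand_lo, straight_strand, lo_val, Equiv.trans_apply]
        ring)
      (fun z => by
        have hp1 : (straight s hs).perm = s := rfl
        simp only [lerp_apply, he, hd, comp_strand_hi, straight_strand, hi_val, hp1,
          Equiv.trans_apply]
        ring)
    exact ⟨w, fun y hy => sub_pos.1 (h1 y hy), (sub_eq_zero.1 h2).symm,
      fun y hy => sub_neg.1 (h3 y hy)⟩
  let F : I → Diagram n := fun t => Diagram.ofReduced (s.trans s') hp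
    (fun i => lerp (d.strand i) (e.strand i) t) (hbot t) (htop t) (hlt t) (hcr t)
  have hF0 : F 0 = d := Diagram.ext_of rfl fun i y => by
    change lerp (d.strand i) (e.strand i) 0 y = _
    rw [lerp_apply]
    simp
  have hF1 : F 1 = e := Diagram.ext_of rfl fun i y => by
    change lerp (d.strand i) (e.strand i) 1 y = _
    rw [lerp_apply]
    simp
  refine ⟨F, hF0, hF1, fun i => continuous_lerp _ _, fun t => ?_⟩
  rw [← hF0]
  exact (Diagram.ncard_ofReduced _ _ _ _ _ _ _).trans (Diagram.ncard_ofReduced _ _ _ _ _ _ _).symm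

theorem avoids321_of_inversions {m : ℕ} {s s' : Equiv.Perm (Fin m)} (hs : Avoids321 s)
    (h : ∀ i j, i < j → s' j < s' i → s j < s i) : Avoids321 s' := by
  rintro ⟨i, j, k, hij, hjk, h1, h2⟩
  exact hs ⟨i, j, k, hij, hjk, h i j hij h1, h j k hjk h2⟩

theorem perm_eq_one_of_strictMono {m : ℕ} {s : Equiv.Perm (Fin m)} (h : StrictMono s) : s = 1 := by
  have : (s : Fin m → Fin m) = id := (h.range_inj strictMono_id).1
    (by rw [s.surjective.range_eq, Set.range_id])
  exact Equiv.ext fun i => congrFun this i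

/-- A permutation other than the identity can be shortened by exchanging two adjacent values. -/
theorem exists_descent {n : ℕ} {s : Equiv.Perm (Fin (n + 1))} (hs : s ≠ 1) :
    ∃ i : Fin n, s.symm i.succ < s.symm i.castSucc := by
  by_contra hc
  push Not at hc
  have h : StrictMono s.symm := Fin.strictMono_iff_lt_succ.2 fun i =>
    lt_of_le_of_ne (hc i) (s.symm.injective.ne (Fin.castSucc_lt_succ).ne)
  have h1 := perm_eq_one_of_strictMono h
  exact hs (by rw [← Equiv.symm_symm s, h1]; rfl)

theorem lt_of_swap_lt {n : ℕ} {s : Equiv.Perm (Fin (n + 1))} {i : Fin n}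
    (hi : s.symm i.succ < s.symm i.castSucc) {a b : Fin (n + 1)} (hab : a < b)
    (h : Equiv.swap i.castSucc i.succ (s b) < Equiv.swap i.castSucc i.succ (s a)) : s b < s a := by
  by_contra hc
  have hc : s a < s b := lt_of_le_of_ne (not_lt.1 hc) (s.injective.ne hab.ne)
  rw [Fin.lt_def, swap_val, swap_val] at h
  rw [Fin.lt_def] at hc
  have h2 : (s a).val = i.val ∧ (s b).val = i.val + 1 := by
    split_ifs at h <;> omega
  have ha : s.symm i.castSucc = a := by
    rw [Equiv.symm_apply_eq]; exact Fin.ext (by simp [h2.1])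
  have hb : s.symm i.succ = b := by
    rw [Equiv.symm_apply_eq]; exact Fin.ext (by simp [h2.2])
  rw [ha, hb] at hi
  exact hi.asymm hab

theorem card_inversions_swap {n : ℕ} {s : Equiv.Perm (Fin (n + 1))} {i : Fin n}
    (hi : s.symm i.succ < s.symm i.castSucc) :
    (inversions (s.trans (Equiv.swap i.castSucc i.succ))).card < (inversions s).card := by
  refine Finset.card_lt_card ⟨?_, fun hsub => ?_⟩
  · rintro ⟨a, b⟩ h
    rw [mem_inversions] at h ⊢
    exact ⟨h.1, lt_of_swap_lt hi h.1 h.2⟩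
  · have h1 : (s.symm i.succ, s.symm i.castSucc) ∈ inversions s :=
      mem_inversions.2 ⟨hi, by simp⟩
    have h2 := (mem_inversions.1 (hsub h1)).2
    simp only [Equiv.trans_apply, Equiv.apply_symm_apply, Equiv.swap_apply_left,
      Equiv.swap_apply_right] at h2
    exact h2.asymm (Fin.castSucc_lt_succ)

theorem isotopic_straight_descent {n : ℕ} {s : Equiv.Perm (Fin (n + 1))} (hs : Avoids321 s)
    {i : Fin n} (hi : s.symm i.succ < s.symm i.castSucc)
    (hs' : Avoids321 (s.trans (Equiv.swap i.castSucc i.succ))) :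
    Isotopic (straight s hs) ((straight _ hs').comp (elementary i)) := by
  have key : (s.trans (Equiv.swap i.castSucc i.succ)).trans (Equiv.swap i.castSucc i.succ) = s := by
    ext a
    simp
  have h := isotopic_straight_comp hs' (avoids321_swap i) (by rwa [key]) (fun a b hab h => by
    simpa using lt_of_swap_lt hi hab h)
  simp only [key] at h
  exact h

/-! ### The defining relations hold for diagrams -/

/-- The height `1/2`. -/
noncomputable def half : I := ⟨1 / 2, by norm_num, by norm_num⟩

theorem half_val : ((half : I) : ℝ) = 1 / 2 := rfl

/-- The numbers `i` and `i + 1`, in one of the two orders. -/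
def Consecutive (i a b : ℕ) : Prop := (a = i ∧ b = i + 1) ∨ (a = i + 1 ∧ b = i)

theorem elementary_perm {n : ℕ} (i : Fin n) :
    (elementary i).perm = Equiv.swap i.castSucc i.succ := rfl

theorem elementary_strand {n : ℕ} (i : Fin n) (k : Fin (n + 1)) (y : I) :
    (elementary i).strand k y =
      (1 - (y : ℝ)) * ((k : ℝ) + 1) + y * ((Equiv.swap i.castSucc i.succ k : ℝ) + 1) := rfl

theorem elementary_meet {n : ℕ} (i : Fin n) {a b : Fin (n + 1)} (hab : a ≠ b) (y : I) :
    (elementary i).strand a y = (elementary i).strand b y ↔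
      y = half ∧ Consecutive i a b := by
  have key : ∀ a b : Fin (n + 1), a < b → (elementary i).strand a y = (elementary i).strand b y →
      y = half ∧ (a : ℕ) = i ∧ (b : ℕ) = i + 1 := by
    intro a b hab h
    have h1 := straight_inv (Equiv.swap i.castSucc i.succ) hab h
    rw [Fin.lt_def, swap_val, swap_val] at h1
    rw [Fin.lt_def] at hab
    have h2 : a.val = i.val ∧ b.val = i.val + 1 := by split_ifs at h1 <;> omega
    refine ⟨?_, h2⟩
    rw [elementary_strand, elementary_strand, swap_val, swap_val, h2.1, h2.2] at h
    simp only [if_true, Nat.succ_ne_self, if_false] at h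
    push_cast at h
    apply Subtype.ext
    rw [half_val]
    linarith
  constructor
  · intro h
    rcases lt_or_gt_of_ne hab with hlt | hlt
    · exact ⟨(key a b hlt h).1, Or.inl (key a b hlt h).2⟩
    · exact ⟨(key b a hlt h.symm).1, Or.inr ⟨(key b a hlt h.symm).2.2, (key b a hlt h.symm).2.1⟩⟩
  · rintro ⟨rfl, ⟨h1, h2⟩ | ⟨h1, h2⟩⟩ <;>
    · rw [elementary_strand, elementary_strand, swap_val, swap_val, h1, h2, half_val]
      simp only [if_true, Nat.succ_ne_self, if_false]
      push_cast
      ring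

theorem comp_meet {n : ℕ} (d e : Diagram n) (a b : Fin (n + 1)) (y : I) :
    (d.comp e).strand a y = (d.comp e).strand b y ↔
      (∃ z, y = lo z ∧ d.strand a z = d.strand b z) ∨
      ∃ z, y = hi z ∧ e.strand (d.perm a) z = e.strand (d.perm b) z := by
  constructor
  · intro h
    rcases lo_or_hi y with ⟨z, -, rfl⟩ | ⟨z, rfl⟩
    · exact Or.inl ⟨z, rfl, by simpa only [comp_strand_lo] using h⟩
    · exact Or.inr ⟨z, rfl, by simpa only [comp_strand_hi] using h⟩
  · rintro (⟨z, rfl, h⟩ | ⟨z, rfl, h⟩)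
    · simpa only [comp_strand_lo] using h
    · simpa only [comp_strand_hi] using h

/-- Only the `m` strands starting at the places `c, …, c + m - 1` (counted from `0`) are not
vertical, and they stay close to these places. -/
def Diagram.InBlock {n : ℕ} (d : Diagram n) (c m : ℕ) : Prop :=
  (∀ k : Fin (n + 1), c ≤ k → (k : ℕ) < c + m → (c ≤ d.perm k ∧ (d.perm k : ℕ) < c + m) ∧
    ∀ y, d.strand k y ∈ Set.Ioo ((c : ℝ) + 1 / 2) ((c : ℝ) + m + 1 / 2)) ∧
  ∀ k : Fin (n + 1), ¬ (c ≤ k ∧ (k : ℕ) < c + m) →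
    d.perm k = k ∧ ∀ y, d.strand k y = (k : ℝ) + 1

theorem Diagram.InBlock.comp {n c m : ℕ} {d e : Diagram n} (hd : d.InBlock c m)
    (he : e.InBlock c m) : (d.comp e).InBlock c m := by
  constructor
  · intro k h1 h2
    have h3 := hd.1 k h1 h2
    have h4 := he.1 (d.perm k) h3.1.1 h3.1.2
    refine ⟨h4.1, fun y => ?_⟩
    rcases lo_or_hi y with ⟨z, -, rfl⟩ | ⟨z, rfl⟩
    · rw [comp_strand_lo]
      exact h3.2 z
    · rw [comp_strand_hi]
      exact h4.2 z
  · intro k h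
    have h3 := hd.2 k h
    have h4 := he.2 k h
    refine ⟨by rw [comp_perm_apply, h3.1, h4.1], fun y => ?_⟩
    rcases lo_or_hi y with ⟨z, -, rfl⟩ | ⟨z, rfl⟩
    · rw [comp_strand_lo]
      exact h3.2 z
    · rw [comp_strand_hi, h3.1]
      exact h4.2 z

theorem inBlock_elementary {n c m : ℕ} (i : Fin n) (h1 : c ≤ i) (h2 : (i : ℕ) + 1 < c + m) :
    (elementary i).InBlock c m := by
  constructor
  · intro k hk1 hk2
    have h3 : c ≤ ((elementary i).perm k : ℕ) ∧ ((elementary i).perm k : ℕ) < c + m := by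
      rw [elementary_perm, swap_val]
      split_ifs <;> omega
    refine ⟨h3, fun y => ?_⟩
    have e1 : (c : ℝ) ≤ (k : ℝ) := by exact_mod_cast hk1
    have e2 : (k : ℝ) + 1 ≤ (c : ℝ) + m := by exact_mod_cast hk2
    have e3 : (c : ℝ) ≤ (((elementary i).perm k : ℕ) : ℝ) := by exact_mod_cast h3.1
    have e4 : (((elementary i).perm k : ℕ) : ℝ) + 1 ≤ (c : ℝ) + m := by exact_mod_cast h3.2
    rw [elementary_strand, ← elementary_perm]
    constructor <;> nlinarith [y.2.1, y.2.2]
  · intro k hk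
    have h3 : (elementary i).perm k = k := by
      apply Fin.ext
      rw [elementary_perm, swap_val]
      split_ifs <;> omega
    refine ⟨h3, fun y => ?_⟩
    rw [elementary_strand, ← elementary_perm, h3]
    ring

/-- The strand starting at the place `s` of a block. -/
def blockStrand {n : ℕ} {c m : ℕ} (hc : c + m ≤ n + 1) (s : Fin m) : Fin (n + 1) :=
  ⟨c + s, by omega⟩

theorem localMove_of_block {n c m : ℕ} (hc : c + m ≤ n + 1) (hm : 0 < m) {d e : Diagram n}
    (hd : d.InBlock c m) (he : e.InBlock c m) {P Q : List (Fin m × Fin m)}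
    (hP : LocalPattern d (blockStrand hc) 0 1 P) (hQ : LocalPattern e (blockStrand hc) 0 1 Q) :
    LocalMove P Q d e := by
  have hout : ∀ k, k ∉ Set.range (blockStrand hc) → ¬ (c ≤ k ∧ (k : ℕ) < c + m) := by
    rintro k hk ⟨h1, h2⟩
    exact hk ⟨⟨k - c, by omega⟩, Fin.ext (by simp only [blockStrand]; omega)⟩
  have hin : ∀ s : Fin m, c ≤ (blockStrand hc s : ℕ) ∧ (blockStrand hc s : ℕ) < c + m := by
    intro s
    simp only [blockStrand]
    omega
  refine ⟨blockStrand hc, 0, 1, (c : ℝ) + 1 / 2, (c : ℝ) + m + 1 / 2, e.perm.trans d.perm.symm,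
    zero_lt_one, ?_, ?_, ?_, ?_, ?_, ?_, ?_, hP, hQ⟩
  · have : (0 : ℝ) < m := by exact_mod_cast hm
    linarith
  · intro s t h
    have := congrArg Fin.val h
    simp only [blockStrand] at this
    exact Fin.ext (by omega)
  · exact fun s y _ => ⟨(hd.1 _ (hin s).1 (hin s).2).2 y, (he.1 _ (hin s).1 (hin s).2).2 y⟩
  · intro k hk y _
    rw [(hd.2 k (hout k hk)).2, (he.2 k (hout k hk)).2]
    refine ⟨fun h => hout k hk ⟨?_, ?_⟩, rfl⟩
    · by_contra hlt
      have : (k : ℝ) + 1 ≤ c := by exact_mod_cast not_le.1 hlt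
      linarith [h.1]
    · by_contra hlt
      have : (c : ℝ) + m ≤ k := by exact_mod_cast not_lt.1 hlt
      linarith [h.2]
  · intro k y hy
    obtain rfl : y = 0 := le_antisymm hy y.2.1
    rw [d.bottom, e.bottom]
  · intro k hk
    rw [Equiv.trans_apply, (he.2 k (hout k hk)).1, Equiv.symm_apply_eq, (hd.2 k (hout k hk)).1]
  · intro k y hy
    obtain rfl : y = 1 := le_antisymm y.2.2 hy
    rw [d.top, e.top, Equiv.trans_apply, Equiv.apply_symm_apply]

theorem localPattern_block {n c m : ℕ} (hc : c + m ≤ n + 1) {d : Diagram n}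
    {P : List (Fin m × Fin m)} (h : Fin P.length → I) (hmono : StrictMono h)
    (hpos : ∀ q, 0 < h q ∧ h q < 1)
    (hiff : ∀ s t, s < t → ∀ y, d.strand (blockStrand hc s) y = d.strand (blockStrand hc t) y ↔
      ∃ q, h q = y ∧ P.get q = (s, t)) :
    LocalPattern d (blockStrand hc) 0 1 P := by
  refine ⟨fun s t hst => ?_, h, hmono, hpos, fun s t hst y _ => hiff s t hst y⟩
  rw [d.bottom, d.bottom]
  refine fin_cast_lt ?_
  rw [Fin.lt_def] at hst ⊢
  simp only [blockStrand]
  omega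

theorem half_pos : (0 : I) < half := by
  rw [← Subtype.coe_lt_coe, half_val]
  norm_num

theorem half_lt_one : half < 1 := by
  rw [← Subtype.coe_lt_coe, half_val]
  norm_num

theorem lo_half_pos : 0 < lo half := by
  rw [← Subtype.coe_lt_coe, lo_val, half_val]
  norm_num

theorem lo_lt_hi_half (y : I) : lo y < hi half := by
  rw [← Subtype.coe_lt_coe, lo_val, hi_val, half_val]
  linarith [y.2.2]

theorem hi_half_lt_one : hi half < 1 := by
  rw [← Subtype.coe_lt_coe, hi_val, half_val]
  norm_num

theorem lo_pos {y : I} (h : 0 < y) : 0 < lo y := by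
  rw [← lo_zero]
  exact lo_strictMono h

theorem blockStrand_ne {n c m : ℕ} (hc : c + m ≤ n + 1) {s t : Fin m} (h : s < t) :
    blockStrand hc s ≠ blockStrand hc t := by
  intro h'
  have := congrArg Fin.val h'
  simp only [blockStrand] at this
  rw [Fin.lt_def] at h
  omega

theorem localPattern_elementary {n : ℕ} (i : Fin n) (hc : (i : ℕ) + 2 ≤ n + 1) :
    LocalPattern (elementary i) (blockStrand hc) 0 1 [(0, 1)] := by
  refine localPattern_block hc (fun _ => half) (Subsingleton.strictMono (α := Fin 1) _)
    (fun _ => ⟨half_pos, half_lt_one⟩) fun s t hst y => ?_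
  rw [elementary_meet i (blockStrand_ne hc hst)]
  constructor
  · rintro ⟨rfl, h⟩
    refine ⟨⟨0, by simp⟩, rfl, ?_⟩
    fin_cases s <;> fin_cases t <;> simp_all
  · rintro ⟨q, rfl, h⟩
    obtain ⟨q, hq⟩ := q
    simp only [List.length_cons, List.length_nil] at hq
    interval_cases q
    simp only [List.get_eq_getElem, List.getElem_cons_zero, Prod.mk.injEq] at h
    obtain ⟨rfl, rfl⟩ := h
    exact ⟨rfl, Or.inl ⟨by simp [blockStrand], by simp [blockStrand]⟩⟩

theorem comp_elementary_meet {n : ℕ} (d : Diagram n) (i : Fin n) {a b : Fin (n + 1)} (hab : a ≠ b)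
    (y : I) : (d.comp (elementary i)).strand a y = (d.comp (elementary i)).strand b y ↔
      (∃ z, y = lo z ∧ d.strand a z = d.strand b z) ∨
        (y = hi half ∧ Consecutive i (d.perm a) (d.perm b)) := by
  rw [comp_meet]
  refine or_congr_right ?_
  constructor
  · rintro ⟨z, rfl, h⟩
    rw [elementary_meet i (d.perm.injective.ne hab)] at h
    exact ⟨by rw [h.1], h.2⟩
  · rintro ⟨rfl, h⟩
    exact ⟨half, rfl, (elementary_meet i (d.perm.injective.ne hab) _).2 ⟨rfl, h⟩⟩

theorem comp_elementary_meet₂ {n : ℕ} (i k : Fin n) {a b : Fin (n + 1)} (hab : a ≠ b)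
    (y : I) : ((elementary i).comp (elementary k)).strand a y =
      ((elementary i).comp (elementary k)).strand b y ↔
      (y = lo half ∧ Consecutive i a b) ∨
        (y = hi half ∧ Consecutive k ((elementary i).perm a) ((elementary i).perm b)) := by
  rw [comp_elementary_meet _ _ hab]
  refine or_congr_left ?_
  constructor
  · rintro ⟨z, rfl, h⟩
    rw [elementary_meet i hab] at h
    exact ⟨by rw [h.1], h.2⟩
  · rintro ⟨rfl, h⟩
    exact ⟨half, rfl, (elementary_meet i hab _).2 ⟨rfl, h⟩⟩

theorem comp_elementary_meet₃ {n : ℕ} (i k l : Fin n) {a b : Fin (n + 1)} (hab : a ≠ b)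
    (y : I) : (((elementary i).comp (elementary k)).comp (elementary l)).strand a y =
      (((elementary i).comp (elementary k)).comp (elementary l)).strand b y ↔
      (y = lo (lo half) ∧ Consecutive i a b) ∨
        (y = lo (hi half) ∧ Consecutive k ((elementary i).perm a) ((elementary i).perm b)) ∨
        (y = hi half ∧ Consecutive l ((elementary k).perm ((elementary i).perm a))
          ((elementary k).perm ((elementary i).perm b))) := by
  rw [comp_elementary_meet _ _ hab, comp_perm_apply, comp_perm_apply, ← or_assoc]
  refine or_congr_left ?_
  constructor
  · rintro ⟨z, rfl, h⟩
    rw [comp_elementary_meet₂ i k hab] at h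
    exact h.imp (fun h => ⟨by rw [h.1], h.2⟩) (fun h => ⟨by rw [h.1], h.2⟩)
  · rintro (⟨rfl, h⟩ | ⟨rfl, h⟩)
    · exact ⟨lo half, rfl, (comp_elementary_meet₂ i k hab _).2 (Or.inl ⟨rfl, h⟩)⟩
    · exact ⟨hi half, rfl, (comp_elementary_meet₂ i k hab _).2 (Or.inr ⟨rfl, h⟩)⟩

theorem localPattern_two {n c m : ℕ} (hc : c + m ≤ n + 1) (i k : Fin n) (p q : Fin m × Fin m)
    (h1 : ∀ s t, s < t → (Consecutive i (blockStrand hc s) (blockStrand hc t) ↔ p = (s, t)))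
    (h2 : ∀ s t, s < t → (Consecutive k ((elementary i).perm (blockStrand hc s))
      ((elementary i).perm (blockStrand hc t)) ↔ q = (s, t))) :
    LocalPattern ((elementary i).comp (elementary k)) (blockStrand hc) 0 1 [p, q] := by
  refine localPattern_block hc ![lo half, hi half] ?_ ?_ ?_
  · exact Fin.strictMono_iff_lt_succ.2 fun r => by
      fin_cases r
      exact lo_lt_hi_half _
  · intro r
    change Fin 2 at r
    fin_cases r
    · exact ⟨lo_half_pos, (lo_lt_hi_half _).trans hi_half_lt_one⟩
    · exact ⟨lo_half_pos.trans (lo_lt_hi_half _), hi_half_lt_one⟩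
  · intro s t hst y
    rw [comp_elementary_meet₂ _ _ (blockStrand_ne hc hst), h1 s t hst, h2 s t hst]
    constructor
    · rintro (⟨rfl, h⟩ | ⟨rfl, h⟩)
      · exact ⟨(0 : Fin 2), rfl, h⟩
      · exact ⟨(1 : Fin 2), rfl, h⟩
    · rintro ⟨r, hr, h⟩
      change Fin 2 at r
      fin_cases r
      · exact Or.inl ⟨hr.symm, h⟩
      · exact Or.inr ⟨hr.symm, h⟩

theorem localPattern_three {n c m : ℕ} (hc : c + m ≤ n + 1) (i k l : Fin n)
    (p q r : Fin m × Fin m)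
    (h1 : ∀ s t, s < t → (Consecutive i (blockStrand hc s) (blockStrand hc t) ↔ p = (s, t)))
    (h2 : ∀ s t, s < t → (Consecutive k ((elementary i).perm (blockStrand hc s))
      ((elementary i).perm (blockStrand hc t)) ↔ q = (s, t)))
    (h3 : ∀ s t, s < t → (Consecutive l
      ((elementary k).perm ((elementary i).perm (blockStrand hc s)))
      ((elementary k).perm ((elementary i).perm (blockStrand hc t))) ↔ r = (s, t))) :
    LocalPattern (((elementary i).comp (elementary k)).comp (elementary l)) (blockStrand hc) 0 1
      [p, q, r] := by
  have hlt : lo (lo half) < lo (hi half) := lo_strictMono (lo_lt_hi_half _)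
  refine localPattern_block hc ![lo (lo half), lo (hi half), hi half] ?_ ?_ ?_
  · exact Fin.strictMono_iff_lt_succ.2 fun x => by
      fin_cases x
      · exact hlt
      · exact lo_lt_hi_half _
  · intro x
    change Fin 3 at x
    fin_cases x
    · exact ⟨lo_pos lo_half_pos, (lo_lt_hi_half _).trans hi_half_lt_one⟩
    · exact ⟨(lo_pos lo_half_pos).trans hlt, (lo_lt_hi_half _).trans hi_half_lt_one⟩
    · exact ⟨lo_half_pos.trans (lo_lt_hi_half _), hi_half_lt_one⟩
  · intro s t hst y
    rw [comp_elementary_meet₃ _ _ _ (blockStrand_ne hc hst), h1 s t hst, h2 s t hst, h3 s t hst]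
    constructor
    · rintro (⟨rfl, h⟩ | ⟨rfl, h⟩ | ⟨rfl, h⟩)
      · exact ⟨(0 : Fin 3), rfl, h⟩
      · exact ⟨(1 : Fin 3), rfl, h⟩
      · exact ⟨(2 : Fin 3), rfl, h⟩
    · rintro ⟨x, hx, h⟩
      change Fin 3 at x
      fin_cases x
      · exact Or.inl ⟨hx.symm, h⟩
      · exact Or.inr (Or.inl ⟨hx.symm, h⟩)
      · exact Or.inr (Or.inr ⟨hx.symm, h⟩)

/-- The class of an elementary diagram. -/
noncomputable def elem {n : ℕ} (i : Fin n) : DL n := DL.mk (elementary i)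

theorem elem_idem {n : ℕ} (i : Fin n) : elem i * elem i = elem i := by
  have hc : (i : ℕ) + 2 ≤ n + 1 := by omega
  have hb : (elementary i).InBlock i 2 := inBlock_elementary i le_rfl (by omega)
  refine Quot.sound (.two (localMove_of_block hc two_pos (hb.comp hb) hb ?_
    (localPattern_elementary i hc)))
  refine localPattern_two hc i i _ _ ?_ ?_ <;> intro s t hst <;> fin_cases s <;> fin_cases t <;>
    simp [Consecutive, blockStrand, elementary_perm, swap_val] at hst ⊢

theorem elem_braid {n : ℕ} (i k : Fin n) (h : (k : ℕ) = i + 1) :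
    elem i * elem k * elem i = elem k * elem i * elem k := by
  have hc : (i : ℕ) + 3 ≤ n + 1 := by omega
  have hi : (elementary i).InBlock i 3 := inBlock_elementary i le_rfl (by omega)
  have hk : (elementary k).InBlock i 3 := inBlock_elementary k (by omega) (by omega)
  refine Quot.sound (.three (localMove_of_block hc three_pos ((hi.comp hk).comp hi)
    ((hk.comp hi).comp hk) ?_ ?_)) <;>
  refine localPattern_three hc _ _ _ _ _ _ ?_ ?_ ?_ <;> intro s t hst <;> fin_cases s <;>
    fin_cases t <;>
        simp [Consecutive, blockStrand, elementary_perm, swap_val, h, add_assoc] at hst ⊢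

theorem elem_kiselman {n : ℕ} (i k : Fin n) (h : (k : ℕ) = i + 1) :
    elem k * elem i * elem k = elem i * elem k := by
  have hc : (i : ℕ) + 3 ≤ n + 1 := by omega
  have hi : (elementary i).InBlock i 3 := inBlock_elementary i le_rfl (by omega)
  have hk : (elementary k).InBlock i 3 := inBlock_elementary k (by omega) (by omega)
  refine Quot.sound (.three' (localMove_of_block hc three_pos ((hk.comp hi).comp hk)
    (hi.comp hk) ?_ ?_))
  · refine localPattern_three hc _ _ _ _ _ _ ?_ ?_ ?_ <;> intro s t hst <;> fin_cases s <;>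
      fin_cases t <;>
        simp [Consecutive, blockStrand, elementary_perm, swap_val, h, add_assoc] at hst ⊢
  · refine localPattern_two hc _ _ _ _ ?_ ?_ <;> intro s t hst <;> fin_cases s <;>
      fin_cases t <;>
        simp [Consecutive, blockStrand, elementary_perm, swap_val, h, add_assoc] at hst ⊢

theorem elem_comm {n : ℕ} (i k : Fin n) (h : (k : ℕ) + 1 < i) :
    elem i * elem k = elem k * elem i := by
  have hcomm : (Equiv.swap i.castSucc i.succ : Equiv.Perm (Fin (n + 1))).trans
      (Equiv.swap k.castSucc k.succ) =
      (Equiv.swap k.castSucc k.succ).trans (Equiv.swap i.castSucc i.succ) := by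
    ext a
    simp only [Equiv.trans_apply, swap_val]
    split_ifs <;> omega
  have hav : Avoids321 ((Equiv.swap i.castSucc i.succ : Equiv.Perm (Fin (n + 1))).trans
      (Equiv.swap k.castSucc k.succ)) := by
    have hv : ∀ x : Fin (n + 1), (((Equiv.swap i.castSucc i.succ : Equiv.Perm (Fin (n + 1))).trans
        (Equiv.swap k.castSucc k.succ)) x).val =
        if x.val = i.val then i.val + 1 else if x.val = i.val + 1 then i.val else
        if x.val = k.val then k.val + 1 else if x.val = k.val + 1 then k.val else x.val := by
      intro x
      simp only [Equiv.trans_apply, swap_val]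
      split_ifs <;> omega
    -- the only inversions are those of the two factors
    have key : ∀ a b : Fin (n + 1), a < b →
        ((Equiv.swap i.castSucc i.succ : Equiv.Perm (Fin (n + 1))).trans
          (Equiv.swap k.castSucc k.succ)) b < ((Equiv.swap i.castSucc i.succ).trans
          (Equiv.swap k.castSucc k.succ)) a → b.val = a.val + 1 ∧ (a.val = i ∨ a.val = k) := by
      intro a b hab hlt
      rw [Fin.lt_def, hv, hv] at hlt
      rw [Fin.lt_def] at hab
      split_ifs at hlt <;> omega
    rintro ⟨a, b, c, hab, hbc, h1, h2⟩
    have := key a b hab h1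
    have := key b c hbc h2
    omega
  have hadd : ∀ i k : Fin n, ((k : ℕ) + 1 < i ∨ (i : ℕ) + 1 < k) → ∀ a b : Fin (n + 1), a < b →
      Equiv.swap i.castSucc i.succ b < Equiv.swap i.castSucc i.succ a →
      Equiv.swap k.castSucc k.succ (Equiv.swap i.castSucc i.succ b) <
        Equiv.swap k.castSucc k.succ (Equiv.swap i.castSucc i.succ a) := by
    intro i k hik a b hab hlt
    rw [Fin.lt_def] at hab hlt ⊢
    simp only [swap_val] at hlt ⊢
    split_ifs at hlt ⊢ <;> omega
  have h1 := isotopic_straight_comp (avoids321_swap i) (avoids321_swap k) hav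
    (hadd i k (Or.inl h))
  have h2 := isotopic_straight_comp (avoids321_swap k) (avoids321_swap i) (hcomm ▸ hav)
    (hadd k i (Or.inr h))
  simp only [← hcomm] at h2
  exact (DL.mk_eq_of_isotopic h1).symm.trans (DL.mk_eq_of_isotopic h2)

/-- The homomorphism `ε`, sending the generators of `L_n` to the elementary diagrams. -/
noncomputable def eps (n : ℕ) : LMonoid n →* DL n :=
  PresentedMonoid.lift elem fun a b hab => by
    rcases hab with i | ⟨i, j, h⟩ | ⟨i, j, h⟩ | ⟨i, j, h⟩ <;>
      simp only [map_mul, FreeMonoid.lift_eval_of]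
    · exact elem_idem i
    · exact elem_comm i j h
    · exact elem_braid i j h
    · exact elem_kiselman i j h

theorem eps_gen {n : ℕ} (i : Fin n) : eps n (gen i) = elem i := rfl

/-- By induction on the number of inversions: an adjacent pair of inverted values is exchanged by an
elementary diagram, which can be split off at the top. -/
theorem straight_mem_range_eps {n : ℕ} {s : Equiv.Perm (Fin (n + 1))} (hs : Avoids321 s) :
    ∃ x, eps n x = DL.mk (straight s hs) := by
  induction hk : (inversions s).card using Nat.strong_induction_on generalizing s with
  | _ k ih =>
    by_cases h1 : s = 1
    · subst h1
      exact ⟨1, map_one _⟩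
    · obtain ⟨i, hi⟩ := exists_descent h1
      have hs' : Avoids321 (s.trans (Equiv.swap i.castSucc i.succ)) :=
        avoids321_of_inversions hs fun a b hab h => lt_of_swap_lt hi hab h
      obtain ⟨x, hx⟩ := ih _ (hk ▸ card_inversions_swap hi) hs' rfl
      refine ⟨x * gen i, ?_⟩
      rw [map_mul, hx, eps_gen]
      exact (DL.mk_eq_of_isotopic (isotopic_straight_descent hs hi hs')).symm

/-! ### Every diagram is a product of elementary diagrams -/

theorem exists_eq_between (f g : C(I, ℝ)) {a b : I} (hab : a ≤ b) (h1 : f a ≤ g a)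
    (h2 : g b ≤ f b) : ∃ z, a ≤ z ∧ z ≤ b ∧ f z = g z := by
  obtain ⟨z, hz, h⟩ := isPreconnected_Icc.intermediate_value₂ (Set.left_mem_Icc.2 hab)
    (Set.right_mem_Icc.2 hab) f.continuous.continuousOn g.continuous.continuousOn h1 h2
  exact ⟨z, hz.1, hz.2, h⟩

/-- Two functions that do not meet between two heights are in the same order at both. -/
theorem lt_iff_of_no_meet (f g : C(I, ℝ)) {a b : I} (hab : a ≤ b)
    (h : ∀ z, a ≤ z → z ≤ b → f z ≠ g z) : f a < g a ↔ f b < g b := by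
  constructor
  · intro h1
    by_contra hc
    obtain ⟨z, hz, hz', h'⟩ := exists_eq_between f g hab h1.le (not_lt.1 hc)
    exact h z hz hz' h'
  · intro h1
    by_contra hc
    obtain ⟨z, hz, hz', h'⟩ := exists_eq_between g f hab (not_lt.1 hc) h1.le
    exact h z hz hz' h'.symm

theorem Diagram.bottom_lt {n : ℕ} (d : Diagram n) (i j : Fin (n + 1)) :
    d.strand i 0 < d.strand j 0 ↔ i < j := by
  rw [d.bottom, d.bottom, add_lt_add_iff_right, Nat.cast_lt, Fin.lt_def]

theorem Diagram.top_lt {n : ℕ} (d : Diagram n) (i j : Fin (n + 1)) :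
    d.strand i 1 < d.strand j 1 ↔ d.perm i < d.perm j := by
  rw [d.top, d.top, add_lt_add_iff_right, Nat.cast_lt, Fin.lt_def]

/-- The heights of the crossings of a diagram. -/
def Diagram.heights {n : ℕ} (d : Diagram n) : Set I :=
  {y | ∃ i j, i ≠ j ∧ d.strand i y = d.strand j y}

theorem Diagram.heights_finite {n : ℕ} (d : Diagram n) : d.heights.Finite := by
  have h : (⋃ i : Fin (n + 1), ⋃ j : Fin (n + 1), ⋃ _ : i ≠ j,
      {y : I | d.strand i y = d.strand j y}).Finite :=
    Set.finite_iUnion fun i => Set.finite_iUnion fun j => Set.finite_iUnion fun hij =>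
      d.finite_meet i j hij
  refine h.subset ?_
  rintro y ⟨i, j, h1, h2⟩
  simp only [Set.mem_iUnion]
  exact ⟨i, j, h1, h2⟩

theorem exists_rank {m : ℕ} {f : Fin m → ℝ} (hf : Function.Injective f) :
    ∃ p : Equiv.Perm (Fin m), ∀ i j, f i < f j ↔ p i < p j := by
  have h : StrictMono (f ∘ Tuple.sort f) :=
    (Tuple.monotone_sort f).strictMono_of_injective (hf.comp (Tuple.sort f).injective)
  refine ⟨(Tuple.sort f).symm, fun i j => ?_⟩
  rw [← h.lt_iff_lt]
  simp

/-- A reparametrization of the interval taking given values at `1/2` and `3/4`. -/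
theorem exists_reparam {v h : ℝ} (hv : 0 < v) (hvh : v < h) (h1 : h < 1) :
    ∃ g : C(I, I), StrictMono g ∧ g 0 = 0 ∧ g 1 = 1 ∧ (∀ z, ((g (lo z) : I) : ℝ) = v * z) ∧
      (∀ z : I, (z : ℝ) ≤ 1 / 2 → ((g (hi z) : I) : ℝ) = v + 2 * (h - v) * z) ∧
      (∀ z : I, 1 / 2 ≤ (z : ℝ) → ((g (hi z) : I) : ℝ) = h + (1 - h) * (2 * z - 1)) := by
  let A : ℝ → ℝ := fun y => min y (1 / 2)
  let B : ℝ → ℝ := fun y => max (1 / 2) (min y (3 / 4)) - 1 / 2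
  let D : ℝ → ℝ := fun y => max (3 / 4) y - 3 / 4
  have hsum : ∀ y, A y + B y + D y = y := by
    intro y
    simp only [A, B, D]
    rcases le_total y (1 / 2) with h1 | h1
    · rw [min_eq_left h1, min_eq_left (by linarith), max_eq_left h1, max_eq_left (by linarith)]
      ring
    · rcases le_total y (3 / 4) with h2 | h2
      · rw [min_eq_right h1, min_eq_left h2, max_eq_right h1, max_eq_left h2]
        ring
      · rw [min_eq_right h1, min_eq_right h2, max_eq_right (by norm_num), max_eq_right h2]
        ring
  have hA : Monotone A := fun y z h => min_le_min_right _ h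
  have hB : Monotone B := fun y z h =>
    sub_le_sub_right (max_le_max_left _ (min_le_min_right _ h)) _
  have hD : Monotone D := fun y z h => sub_le_sub_right (max_le_max_left _ h) _
  let f : ℝ → ℝ := fun y => 2 * v * A y + 4 * (h - v) * B y + 4 * (1 - h) * D y
  have hf : StrictMono f := by
    intro y z hyz
    have h1 := hsum y
    have h2 := hsum z
    have hA' := hA hyz.le
    have hB' := hB hyz.le
    have hD' := hD hyz.le
    simp only [f]
    by_contra hc
    have p1 := mul_nonneg hv.le (sub_nonneg.2 hA')
    have p2 := mul_nonneg (sub_nonneg.2 hvh.le) (sub_nonneg.2 hB')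
    have p3 := mul_nonneg (sub_nonneg.2 h1.le) (sub_nonneg.2 hD')
    have q1 : v * (A z - A y) = 0 := by nlinarith
    have q2 : (h - v) * (B z - B y) = 0 := by nlinarith
    have q3 : (1 - h) * (D z - D y) = 0 := by nlinarith
    have r1 := (mul_eq_zero.1 q1).resolve_left hv.ne'
    have r2 := (mul_eq_zero.1 q2).resolve_left (sub_pos.2 hvh).ne'
    have r3 := (mul_eq_zero.1 q3).resolve_left (by linarith)
    linarith
  have hf0 : f 0 = 0 := by norm_num [f, A, B, D]
  have hf1 : f 1 = 1 := by norm_num [f, A, B, D]; ring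
  have hfc : Continuous f := by simp only [f, A, B, D]; fun_prop
  refine ⟨⟨fun y => ⟨f y, hf0 ▸ hf.monotone y.2.1, hf1 ▸ hf.monotone y.2.2⟩, by fun_prop⟩,
    fun y z h => hf h, Subtype.ext hf0, Subtype.ext hf1, ?_, ?_, ?_⟩
  · intro z
    change f (lo z) = _
    have := z.2.2
    simp only [f, A, B, D, lo_val]
    rw [min_eq_left (by linarith), min_eq_left (by linarith), max_eq_left (by linarith),
      max_eq_left (by linarith)]
    ring
  · intro z hz
    change f (hi z) = _
    have := z.2.1
    simp only [f, A, B, D, hi_val]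
    rw [min_eq_right (by linarith), min_eq_left (by linarith), max_eq_right (by linarith),
      max_eq_left (by linarith)]
    ring
  · intro z hz
    change f (hi z) = _
    have := z.2.2
    simp only [f, A, B, D, hi_val]
    rw [min_eq_right (by linarith), min_eq_right (by linarith), max_eq_right (by norm_num),
      max_eq_right (by linarith)]
    ring

/-- The part of a diagram below the height `v`, stretched to the whole interval. There is no
crossing between the heights `w` and `v`, so that the strands can be moved to integer places there,
without changing their order. -/
theorem Diagram.exists_lower {n : ℕ} (d : Diagram n) {w v : I} (hwv : w < v)
    (hno : ∀ y ∈ d.heights, y ≤ v → y ≤ w) (p : Equiv.Perm (Fin (n + 1)))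
    (hp : ∀ i j, d.strand i v < d.strand j v ↔ p i < p j) :
    ∃ d' : Diagram n, d'.perm = p ∧ ∀ z i j, d'.strand i z < d'.strand j z ↔
      d.strand i (v * z) < d.strand j (v * z) := by
  have hwv' : (w : ℝ) < v := hwv
  have hv0 : 0 < (v : ℝ) := lt_of_le_of_lt w.2.1 hwv'
  let g : C(I, I) := ⟨fun z => v * z, by fun_prop⟩
  have hg : StrictMono g := by
    intro y z hyz
    have hyz : (y : ℝ) < z := hyz
    change (v : ℝ) * y < v * z
    exact mul_lt_mul_of_pos_left hyz hv0
  let β : C(I, I) := ⟨fun z => ⟨max 0 (((v : ℝ) * z - w) / (v - w)), le_max_left _ _,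
    max_le zero_le_one (by
      rw [div_le_one (sub_pos.2 hwv')]
      nlinarith [z.2.2])⟩, by fun_prop⟩
  have hβ : ∀ z, ((β z : I) : ℝ) = max 0 (((v : ℝ) * z - w) / (v - w)) := fun z => rfl
  have hβ0 : ((β 0 : I) : ℝ) = 0 := by
    rw [hβ, max_eq_left]
    refine div_nonpos_of_nonpos_of_nonneg ?_ (sub_pos.2 hwv').le
    have := w.2.1
    simpa using this
  have hβ1 : ((β 1 : I) : ℝ) = 1 := by
    rw [hβ]
    have : ((v : ℝ) * ((1 : I) : ℝ) - w) / (v - w) = 1 := by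
      rw [Set.Icc.coe_one, mul_one, div_self (sub_pos.2 hwv').ne']
    rw [this]
    norm_num
  let e : Fin (n + 1) → C(I, ℝ) := fun i =>
    ⟨fun z => (1 - ((β z : I) : ℝ)) * d.strand i (g z) + β z * ((p i : ℝ) + 1), by fun_prop⟩
  have he : ∀ i z, e i z =
      (1 - ((β z : I) : ℝ)) * d.strand i (g z) + β z * ((p i : ℝ) + 1) := fun i z => rfl
  have ord : ∀ y i j, e i y < e j y ↔ d.strand i (g y) < d.strand j (g y) := by
    intro y i j
    rw [he, he]
    by_cases hy : g y ≤ w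
    · have hy' : (v : ℝ) * y ≤ w := hy
      have h0 : ((β y : I) : ℝ) = 0 := by
        rw [hβ, max_eq_left]
        exact div_nonpos_of_nonpos_of_nonneg (by linarith) (sub_pos.2 hwv').le
      rw [h0]
      simp
    · refine lerp_lt_iff (a := fun i => d.strand i (g y)) (b := fun i => (p i : ℝ) + 1) ?_ _ i j
      intro i j
      have hgv : g y ≤ v := by
        change (v : ℝ) * y ≤ v
        nlinarith [y.2.2]
      rw [add_lt_add_iff_right, Nat.cast_lt, ← Fin.lt_def, ← hp]
      by_cases hij : i = j
      · subst hij
        simp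
      · refine (lt_iff_of_no_meet _ _ hgv fun z hz hz' hzz => ?_).symm
        exact hy (hz.trans (hno z ⟨i, j, hij, hzz⟩ hz'))
  refine ⟨d.pull g hg.monotone (fun y z h h' => absurd h' (hg h).ne) p e ?_ ?_ ord, rfl,
    fun z i j => ord z i j⟩
  · intro i
    have : g 0 = 0 := Subtype.ext (mul_zero _)
    rw [he, hβ0, this, d.bottom]
    ring
  · intro i
    rw [he, hβ1]
    ring

/-- The topmost crossings can be split off from a diagram: they form a product of disjoint
transpositions of adjacent strands. -/
theorem Diagram.exists_peel {n : ℕ} (d : Diagram n) (hne : d.heights.Nonempty) :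
    ∃ (d' : Diagram n) (s : Equiv.Perm (Fin (n + 1))) (hs : Avoids321 s) (g : C(I, I)),
      d'.heights.ncard < d.heights.ncard ∧ d'.perm.trans s = d.perm ∧ StrictMono g ∧ g 0 = 0 ∧
      g 1 = 1 ∧ ∀ y i j, (d'.comp (straight s hs)).strand i y < (d'.comp (straight s hs)).strand j y
        ↔ d.strand i (g y) < d.strand j (g y) := by
  -- `h` is the highest height of a crossing and `w` the next lower one, or `0` if there is none;
  -- the diagram is cut at the height `v` in between
  obtain ⟨h, hh, hmax⟩ := Set.exists_max_image d.heights id d.heights_finite hne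
  simp only [id] at hmax
  obtain ⟨hpos, hlt1⟩ : 0 < h ∧ h < 1 := by
    obtain ⟨i, j, hij, hm⟩ := hh
    exact d.meet_pos hij hm
  obtain ⟨w, hw, hwmax⟩ := Set.exists_max_image (insert 0 (d.heights \ {h})) id
    ((d.heights_finite.subset Set.sdiff_subset).insert 0) ⟨0, Set.mem_insert _ _⟩
  simp only [id] at hwmax
  have hwh : w < h := by
    rcases hw with rfl | hw
    · exact hpos
    · exact lt_of_le_of_ne (hmax w hw.1) hw.2
  obtain ⟨v, hwv, hvh⟩ := exists_between hwh
  have hv0 : 0 < v := lt_of_le_of_lt w.2.1 hwv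
  have hno : ∀ y ∈ d.heights, y ≤ v → y ≤ w := fun y hy hyv =>
    hwmax y (Or.inr ⟨hy, fun h' => (lt_of_le_of_lt hyv hvh).ne h'⟩)
  have hno' : ∀ y, v ≤ y → y ≠ h → ∀ i j, i ≠ j → d.strand i y ≠ d.strand j y := by
    intro y hvy hyh i j hij hm
    exact (lt_of_lt_of_le hwv hvy).not_ge (hwmax y (Or.inr ⟨⟨i, j, hij, hm⟩, hyh⟩))
  have hvinj : Function.Injective fun i => d.strand i v := fun i j hij => by
    by_contra hc
    exact hno' v le_rfl hvh.ne i j hc hij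
  obtain ⟨p, hp⟩ := exists_rank hvinj
  -- the order of the strands below, above and at the height `h`
  have O1 : ∀ x, v ≤ x → x < h → ∀ i j, d.strand i x < d.strand j x ↔ p i < p j := by
    intro x hvx hxh i j
    rw [← hp]
    rcases eq_or_ne i j with rfl | hij
    · simp
    · exact (lt_iff_of_no_meet _ _ hvx fun z hz hz' =>
        hno' z hz (lt_of_le_of_lt hz' hxh).ne i j hij).symm
  have O2 : ∀ x, h < x → ∀ i j, d.strand i x < d.strand j x ↔ d.perm i < d.perm j := by
    intro x hxh i j
    rw [← d.top_lt]
    rcases eq_or_ne i j with rfl | hij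
    · simp
    · exact lt_iff_of_no_meet _ _ x.2.2 fun z hz _ =>
        hno' z (hvh.le.trans (hxh.le.trans hz)) (lt_of_lt_of_le hxh hz).ne' i j hij
  have cross : ∀ i j, CrossesAt (d.strand i) (d.strand j) h → p i < p j ∧ d.perm j < d.perm i := by
    rintro i j ⟨a, b, ha, hb, h1, h2⟩
    obtain ⟨z, hz, hz'⟩ := exists_between (max_lt ha hvh)
    obtain ⟨z', hz1, hz1'⟩ := exists_between hb
    exact ⟨(O1 z ((le_max_right _ _).trans hz.le) hz' i j).1
      (h1 z ⟨lt_of_le_of_lt (le_max_left _ _) hz, hz'⟩), (O2 z' hz1 j i).1 (h2 z' ⟨hz1, hz1'⟩)⟩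
  have O3 : ∀ i j, p i < p j → (d.strand i h = d.strand j h ↔ d.perm j < d.perm i) := by
    intro i j hij
    have hne : i ≠ j := fun h' => by
      subst h'
      exact hij.false
    constructor
    · intro hm
      rcases d.crossing i j hne h hm with h' | h'
      · exact (cross i j h').2
      · exact absurd (cross j i h').1 hij.asymm
    · intro hperm
      by_contra hm
      have := (lt_iff_of_no_meet (d.strand i) (d.strand j) (b := 1) v.2.2 fun z hz _ => by
        by_cases hzh : z = h
        · rw [hzh]
          exact hm
        · exact hno' z hz hzh i j hne).1 ((hp i j).2 hij)
      exact ((d.top_lt i j).1 this).asymm hperm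
  have O4 : ∀ i j, d.strand i h ≠ d.strand j h → (d.strand i h < d.strand j h ↔ p i < p j) := by
    intro i j hm
    have hne : i ≠ j := fun h' => hm (by rw [h'])
    rw [← hp]
    refine (lt_iff_of_no_meet _ _ hvh.le fun z hz hz' => ?_).symm
    by_cases hzh : z = h
    · rw [hzh]
      exact hm
    · exact hno' z hz hzh i j hne
  set s : Equiv.Perm (Fin (n + 1)) := p.symm.trans d.perm with hsdef
  have hsp : ∀ i, s (p i) = d.perm i := fun i => by simp [hsdef]
  -- a strand that is between two strands before they cross would give a triple point
  have adj : ∀ a b : Fin (n + 1), a < b → s b < s a → (b : ℕ) = a + 1 := by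
    intro a b hab hsab
    obtain ⟨i, rfl⟩ := p.surjective a
    obtain ⟨j, rfl⟩ := p.surjective b
    rw [hsp, hsp] at hsab
    have hm := (O3 i j hab).2 hsab
    by_contra hc
    have hab' : (p i : ℕ) < p j := hab
    obtain ⟨k, hk⟩ := p.surjective ⟨(p i : ℕ) + 1, by omega⟩
    have hik : p i < p k := by rw [hk, Fin.lt_def]; simp
    have hkj : p k < p j := by rw [hk, Fin.lt_def]; simp only; omega
    have hik' : i ≠ k := fun h' => hik.ne (by rw [h'])
    have hkj' : k ≠ j := fun h' => hkj.ne (by rw [h'])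
    have hij' : i ≠ j := fun h' => hab.ne (by rw [h'])
    by_cases h1 : d.strand i h = d.strand k h
    · exact d.no_triple i k j hik' hkj' hij' h ⟨h1, h1 ▸ hm⟩
    · by_cases h2 : d.strand k h = d.strand j h
      · exact d.no_triple i k j hik' hkj' hij' h ⟨hm.trans h2.symm, h2⟩
      · exact absurd hm ((lt_trans ((O4 i k h1).2 hik) ((O4 k j h2).2 hkj)).ne)
  -- hence the transpositions forming `s` are disjoint
  have adjv : ∀ a b : Fin (n + 1), a < b → s b < s a → (s a : ℕ) = s b + 1 := by
    intro a b hab hsab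
    by_contra hc
    have hsab' : (s b : ℕ) < s a := hsab
    obtain ⟨k, hk⟩ := s.surjective ⟨(s b : ℕ) + 1, by omega⟩
    have h1 : s b < s k := by rw [hk, Fin.lt_def]; simp
    have h2 : s k < s a := by rw [hk, Fin.lt_def]; simp only; omega
    have h3 := adj a b hab hsab
    rcases lt_trichotomy k a with hka | rfl | hka
    · have := adj k b (hka.trans hab) h1
      rw [Fin.lt_def] at hka
      omega
    · exact h2.false
    · rcases lt_trichotomy k b with hkb | rfl | hkb
      · rw [Fin.lt_def] at hka hkb
        omega
      · exact h1.false
      · have := adj a k hka h2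
        rw [Fin.lt_def] at hkb
        omega
  have hs : Avoids321 s := by
    rintro ⟨i, j, k, hij, hjk, h1, h2⟩
    have e1 := adj i j hij h1
    have e2 := adj i k (hij.trans hjk) (h2.trans h1)
    rw [Fin.lt_def] at hjk
    omega
  obtain ⟨d', hd'p, hd'⟩ := d.exists_lower hwv hno p hp
  obtain ⟨g, hg, hg0, hg1, hglo, hghi, hghi'⟩ := exists_reparam (v := v) (h := h) hv0 hvh hlt1
  refine ⟨d', s, hs, g, ?_, ?_, hg, hg0, hg1, ?_⟩
  · have him : (fun z => v * z) '' d'.heights ⊆ d.heights \ {h} := by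
      rintro _ ⟨z, ⟨i, j, hij, hm⟩, rfl⟩
      refine ⟨⟨i, j, hij, (eq_iff_of_order (hd' z) i j).1 hm⟩, fun h' => ?_⟩
      have h1 : v * z ≤ v := by
        change (v : ℝ) * z ≤ v
        nlinarith [v.2.1, z.2.2]
      exact (lt_of_le_of_lt h1 hvh).ne h'
    have hinj : Function.Injective fun z : I => v * z := by
      intro y z hyz
      have := congrArg Subtype.val hyz
      exact Subtype.ext (mul_left_cancel₀ (a := (v : ℝ)) (by
        intro h'
        exact hv0.ne' (Subtype.ext h')) this)
    rw [← Set.ncard_image_of_injective d'.heights hinj]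
    refine lt_of_le_of_lt (Set.ncard_le_ncard him (d.heights_finite.subset Set.sdiff_subset)) ?_
    exact Set.ncard_sdiff_singleton_lt_of_mem hh d.heights_finite
  · rw [hd'p]
    ext i
    simp [hsdef]
  · intro y i j
    rcases lo_or_hi y with ⟨z, -, rfl⟩ | ⟨z, rfl⟩
    · have : g (lo z) = v * z := Subtype.ext (hglo z)
      rw [comp_strand_lo, comp_strand_lo, hd', this]
    · rw [comp_strand_hi, comp_strand_hi, hd'p]
      -- the order of two strands of the upper part
      have key : ∀ i j, p i < p j →
          ((straight s hs).strand (p i) z < (straight s hs).strand (p j) z ↔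
            d.strand i (g (hi z)) < d.strand j (g (hi z))) ∧
          ((straight s hs).strand (p j) z < (straight s hs).strand (p i) z ↔
            d.strand j (g (hi z)) < d.strand i (g (hi z))) := by
        intro i j hij
        have hval : d.perm j < d.perm i → (straight s hs).strand (p i) z -
            (straight s hs).strand (p j) z = 2 * (z : ℝ) - 1 := by
          intro hperm
          have e1 : ((p j : ℕ) : ℝ) = (p i : ℕ) + 1 := by
            exact_mod_cast adj _ _ hij (by rwa [hsp, hsp])
          have e2 : ((s (p i) : ℕ) : ℝ) = (s (p j) : ℕ) + 1 := by
            exact_mod_cast adjv _ _ hij (by rwa [hsp, hsp])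
          rw [straight_strand, straight_strand, e1, e2]
          ring
        have hst : d.perm i < d.perm j →
            (straight s hs).strand (p i) z < (straight s hs).strand (p j) z := fun hperm =>
          straight_lt hs hij (by rwa [hsp, hsp]) z
        have hne : d.perm i ≠ d.perm j := fun h' => hij.ne (by rw [d.perm.injective h'])
        rcases lt_trichotomy (z : ℝ) (1 / 2) with hz | hz | hz
        · have e := hghi z hz.le
          have f1 : v ≤ g (hi z) := by
            change (v : ℝ) ≤ _
            have : (v : ℝ) < h := hvh
            rw [e]
            nlinarith [z.2.1]
          have f2 : g (hi z) < h := by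
            change _ < (h : ℝ)
            have : (v : ℝ) < h := hvh
            rw [e]
            nlinarith
          rw [O1 _ f1 f2, O1 _ f1 f2]
          have : (straight s hs).strand (p i) z < (straight s hs).strand (p j) z := by
            rcases lt_or_gt_of_ne hne with h' | h'
            · exact hst h'
            · linarith [hval h']
          exact ⟨iff_of_true this hij, iff_of_false this.asymm hij.asymm⟩
        · have e : g (hi z) = h := Subtype.ext (by rw [hghi z hz.le, hz]; ring)
          rw [e]
          rcases lt_or_gt_of_ne hne with h' | h'
          · have hm : d.strand i h ≠ d.strand j h := fun hm => h'.asymm ((O3 i j hij).1 hm)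
            have h1 := (O4 i j hm).2 hij
            exact ⟨iff_of_true (hst h') h1, iff_of_false (hst h').asymm h1.asymm⟩
          · have hm := (O3 i j hij).2 h'
            have h1 := hval h'
            have h2 : (straight s hs).strand (p i) z = (straight s hs).strand (p j) z := by
              linarith
            rw [h2, hm]
            simp
        · have e := hghi' z hz.le
          have f2 : h < g (hi z) := by
            change (h : ℝ) < _
            have : (h : ℝ) < 1 := hlt1
            rw [e]
            nlinarith
          rw [O2 _ f2, O2 _ f2]
          rcases lt_or_gt_of_ne hne with h' | h'
          · exact ⟨iff_of_true (hst h') h', iff_of_false (hst h').asymm h'.asymm⟩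
          · have : (straight s hs).strand (p j) z < (straight s hs).strand (p i) z := by
              linarith [hval h']
            exact ⟨iff_of_false this.asymm h'.asymm, iff_of_true this h'⟩
      rcases lt_trichotomy (p i) (p j) with hij | hij | hij
      · exact (key i j hij).1
      · rw [p.injective hij]
        simp
      · exact (key j i hij).2

theorem Diagram.isotopic_trivial {n : ℕ} (d : Diagram n) (h : d.heights = ∅) :
    d.perm = 1 ∧ Isotopic d (trivialDiagram n) := by
  have hno : ∀ i j, i ≠ j → ∀ y, d.strand i y ≠ d.strand j y := fun i j hij y hy => by
    have : y ∈ d.heights := ⟨i, j, hij, hy⟩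
    rw [h] at this
    exact this
  have ho : ∀ y i j, d.strand i y < d.strand j y ↔ i < j := by
    intro y i j
    rcases eq_or_ne i j with rfl | hij
    · simp
    · rw [← d.bottom_lt]
      exact (lt_iff_of_no_meet _ _ y.2.1 fun z _ _ => hno i j hij z).symm
  have hp : d.perm = 1 := perm_eq_one_of_strictMono fun i j hij =>
    (d.top_lt i j).1 ((ho 1 i j).2 hij)
  refine ⟨hp, isotopic_of_same_order hp.symm fun y i j => ?_⟩
  rw [ho, trivialDiagram_strand, trivialDiagram_strand, add_lt_add_iff_right, Nat.cast_lt,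
    Fin.lt_def]

theorem isotopic_of_reparam {n : ℕ} {d e : Diagram n} (hp : e.perm = d.perm) {g : C(I, I)}
    (hg : StrictMono g) (h0 : g 0 = 0) (h1 : g 1 = 1)
    (ord : ∀ y i j, e.strand i y < e.strand j y ↔ d.strand i (g y) < d.strand j (g y)) :
    Isotopic d e :=
  isotopic_of_order hp g hg.monotone (fun _ _ h h' => absurd h' (hg h).ne) h0 h1 ord

/-- By induction on the number of heights of crossings, split off the topmost crossings. -/
theorem mk_mem_range_eps {n : ℕ} (d : Diagram n) : ∃ x, eps n x = DL.mk d := by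
  induction hk : d.heights.ncard using Nat.strong_induction_on generalizing d with
  | _ k ih =>
    rcases Set.eq_empty_or_nonempty d.heights with h | h
    · refine ⟨1, ?_⟩
      rw [map_one, DL.one_def]
      exact (DL.mk_eq_of_isotopic (d.isotopic_trivial h).2).symm
    · obtain ⟨d', s, hs, g, hlt, hp, hg, h0, h1, ord⟩ := d.exists_peel h
      obtain ⟨x, hx⟩ := ih _ (hk ▸ hlt) d' rfl
      obtain ⟨y, hy⟩ := straight_mem_range_eps hs
      refine ⟨x * y, ?_⟩
      rw [map_mul, hx, hy, DL.mk_mul_mk]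
      exact (DL.mk_eq_of_isotopic (isotopic_of_reparam hp hg h0 h1 ord)).symm

theorem eps_surjective (n : ℕ) : Function.Surjective (eps n) := by
  intro x
  obtain ⟨d, rfl⟩ := DL.exists_mk x
  exact mk_mem_range_eps d

/-! ### Webs are straight -/

theorem Diagram.meet_of_inversion {n : ℕ} (d : Diagram n) {i j : Fin (n + 1)} (hij : i < j)
    (h : d.perm j < d.perm i) : ∃ y, d.strand i y = d.strand j y := by
  obtain ⟨z, -, -, hz⟩ := exists_eq_between (d.strand i) (d.strand j) (zero_le_one (α := I))
    ((d.bottom_lt i j).2 hij).le ((d.top_lt j i).2 h).le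
  exact ⟨z, hz⟩

theorem Diagram.IsWeb.avoids321 {n : ℕ} {d : Diagram n} (h : d.IsWeb) : Avoids321 d.perm := by
  rintro ⟨i, j, k, hij, hjk, h1, h2⟩
  exact h.2 ⟨i, j, k, hij.ne, hjk.ne, (hij.trans hjk).ne, d.meet_of_inversion hij h1,
    d.meet_of_inversion hjk h2, d.meet_of_inversion (hij.trans hjk) (h2.trans h1)⟩

theorem Diagram.IsWeb.of_meets {n : ℕ} {d e : Diagram n} (h : d.IsWeb) {g : I → I}
    (hg : Function.Injective g)
    (hm : ∀ y i j, e.strand i y = e.strand j y → d.strand i (g y) = d.strand j (g y)) :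
    e.IsWeb := by
  refine ⟨fun i j hij y hy z hz => hg (h.1 i j hij (hm y i j hy) (hm z i j hz)), ?_⟩
  rintro ⟨i, j, k, hij, hjk, hik, ⟨y, hy⟩, ⟨z, hz⟩, w, hw⟩
  exact h.2 ⟨i, j, k, hij, hjk, hik, ⟨_, hm y i j hy⟩, ⟨_, hm z j k hz⟩, ⟨_, hm w i k hw⟩⟩

/-- A web is isotopic to the diagram with straight strands and the same endpoints. By induction on
the number of heights of crossings: after the topmost crossings have been split off, the lower part
is straightened. As two strands of a web cross at most once, the upper part undoes no inversion of
the lower one, and the composite can be straightened as well. -/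
theorem Diagram.IsWeb.isotopic_straight {n : ℕ} {d : Diagram n} (h : d.IsWeb) :
    Isotopic d (straight d.perm h.avoids321) := by
  induction hk : d.heights.ncard using Nat.strong_induction_on generalizing d with
  | _ k ih =>
    rcases Set.eq_empty_or_nonempty d.heights with h' | h'
    · obtain ⟨hp, hi⟩ := d.isotopic_trivial h'
      have : straight d.perm h.avoids321 = trivialDiagram n := by
        unfold trivialDiagram
        congr 1
      rw [this]
      exact hi
    · obtain ⟨d', s, hs, g, hlt, hp, hg, h0, h1, ord⟩ := d.exists_peel h'
      have hweb : (d'.comp (straight s hs)).IsWeb :=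
        h.of_meets hg.injective fun y i j => (eq_iff_of_order (ord y) i j).1
      have hweb' : d'.IsWeb := hweb.of_meets lo_strictMono.injective fun y i j hy => by
        rwa [comp_strand_lo, comp_strand_lo]
      have hiso := ih _ (hk ▸ hlt) hweb' rfl
      have hadd : ∀ i j, i < j → d'.perm j < d'.perm i → s (d'.perm j) < s (d'.perm i) := by
        intro i j hij hinv
        by_contra hc
        have hc : s (d'.perm i) < s (d'.perm j) :=
          lt_of_le_of_ne (not_lt.1 hc) (s.injective.ne (d'.perm.injective.ne hij.ne))
        obtain ⟨y, hy⟩ := d'.meet_of_inversion hij hinv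
        obtain ⟨z, hz⟩ := (straight s hs).meet_of_inversion hinv hc
        have m1 : (d'.comp (straight s hs)).strand i (lo y) =
            (d'.comp (straight s hs)).strand j (lo y) := by rwa [comp_strand_lo, comp_strand_lo]
        have m2 : (d'.comp (straight s hs)).strand i (hi z) =
            (d'.comp (straight s hs)).strand j (hi z) := by rw [comp_strand_hi, comp_strand_hi, hz]
        have h2 : lo y = hi z := hweb.1 i j hij.ne m1 m2
        exact (d'.meet_pos hij.ne hy).2.ne (lo_eq_hi h2).1
      have h2 := (isotopic_of_reparam hp hg h0 h1 ord).trans (hiso.comp (.refl (straight s hs)))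
      have h3 := isotopic_straight_comp hweb'.avoids321 hs (hp ▸ h.avoids321) hadd
      refine h2.trans ?_
      simp only [hp] at h3
      exact h3.symm

theorem straight_isWeb {n : ℕ} {s : Equiv.Perm (Fin (n + 1))} (hs : Avoids321 s) :
    (straight s hs).IsWeb := by
  constructor
  · intro i j hij y hy z hz
    rcases lt_or_gt_of_ne hij with h | h
    · exact straight_unique s h hy hz
    · exact straight_unique s h (Eq.symm hy) (Eq.symm hz)
  · have inv : ∀ i j, i < j → (∃ y, (straight s hs).strand i y = (straight s hs).strand j y) →
        s j < s i := fun i j hij ⟨y, hy⟩ => straight_inv s hij hy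
    have key : ∀ i j k, i < j → j < k →
        (∃ y, (straight s hs).strand i y = (straight s hs).strand j y) →
        (∃ y, (straight s hs).strand j y = (straight s hs).strand k y) → False :=
      fun i j k hij hjk h h' => hs ⟨i, j, k, hij, hjk, inv i j hij h, inv j k hjk h'⟩
    have sy : ∀ {i j}, (∃ y, (straight s hs).strand i y = (straight s hs).strand j y) →
        ∃ y, (straight s hs).strand j y = (straight s hs).strand i y := fun ⟨y, hy⟩ => ⟨y, hy.symm⟩
    rintro ⟨i, j, k, hij, hjk, hik, h1, h2, h3⟩
    rcases lt_or_gt_of_ne hij with a | a <;> rcases lt_or_gt_of_ne hjk with b | b <;>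
      rcases lt_or_gt_of_ne hik with c | c
    · exact key i j k a b h1 h2
    · exact absurd (a.trans b) c.asymm
    · exact key i k j c b h3 (sy h2)
    · exact key k i j c a (sy h3) h1
    · exact key j i k a c (sy h1) h3
    · exact key j k i b c h2 (sy h3)
    · exact absurd (b.trans a) c.asymm
    · exact key k j i b a (sy h2) (sy h1)

/-- The class of the straight diagram of a `321`-avoiding permutation. -/
noncomputable def straightWeb {n : ℕ} (s : Equiv.Perm (Fin (n + 1))) (hs : Avoids321 s) : WL n :=
  Quot.mk _ ⟨straight s hs, straight_isWeb hs⟩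

theorem webPerm_straightWeb {n : ℕ} {s : Equiv.Perm (Fin (n + 1))} (hs : Avoids321 s) :
    webPerm (straightWeb s hs) = s := rfl

theorem iota_straightWeb {n : ℕ} {s : Equiv.Perm (Fin (n + 1))} (hs : Avoids321 s) :
    iota (straightWeb s hs) = DL.mk (straight s hs) := rfl

theorem webPerm_avoids321 {n : ℕ} (w : WL n) : Avoids321 (webPerm w) := by
  obtain ⟨d, rfl⟩ := Quot.exists_rep w
  exact d.2.avoids321

theorem eq_straightWeb {n : ℕ} (w : WL n) :
    w = straightWeb (webPerm w) (webPerm_avoids321 w) := by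
  obtain ⟨d, rfl⟩ := Quot.exists_rep w
  exact Quot.sound d.2.isotopic_straight

theorem webPerm_injective {n : ℕ} : Function.Injective (webPerm (n := n)) := by
  intro w w' h
  rw [eq_straightWeb w, eq_straightWeb w']
  congr 1

/-! ### Climbing along the strands: an invariant of diagrams -/

/-- The point `q` lies above the point `p` on a common strand. A point is a height followed by a
horizontal coordinate. -/
def Diagram.Climb {n : ℕ} (d : Diagram n) (p q : I × ℝ) : Prop :=
  p.1 ≤ q.1 ∧ ∃ i, d.strand i p.1 = p.2 ∧ d.strand i q.1 = q.2

/-- One can climb from `p` to `q` along the strands, changing strands at crossings. -/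
def Diagram.Reach {n : ℕ} (d : Diagram n) : I × ℝ → I × ℝ → Prop := Relation.ReflTransGen d.Climb

/-- From the lower endpoint `a` one can climb to the upper endpoint `k` or to one on its right.
(Endpoints are counted from `0`.) -/
def Diagram.Trace {n : ℕ} (d : Diagram n) (a k : Fin (n + 1)) : Prop :=
  ∃ k', k ≤ k' ∧ d.Reach (0, (a : ℝ) + 1) (1, (k' : ℝ) + 1)

theorem Diagram.Reach.le {n : ℕ} {d : Diagram n} {p q : I × ℝ} (h : d.Reach p q) : p.1 ≤ q.1 := by
  induction h with
  | refl => exact le_rfl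
  | tail _ hs ih => exact ih.trans hs.1

theorem Diagram.Reach.on_strand {n : ℕ} {d : Diagram n} {p q : I × ℝ} (h : d.Reach p q)
    (hp : ∃ i, d.strand i p.1 = p.2) : ∃ i, d.strand i q.1 = q.2 := by
  induction h with
  | refl => exact hp
  | tail _ hs _ => exact ⟨hs.2.choose, hs.2.choose_spec.2⟩

theorem Diagram.climb_strand {n : ℕ} (d : Diagram n) (i : Fin (n + 1)) {y z : I} (h : y ≤ z) :
    d.Reach (y, d.strand i y) (z, d.strand i z) := .single ⟨h, i, rfl, rfl⟩

theorem Diagram.Reach.split {n : ℕ} {d : Diagram n} {p q : I × ℝ} (h : d.Reach p q) {u : I}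
    (hp : p.1 ≤ u) (hq : u ≤ q.1) : ∃ x, d.Reach p (u, x) ∧ d.Reach (u, x) q := by
  induction h using Relation.ReflTransGen.head_induction_on with
  | refl =>
    obtain rfl := le_antisymm hp hq
    exact ⟨q.2, .refl, .refl⟩
  | @head a c hs hr ih =>
    rcases le_total c.1 u with hc | hc
    · obtain ⟨x, h1, h2⟩ := ih hc
      exact ⟨x, .head hs h1, h2⟩
    · obtain ⟨hle, i, h1, h2⟩ := hs
      exact ⟨d.strand i u, .single ⟨hp, i, h1, rfl⟩, .head ⟨hc, i, rfl, h2⟩ hr⟩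

/-- Starting further to the right, one can climb at least as far to the right: follow a strand until
it meets the given path, then follow the path. -/
theorem Diagram.Reach.right {n : ℕ} {d : Diagram n} {p q : I × ℝ} (h : d.Reach p q)
    (m : Fin (n + 1)) (hm : p.2 ≤ d.strand m p.1) :
    ∃ m', q.2 ≤ d.strand m' q.1 ∧ d.Reach (p.1, d.strand m p.1) (q.1, d.strand m' q.1) := by
  induction h with
  | refl => exact ⟨m, hm, .refl⟩
  | @tail r q _ hs ih =>
    obtain ⟨m', h1, h2⟩ := ih
    obtain ⟨hle, i, h3, h4⟩ := hs
    rcases le_or_gt q.2 (d.strand m' q.1) with h5 | h5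
    · exact ⟨m', h5, h2.trans (d.climb_strand m' hle)⟩
    · obtain ⟨z, hz, hz', h6⟩ := exists_eq_between (d.strand i) (d.strand m') hle
        (h3 ▸ h1) (h4 ▸ h5.le)
      refine ⟨i, h4.ge, (h2.trans (d.climb_strand m' hz)).trans ?_⟩
      rw [← h6]
      exact d.climb_strand i hz'

theorem Diagram.Reach.below {n : ℕ} {d e : Diagram n} {u : I}
    (hde : ∀ k, ∀ y ≤ u, e.strand k y = d.strand k y) {p q : I × ℝ} (h : d.Reach p q)
    (hq : q.1 ≤ u) : e.Reach p q := by
  induction h with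
  | refl => exact .refl
  | @tail r q _ hs ih =>
    obtain ⟨hle, i, h1, h2⟩ := hs
    exact .tail (ih (hle.trans hq))
      ⟨hle, i, by rw [hde _ _ (hle.trans hq), h1], by rw [hde _ _ hq, h2]⟩

theorem Diagram.Reach.above {n : ℕ} {d e : Diagram n} {v : I} {τ : Equiv.Perm (Fin (n + 1))}
    (hde : ∀ k, ∀ y, v ≤ y → e.strand k y = d.strand (τ k) y) {p q : I × ℝ} (h : d.Reach p q)
    (hp : v ≤ p.1) : e.Reach p q := by
  induction h with
  | refl => exact .refl
  | @tail r q hr hs ih =>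
    obtain ⟨hle, i, h1, h2⟩ := hs
    have hv : v ≤ r.1 := hp.trans (Diagram.Reach.le hr)
    exact .tail ih ⟨hle, τ.symm i, by rw [hde _ _ hv, Equiv.apply_symm_apply, h1],
      by rw [hde _ _ (hv.trans hle), Equiv.apply_symm_apply, h2]⟩

/-! ### Invariance under local moves -/

theorem LocalMove.symm {n m : ℕ} {P Q : List (Fin m × Fin m)} {d e : Diagram n}
    (h : LocalMove P Q d e) : LocalMove Q P e d := by
  obtain ⟨j, u, v, l, r, τ, huv, hlr, hj, hin, hout, hlow, hτ, hup, hP, hQ⟩ := h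
  refine ⟨j, u, v, l, r, τ.symm, huv, hlr, hj, fun s y hy => (hin s y hy).symm,
    fun k hk y hy => ?_, fun k y hy => (hlow k y hy).symm, fun k hk => ?_, fun k y hy => ?_, hQ, hP⟩
  · rw [(hout k hk y hy).2]
    exact ⟨(hout k hk y hy).1, rfl⟩
  · rw [Equiv.symm_apply_eq, hτ k hk]
  · rw [hup _ y hy, Equiv.apply_symm_apply]

/-- Each strand entering the box at the bottom meets the one that leaves it as the rightmost one. -/
def Funnel {n m : ℕ} (e : Diagram n) (j : Fin m → Fin (n + 1)) (u v : I) : Prop :=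
  ∃ t, (∀ s, e.strand (j s) v ≤ e.strand (j t) v) ∧
    ∀ s, ∃ z ∈ Set.Icc u v, e.strand (j s) z = e.strand (j t) z

theorem LocalPattern.funnel_of_all {n m : ℕ} (hm : 0 < m) {e : Diagram n}
    {j : Fin m → Fin (n + 1)} {u v : I} {P : List (Fin m × Fin m)} (h : LocalPattern e j u v P)
    (huv : u < v) (hall : ∀ s t, s < t → ∃ q, P.get q = (s, t)) : Funnel e j u v := by
  obtain ⟨-, x, -, hx, hiff⟩ := h
  have : Nonempty (Fin m) := ⟨⟨0, hm⟩⟩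
  obtain ⟨t, ht⟩ := Finite.exists_max fun s => e.strand (j s) v
  have key : ∀ s t, s < t → ∃ z ∈ Set.Icc u v, e.strand (j s) z = e.strand (j t) z := by
    intro s t hst
    obtain ⟨q, hq⟩ := hall s t hst
    have hz : x q ∈ Set.Icc u v := ⟨(hx q).1.le, (hx q).2.le⟩
    exact ⟨x q, hz, (hiff s t hst _ hz).2 ⟨q, rfl, hq⟩⟩
  refine ⟨t, ht, fun s => ?_⟩
  rcases lt_trichotomy s t with hst | rfl | hst
  · exact key s t hst
  · exact ⟨u, ⟨le_rfl, huv.le⟩, rfl⟩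
  · obtain ⟨z, hz, h⟩ := key t s hst
    exact ⟨z, hz, h.symm⟩

/-- Two strands which cross exactly once in the box leave it in the opposite order. -/
theorem LocalPattern.flip {n m : ℕ} {e : Diagram n} {j : Fin m → Fin (n + 1)}
    (hj : Function.Injective j) {u v : I} {P : List (Fin m × Fin m)} (h : LocalPattern e j u v P)
    {s t : Fin m} (hst : s < t) (hu : ∃! q, P.get q = (s, t)) :
    (∃ z ∈ Set.Icc u v, e.strand (j s) z = e.strand (j t) z) ∧
      e.strand (j t) v < e.strand (j s) v := by
  obtain ⟨hord, x, -, hx, hiff⟩ := h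
  obtain ⟨q, hq, hq'⟩ := hu
  have hz : x q ∈ Set.Icc u v := ⟨(hx q).1.le, (hx q).2.le⟩
  have hm := (hiff s t hst _ hz).2 ⟨q, rfl, hq⟩
  have honly : ∀ y, u ≤ y → y ≤ v → y ≠ x q → e.strand (j s) y ≠ e.strand (j t) y := by
    intro y h1 h2 hne hy
    obtain ⟨q', rfl, hq2⟩ := (hiff s t hst y ⟨h1, h2⟩).1 hy
    exact hne (by rw [hq' q' hq2])
  refine ⟨⟨x q, hz, hm⟩, ?_⟩
  rcases e.crossing (j s) (j t) (hj.ne hst.ne) _ hm with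
    ⟨a, b, ha, hb, h1, h2⟩ | ⟨a, b, ha, hb, h1, h2⟩
  · obtain ⟨z, hz1, hz2⟩ := exists_between (lt_min hb (hx q).2)
    have h3 := h2 z ⟨hz1, hz2.trans_le (min_le_left _ _)⟩
    refine (lt_iff_of_no_meet _ _ (hz2.le.trans (min_le_right _ _)) fun w hw hw' => ?_).1 h3
    exact (honly w ((hx q).1.le.trans (hz1.le.trans hw)) hw' (hz1.trans_le hw).ne').symm
  · obtain ⟨z, hz1, hz2⟩ := exists_between (max_lt ha (hx q).1)
    have h3 := h1 z ⟨(le_max_left _ _).trans_lt hz1, hz2⟩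
    have h4 := (lt_iff_of_no_meet (e.strand (j t)) (e.strand (j s)) (a := u) (b := z)
      ((le_max_right _ _).trans hz1.le) fun w hw hw' =>
        (honly w hw (hw'.trans (hz2.le.trans (hx q).2.le)) (hw'.trans_lt hz2).ne).symm).2 h3
    exact absurd h4 (hord s t hst).asymm

/-- A path through the box can be replaced by one that leaves the box along the rightmost of its
strands, and from there one can climb at least as far to the right as before. -/
theorem LocalMove.trace {n m : ℕ} {P Q : List (Fin m × Fin m)} {d e : Diagram n}
    (h : LocalMove P Q d e)
    (hQf : ∀ (j : Fin m → Fin (n + 1)) (u v : I), Function.Injective j → u < v →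
      LocalPattern e j u v Q → Funnel e j u v) {a k : Fin (n + 1)} (hT : d.Trace a k) :
    e.Trace a k := by
  obtain ⟨j, u, v, l, r, τ, huv, hlr, hj, hin, hout, hlow, hτ, hup, hP, hQ⟩ := h
  obtain ⟨k', hk, hr⟩ := hT
  obtain ⟨t, ht, hmeet⟩ := hQf j u v hj huv hQ
  obtain ⟨x, h1, h2⟩ := hr.split (u := u) u.2.1 u.2.2
  obtain ⟨x', h3, h4⟩ := h2.split (u := v) huv.le v.2.2
  obtain ⟨i0, hi0⟩ : ∃ i, d.strand i u = x := h1.on_strand ⟨a, d.bottom a⟩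
  have e1 := h1.below hlow le_rfl
  have e4 : e.Reach (v, x') (1, (k' : ℝ) + 1) := h4.above hup le_rfl
  -- a path through the box either avoids it or stays in it
  have main : ∀ q : I × ℝ, d.Reach (u, x) q → q.1 ≤ v →
      ((∃ i, i ∉ Set.range j ∧ d.strand i q.1 = q.2) ∧ e.Reach (u, x) q) ∨
      ((∃ s, d.strand (j s) q.1 = q.2) ∧ ∃ s, d.strand (j s) u = x) := by
    intro q hq
    induction hq with
    | refl =>
      intro _
      by_cases hi : i0 ∈ Set.range j
      · obtain ⟨s, rfl⟩ := hi
        exact Or.inr ⟨⟨s, hi0⟩, ⟨s, hi0⟩⟩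
      · exact Or.inl ⟨⟨i0, hi, hi0⟩, .refl⟩
    | @tail b c hb hs ih =>
      intro hcv
      obtain ⟨hle, i, hi1, hi2⟩ := hs
      have hb' : b.1 ∈ Set.Icc u v := ⟨Diagram.Reach.le hb, hle.trans hcv⟩
      have hc' : c.1 ∈ Set.Icc u v := ⟨hb'.1.trans hle, hcv⟩
      rcases ih hb'.2 with ⟨⟨i', hi', hb2⟩, hr⟩ | ⟨⟨s, hs⟩, hx⟩
      · have hij : i ∉ Set.range j := by
          rintro ⟨s, rfl⟩
          have h5 := (hin s b.1 hb').1
          rw [hi1, ← hb2] at h5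
          exact (hout i' hi' b.1 hb').1 ⟨h5.1.le, h5.2.le⟩
        refine Or.inl ⟨⟨i, hij, hi2⟩, .tail hr ⟨hle, i, ?_, ?_⟩⟩
        · rw [(hout i hij _ hb').2, hi1]
        · rw [(hout i hij _ hc').2, hi2]
      · have hij : i ∈ Set.range j := by
          by_contra hij
          have h5 := (hin s b.1 hb').1
          rw [hs, ← hi1] at h5
          exact (hout i hij b.1 hb').1 ⟨h5.1.le, h5.2.le⟩
        obtain ⟨s', rfl⟩ := hij
        exact Or.inr ⟨⟨s', hi2⟩, hx⟩
  rcases main _ h3 le_rfl with ⟨-, h5⟩ | ⟨⟨s, hs⟩, ⟨s0, hs0⟩⟩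
  · exact ⟨k', hk, (e1.trans h5).trans e4⟩
  · obtain ⟨z, hz, hz'⟩ := hmeet s0
    have h6 : e.Reach (u, x) (v, e.strand (j t) v) := by
      have h7 := e.climb_strand (j s0) hz.1
      rw [hlow _ _ le_rfl, hs0, hz'] at h7
      exact h7.trans (e.climb_strand (j t) hz.2)
    have h8 : x' ≤ e.strand (j t) v := by
      have hτs : τ.symm (j s) ∈ Set.range j := by
        by_contra hc
        have := hτ _ hc
        rw [Equiv.apply_symm_apply] at this
        exact hc (this ▸ ⟨s, rfl⟩)
      obtain ⟨s', hs'⟩ := hτs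
      have h9 := hup (j s') v le_rfl
      rw [hs', Equiv.apply_symm_apply, hs, ← hs'] at h9
      exact (show x' ≤ _ from h9.ge.trans (ht s'))
    obtain ⟨m', h10, h11⟩ := e4.right (j t) h8
    rw [e.top] at h10 h11
    refine ⟨e.perm m', ?_, (e1.trans h6).trans h11⟩
    refine hk.trans (Fin.le_def.2 ?_)
    have : (k' : ℝ) ≤ (e.perm m' : ℝ) := by simpa using h10
    exact_mod_cast this

/-! ### Invariance under isotopy -/

/-- One can climb from the lower endpoint of the strand `a` to the point `(y, x)`, with at most `M`
changes of strands. -/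
def Diagram.ReachN {n : ℕ} (d : Diagram n) (a : Fin (n + 1)) : ℕ → I → ℝ → Prop
  | 0, y, x => d.strand a y = x
  | M + 1, y, x => ∃ i, ∃ z ≤ y, d.ReachN a M z (d.strand i z) ∧ d.strand i y = x

/-- One can climb from the lower endpoint of the strand `a` to the strand `i`, with `M` proper
changes of strands at distinct heights below `y`. -/
def Diagram.ReachStrict {n : ℕ} (d : Diagram n) (a : Fin (n + 1)) : ℕ → Fin (n + 1) → I → Prop
  | 0, i, _ => i = a
  | M + 1, j, y => ∃ z < y, ∃ i, i ≠ j ∧ d.ReachStrict a M i z ∧ d.strand i z = d.strand j z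

theorem Diagram.ReachN.on_strand {n : ℕ} {d : Diagram n} {a : Fin (n + 1)} {M : ℕ} {y : I} {x : ℝ}
    (h : d.ReachN a M y x) : ∃ i, d.strand i y = x := by
  cases M with
  | zero => exact ⟨a, h⟩
  | succ M =>
    obtain ⟨i, z, _, _, h⟩ := h
    exact ⟨i, h⟩

theorem Diagram.ReachN.mono {n : ℕ} {d : Diagram n} {a : Fin (n + 1)} {M N : ℕ} (hMN : M ≤ N)
    {y : I} {x : ℝ} (h : d.ReachN a M y x) : d.ReachN a N y x := by
  induction hMN with
  | refl => exact h
  | step _ ih =>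
    obtain ⟨i, rfl⟩ := h.on_strand
    exact ⟨i, y, le_rfl, ih, rfl⟩

theorem Diagram.reach_iff {n : ℕ} (d : Diagram n) (a : Fin (n + 1)) (q : I × ℝ) :
    d.Reach (0, (a : ℝ) + 1) q ↔ ∃ M, d.ReachN a M q.1 q.2 := by
  constructor
  · intro h
    induction h with
    | refl => exact ⟨0, d.bottom a⟩
    | tail _ hs ih =>
      obtain ⟨M, hM⟩ := ih
      obtain ⟨hle, i, h1, h2⟩ := hs
      exact ⟨M + 1, i, _, hle, h1.symm ▸ hM, h2⟩
  · rintro ⟨M, hM⟩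
    induction M generalizing q with
    | zero => exact .single ⟨q.1.2.1, a, d.bottom a, hM⟩
    | succ M ih =>
      obtain ⟨i, z, hz, h1, h2⟩ := hM
      exact .tail (ih (z, d.strand i z) h1) ⟨hz, i, rfl, h2⟩

theorem Diagram.ReachStrict.mono {n : ℕ} {d : Diagram n} {a : Fin (n + 1)} {M : ℕ}
    {i : Fin (n + 1)} {y z : I} (hyz : y ≤ z) (h : d.ReachStrict a M i y) :
    d.ReachStrict a M i z := by
  cases M with
  | zero => exact h
  | succ M =>
    obtain ⟨w, hw, h⟩ := h
    exact ⟨w, hw.trans_le hyz, h⟩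

theorem Diagram.ReachStrict.reachN {n : ℕ} {d : Diagram n} {a : Fin (n + 1)} {M : ℕ}
    {i : Fin (n + 1)} {y : I} (h : d.ReachStrict a M i y) : d.ReachN a M y (d.strand i y) := by
  induction M generalizing i y with
  | zero => exact congrArg (fun k => d.strand k y) (Eq.symm h)
  | succ M ih =>
    obtain ⟨z, hz, j, -, h1, h2⟩ := h
    exact ⟨i, z, hz.le, h2 ▸ ih h1, rfl⟩

/-- As there are no triple points, several changes of strands at the same height can be replaced by
at most one. It remains to allow for a change at the height `y` itself. -/
theorem Diagram.ReachN.strict {n : ℕ} {d : Diagram n} {a : Fin (n + 1)} {M : ℕ} {y : I} {x : ℝ}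
    (h : d.ReachN a M y x) : ∃ i, d.strand i y = x ∧ ((∃ M' ≤ M, d.ReachStrict a M' i y) ∨
      ∃ M' < M, ∃ i', i' ≠ i ∧ d.strand i' y = d.strand i y ∧ d.ReachStrict a M' i' y) := by
  induction M generalizing y x with
  | zero => exact ⟨a, h, Or.inl ⟨0, le_rfl, rfl⟩⟩
  | succ M ih =>
    obtain ⟨j, z, hz, h1, rfl⟩ := h
    refine ⟨j, rfl, ?_⟩
    have key : ∀ M' ≤ M, ∀ i, i ≠ j → d.strand i z = d.strand j z → d.ReachStrict a M' i z →
        (∃ M' ≤ M + 1, d.ReachStrict a M' j y) ∨ ∃ M' < M + 1, ∃ i', i' ≠ j ∧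
          d.strand i' y = d.strand j y ∧ d.ReachStrict a M' i' y := by
      intro M' hM' i hij hm hs
      rcases eq_or_lt_of_le hz with rfl | hlt
      · exact Or.inr ⟨M', by omega, i, hij, hm, hs⟩
      · exact Or.inl ⟨M' + 1, by omega, z, hlt, i, hij, hs, hm⟩
    obtain ⟨i, hi, ⟨M', hM', hs⟩ | ⟨M', hM', i', hi', hm, hs⟩⟩ := ih h1
    · by_cases hij : i = j
      · subst hij
        exact Or.inl ⟨M', by omega, hs.mono hz⟩
      · exact key M' hM' i hij hi hs
    · by_cases hij : i' = j
      · subst hij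
        exact Or.inl ⟨M', by omega, hs.mono hz⟩
      · exact key M' (by omega) i' hij (hm.trans hi) hs

/-- Limits of paths with at most `M` changes of strands are such paths, by compactness of the set of
the possible heights of the changes. -/
theorem isClosed_reachN {n : ℕ} {F : I → Diagram n}
    (hF : ∀ i, Continuous fun p : I × I => (F p.1).strand i p.2) (a : Fin (n + 1)) (M : ℕ) :
    IsClosed {c : I × I × ℝ | (F c.1).ReachN a M c.2.1 c.2.2} := by
  have hF' : ∀ (i) {X : Type} [TopologicalSpace X] {f g : X → I}, Continuous f → Continuous g →
      Continuous fun x => (F (f x)).strand i (g x) := fun i X _ f g hf hg =>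
    (hF i).comp (hf.prodMk hg)
  induction M with
  | zero => exact isClosed_eq (hF' a (by fun_prop) (by fun_prop)) (by fun_prop)
  | succ M ih =>
    have heq : {c : I × I × ℝ | (F c.1).ReachN a (M + 1) c.2.1 c.2.2} =
        ⋃ i : Fin (n + 1), Prod.fst '' {b : (I × I × ℝ) × I | b.2 ≤ b.1.2.1 ∧
          (F b.1.1).ReachN a M b.2 ((F b.1.1).strand i b.2) ∧
          (F b.1.1).strand i b.1.2.1 = b.1.2.2} := by
      ext ⟨t, y, x⟩
      simp only [Set.mem_iUnion]
      constructor
      · rintro ⟨i, z, hz, h1, h2⟩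
        exact ⟨i, ⟨(t, y, x), z⟩, ⟨hz, h1, h2⟩, rfl⟩
      · rintro ⟨i, ⟨⟨t', y', x'⟩, z⟩, ⟨hz, h1, h2⟩, heq⟩
        simp only [Prod.mk.injEq] at heq
        obtain ⟨rfl, rfl, rfl⟩ := heq
        exact ⟨i, z, hz, h1, h2⟩
    rw [heq]
    refine isClosed_iUnion_of_finite fun i => isClosedMap_fst_of_compactSpace _ ?_
    refine (isClosed_le (by fun_prop) (by fun_prop)).inter (IsClosed.inter ?_ ?_)
    · exact ih.preimage (f := fun b : (I × I × ℝ) × I => (b.1.1, b.2, (F b.1.1).strand i b.2))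
        ((by fun_prop : Continuous fun b : (I × I × ℝ) × I => b.1.1).prodMk
          (continuous_snd.prodMk (hF' i (by fun_prop) (by fun_prop))))
    · exact isClosed_eq (hF' i (by fun_prop) (by fun_prop)) (by fun_prop)

/-- Crossings persist under small deformations, as the strands change sides there. -/
theorem isOpen_reachStrict {n : ℕ} {F : I → Diagram n}
    (hF : ∀ i, Continuous fun p : I × I => (F p.1).strand i p.2) (a : Fin (n + 1)) (M : ℕ)
    (i : Fin (n + 1)) : IsOpen {p : I × I | (F p.1).ReachStrict a M i p.2} := by
  induction M generalizing i with
  | zero => exact isOpen_const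
  | succ M ih =>
    rw [isOpen_iff_mem_nhds]
    rintro ⟨t₀, y₀⟩ ⟨z₀, hz₀, j, hji, hs, hm⟩
    simp only at hz₀ hs hm
    obtain ⟨U, V, hU, htU, hV, hzV, hUV⟩ := mem_nhds_prod_iff'.1 ((ih j).mem_nhds
      (show (t₀, z₀) ∈ {p : I × I | (F p.1).ReachStrict a M j p.2} from hs))
    have hpos := (F t₀).meet_pos hji hm
    obtain ⟨l, hl, hlV⟩ := exists_Ioc_subset_of_mem_nhds (hV.mem_nhds hzV) ⟨0, hpos.1⟩
    obtain ⟨r, hr, hrV⟩ := exists_Ico_subset_of_mem_nhds (hV.mem_nhds hzV) ⟨1, hpos.2⟩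
    have key : ∀ f g : Fin (n + 1), (f = j ∧ g = i ∨ f = i ∧ g = j) →
        CrossesAt ((F t₀).strand f) ((F t₀).strand g) z₀ →
        {p : I × I | (F p.1).ReachStrict a (M + 1) i p.2} ∈ nhds (t₀, y₀) := by
      rintro f g hfg ⟨b, c, hb, hc, h1, h2⟩
      obtain ⟨z₁, hz₁, hz₁'⟩ := exists_between (max_lt hb hl)
      obtain ⟨z₂, hz₂, hz₂'⟩ := exists_between (lt_min hc (lt_min hr hz₀))
      have s1 := h1 z₁ ⟨(le_max_left _ _).trans_lt hz₁, hz₁'⟩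
      have s2 := h2 z₂ ⟨hz₂, hz₂'.trans_le (min_le_left _ _)⟩
      have hcont : ∀ k z, Continuous fun t => (F t).strand k z := fun k z =>
        (hF k).comp (continuous_id.prodMk continuous_const)
      have n1 : U ∩ {t | (F t).strand f z₁ < (F t).strand g z₁} ∩
          {t | (F t).strand g z₂ < (F t).strand f z₂} ∈ nhds t₀ :=
        ((hU.inter (isOpen_lt (hcont _ _) (hcont _ _))).inter
          (isOpen_lt (hcont _ _) (hcont _ _))).mem_nhds ⟨⟨htU, s1⟩, s2⟩
      have n2 : Set.Ioi z₂ ∈ nhds y₀ :=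
        isOpen_Ioi.mem_nhds (hz₂'.trans_le ((min_le_right _ _).trans (min_le_right _ _)))
      filter_upwards [prod_mem_nhds n1 n2]
      rintro ⟨t, y⟩ ⟨⟨⟨htU', ht1⟩, ht2⟩, hy⟩
      obtain ⟨z, hz, hz', hzm⟩ := exists_eq_between ((F t).strand f) ((F t).strand g)
        (hz₁'.trans hz₂).le (le_of_lt ht1) (le_of_lt ht2)
      have hzV' : z ∈ V := by
        rcases le_total z z₀ with hle | hle
        · exact hlV ⟨((le_max_right _ _).trans_lt hz₁).trans_le hz, hle⟩
        · exact hrV ⟨hle, hz'.trans_lt (hz₂'.trans_le ((min_le_right _ _).trans (min_le_left _ _)))⟩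
      refine ⟨z, hz'.trans_lt hy, j, hji, hUV (Set.mk_mem_prod htU' hzV'), ?_⟩
      rcases hfg with ⟨rfl, rfl⟩ | ⟨rfl, rfl⟩
      · exact hzm
      · exact hzm.symm
    rcases (F t₀).crossing j i hji z₀ hm with h | h
    · exact key j i (Or.inl ⟨rfl, rfl⟩) h
    · exact key i j (Or.inr ⟨rfl, rfl⟩) h

theorem Diagram.reachN_top {n : ℕ} (d : Diagram n) (a : Fin (n + 1)) (M : ℕ) (i : Fin (n + 1)) :
    d.ReachN a M 1 ((d.perm i : ℝ) + 1) ↔ ∃ M' ≤ M, d.ReachStrict a M' i 1 := by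
  constructor
  · intro h
    obtain ⟨i', hi', h'⟩ := h.strict
    have : i' = i := by
      by_contra hc
      exact d.top_ne hc (by rw [hi', d.top])
    subst this
    rcases h' with h' | ⟨M', _, j, hj, hm, -⟩
    · exact h'
    · exact absurd hm (d.top_ne hj)
  · rintro ⟨M', hM', h⟩
    have := h.reachN.mono hM'
    rwa [d.top] at this

/-- The times at which the upper endpoint `k'` can be reached with at most `M` changes of strands form
a closed and open set. -/
theorem Isotopic.trace {n : ℕ} {d e : Diagram n} (h : Isotopic d e) {a k : Fin (n + 1)}
    (hT : d.Trace a k) : e.Trace a k := by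
  obtain ⟨F, rfl, rfl, hF, -⟩ := h
  obtain ⟨k', hk, hr⟩ := hT
  obtain ⟨M, hM⟩ := ((F 0).reach_iff a _).1 hr
  obtain ⟨i, rfl⟩ := (F 0).perm.surjective k'
  let S : Set I := {t | (F t).ReachN a M 1 (((F 0).perm i : ℝ) + 1)}
  have hcl : IsClosed S := (isClosed_reachN hF a M).preimage
    (f := fun t : I => (t, (1 : I), (((F 0).perm i : ℝ) + 1))) (by fun_prop)
  have hop : IsOpen S := by
    have : S = ⋃ M' : ℕ, ⋃ _ : M' ≤ M, {t | (F t).ReachStrict a M' i 1} := by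
      ext t
      simp only [Set.mem_iUnion, exists_prop]
      change (F t).ReachN a M 1 (((F 0).perm i : ℝ) + 1) ↔ _
      rw [perm_eq_of_continuous hF 0 t, (F t).reachN_top]
      rfl
    rw [this]
    refine isOpen_iUnion fun M' => isOpen_iUnion fun _ => ?_
    exact (isOpen_reachStrict hF a M' i).preimage (f := fun t : I => (t, (1 : I))) (by fun_prop)
  have huniv : S = Set.univ := by
    rcases isClopen_iff.1 ⟨hcl, hop⟩ with h | h
    · have h0 : (0 : I) ∈ S := hM
      rw [h] at h0
      exact h0.elim
    · exact h
  have h1 : (1 : I) ∈ S := huniv ▸ Set.mem_univ _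
  exact ⟨_, hk, ((F 1).reach_iff a _).2 ⟨M, h1⟩⟩

/-- In the two patterns of the `2`-move and in the triangles any two strands of the box cross; in the
pattern without triangle the strand `0` crosses both others and leaves the box on their right. -/
theorem Move.trace {n : ℕ} {d e : Diagram n} (h : Move d e) {a k : Fin (n + 1)} :
    d.Trace a k ↔ e.Trace a k := by
  have two : ∀ (P : List (Fin 2 × Fin 2)), P ≠ [] → (∀ c ∈ P, c = (0, 1)) → ∀ (e : Diagram n)
      (j : Fin 2 → Fin (n + 1)) (u v : I), Function.Injective j → u < v →
      LocalPattern e j u v P → Funnel e j u v := by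
    intro P hP hall e j u v _ huv h
    refine h.funnel_of_all two_pos huv fun s t hst => ?_
    have hst' : (s, t) = (0, 1) := by
      revert s t
      decide
    refine ⟨⟨0, List.length_pos_iff.2 hP⟩, ?_⟩
    rw [hst']
    exact hall _ (List.get_mem _ _)
  have three : ∀ (P : List (Fin 3 × Fin 3)), (0, 1) ∈ P → (0, 2) ∈ P → (1, 2) ∈ P →
      ∀ (e : Diagram n) (j : Fin 3 → Fin (n + 1)) (u v : I), Function.Injective j → u < v →
      LocalPattern e j u v P → Funnel e j u v := by
    intro P h01 h02 h12 e j u v _ huv h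
    refine h.funnel_of_all three_pos huv fun s t hst => ?_
    rw [← Set.mem_range, Set.range_list_get]
    have hst' : (s, t) = (0, 1) ∨ (s, t) = (0, 2) ∨ (s, t) = (1, 2) := by
      revert s t
      decide
    rcases hst' with h | h | h <;> rw [h] <;> assumption
  have free : ∀ (e : Diagram n) (j : Fin 3 → Fin (n + 1)) (u v : I), Function.Injective j →
      u < v → LocalPattern e j u v [(0, 1), (0, 2)] → Funnel e j u v := by
    intro e j u v hj huv h
    have f1 := h.flip hj (s := 0) (t := 1) (by decide)
      ⟨(0 : Fin 2), rfl, by decide⟩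
    have f2 := h.flip hj (s := 0) (t := 2) (by decide)
      ⟨(1 : Fin 2), rfl, by decide⟩
    have sy : ∀ {a b}, (∃ z ∈ Set.Icc u v, e.strand a z = e.strand b z) →
        ∃ z ∈ Set.Icc u v, e.strand b z = e.strand a z := fun ⟨z, hz, h⟩ => ⟨z, hz, h.symm⟩
    refine ⟨0, fun s => ?_, fun s => ?_⟩
    · fin_cases s
      · exact le_rfl
      · exact f1.2.le
      · exact f2.2.le
    · fin_cases s
      · exact ⟨u, ⟨le_rfl, huv.le⟩, rfl⟩
      · exact sy f1.1
      · exact sy f2.1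
  rcases h with h | h | h | h
  · exact ⟨h.trace, h.symm.trace⟩
  · exact ⟨h.trace (two _ (by simp) (by simp) e), h.symm.trace (two _ (by simp) (by simp) d)⟩
  · exact ⟨h.trace (three _ (by simp) (by simp) (by simp) e),
      h.symm.trace (three _ (by simp) (by simp) (by simp) d)⟩
  · exact ⟨h.trace (free e), h.symm.trace (three _ (by simp) (by simp) (by simp) d)⟩

/-! ### The invariant of a product and of a straight diagram -/

theorem Diagram.Reach.comp_lo {n : ℕ} {d : Diagram n} (e : Diagram n) {p q : I × ℝ}
    (h : d.Reach p q) : (d.comp e).Reach (lo p.1, p.2) (lo q.1, q.2) := by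
  induction h with
  | refl => exact .refl
  | tail _ hs ih =>
    obtain ⟨hle, i, h1, h2⟩ := hs
    exact .tail ih ⟨lo_strictMono.monotone hle, i, by rwa [comp_strand_lo],
      by rwa [comp_strand_lo]⟩

theorem Diagram.Reach.comp_hi {n : ℕ} (d : Diagram n) {e : Diagram n} {p q : I × ℝ}
    (h : e.Reach p q) : (d.comp e).Reach (hi p.1, p.2) (hi q.1, q.2) := by
  induction h with
  | refl => exact .refl
  | tail _ hs ih =>
    obtain ⟨hle, i, h1, h2⟩ := hs
    exact .tail ih ⟨hi_strictMono.monotone hle, d.perm.symm i,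
      by rwa [comp_strand_hi, Equiv.apply_symm_apply],
      by rwa [comp_strand_hi, Equiv.apply_symm_apply]⟩

theorem Diagram.Reach.of_comp_lo {n : ℕ} {d e : Diagram n} {p q : I × ℝ}
    (h : (d.comp e).Reach p q) {z' : I} (hq : q.1 = lo z') :
    ∃ z, p.1 = lo z ∧ d.Reach (z, p.2) (z', q.2) := by
  induction h using Relation.ReflTransGen.head_induction_on with
  | refl => exact ⟨z', hq, .refl⟩
  | head hs _ ih =>
    obtain ⟨w, hw, hr⟩ := ih
    obtain ⟨hle, i, h1, h2⟩ := hs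
    rw [hw] at hle h2
    obtain ⟨z, hz, hz'⟩ := exists_lo_of_le hle
    rw [← hz', comp_strand_lo] at h1
    rw [comp_strand_lo] at h2
    exact ⟨z, hz'.symm, .head ⟨hz, i, h1, h2⟩ hr⟩

theorem Diagram.Reach.of_comp_hi {n : ℕ} {d e : Diagram n} {p q : I × ℝ}
    (h : (d.comp e).Reach p q) {z : I} (hp : p.1 = hi z) :
    ∃ z', q.1 = hi z' ∧ e.Reach (z, p.2) (z', q.2) := by
  induction h with
  | refl => exact ⟨z, hp, .refl⟩
  | tail _ hs ih =>
    obtain ⟨w, hw, hr⟩ := ih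
    obtain ⟨hle, i, h1, h2⟩ := hs
    rw [hw] at hle h1
    obtain ⟨z', hz, hz'⟩ := exists_hi_of_le hle
    rw [← hz', comp_strand_hi] at h2
    rw [comp_strand_hi] at h1
    exact ⟨z', hz'.symm, .tail hr ⟨hz, d.perm i, h1, h2⟩⟩

theorem Diagram.trace_comp {n : ℕ} (d e : Diagram n) (a k : Fin (n + 1)) :
    (d.comp e).Trace a k ↔ ∃ b, d.Trace a b ∧ e.Trace b k := by
  constructor
  · rintro ⟨k', hk, hr⟩
    obtain ⟨x, h1, h2⟩ := hr.split (u := lo 1) (lo 1).2.1 (lo 1).2.2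
    obtain ⟨z, hz, h3⟩ := h1.of_comp_lo rfl
    have hz0 : z = 0 := lo_strictMono.injective (hz.symm.trans lo_zero.symm)
    rw [hz0] at h3
    obtain ⟨z', hz', h4⟩ := h2.of_comp_hi lo_one
    have hz1 : z' = 1 := hi_strictMono.injective (hz'.symm.trans hi_one.symm)
    rw [hz1] at h4
    obtain ⟨i, hi⟩ := h3.on_strand ⟨a, d.bottom a⟩
    simp only [d.top] at hi
    subst hi
    exact ⟨d.perm i, ⟨_, le_rfl, h3⟩, ⟨k', hk, h4⟩⟩
  · rintro ⟨b, ⟨b', hb, h1⟩, ⟨k', hk, h2⟩⟩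
    obtain ⟨m, h3, h4⟩ := h2.right b' (by
      rw [e.bottom]
      simpa using hb)
    rw [e.bottom, e.top] at h4
    rw [e.top] at h3
    refine ⟨e.perm m, hk.trans (Fin.le_def.2 ?_), ?_⟩
    · have : (k' : ℝ) ≤ (e.perm m : ℝ) := by simpa using h3
      exact_mod_cast this
    · have h5 := h1.comp_lo e
      have h6 := h4.comp_hi d
      simp only [lo_zero, lo_one, hi_one] at h5 h6
      exact h5.trans h6

theorem trace_straight {n : ℕ} {s : Equiv.Perm (Fin (n + 1))} (hs : Avoids321 s)
    (a k : Fin (n + 1)) : (straight s hs).Trace a k ↔ ∃ i ≤ a, k ≤ s i := by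
  constructor
  · rintro ⟨k', hk, hr⟩
    -- a path is never to the right of all strands that start to the left of it
    have main : ∀ q : I × ℝ, (straight s hs).Reach (0, (a : ℝ) + 1) q →
        ∃ i ≤ a, q.2 ≤ (straight s hs).strand i q.1 := by
      intro q hq
      induction hq with
      | refl => exact ⟨a, le_rfl, ((straight s hs).bottom a).ge⟩
      | @tail b c _ hst ih =>
        obtain ⟨i, hia, hi⟩ := ih
        obtain ⟨hle, j, h1, h2⟩ := hst
        rw [← h1] at hi
        rw [← h2]
        rcases le_or_gt j a with hja | hja
        · exact ⟨j, hja, le_rfl⟩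
        · refine ⟨i, hia, ?_⟩
          by_contra hc
          have hij : i < j := hia.trans_lt hja
          obtain ⟨w, hw, hw', hm⟩ := exists_eq_between ((straight s hs).strand j)
            ((straight s hs).strand i) hle hi (not_le.1 hc).le
          have hinv := straight_inv s hij hm.symm
          have g1 := fin_cast_lt hij
          have g2 := fin_cast_lt hinv
          rw [straight_strand, straight_strand] at hi hm hc
          have hw1 : (w : ℝ) ≤ c.1 := hw'
          have hw2 : (b.1 : ℝ) ≤ w := hw
          nlinarith
    obtain ⟨i, hia, hi⟩ := main _ hr
    rw [(straight s hs).top] at hi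
    refine ⟨i, hia, hk.trans (Fin.le_def.2 ?_)⟩
    have : (k' : ℝ) ≤ (s i : ℝ) := by
      have : (k' : ℝ) + 1 ≤ (s i : ℝ) + 1 := hi
      linarith
    exact_mod_cast this
  · rintro ⟨i, hia, hk⟩
    have h := (straight s hs).climb_strand i (y := 0) (z := 1) zero_le_one
    obtain ⟨m, h3, h4⟩ := h.right a (by
      simp only [(straight s hs).bottom]
      have : (i : ℝ) ≤ (a : ℝ) := by exact_mod_cast hia
      linarith)
    simp only [(straight s hs).bottom, (straight s hs).top] at h3 h4
    refine ⟨s m, hk.trans (Fin.le_def.2 ?_), h4⟩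
    have : (s i : ℝ) + 1 ≤ (s m : ℝ) + 1 := h3
    have : (s i : ℝ) ≤ (s m : ℝ) := by linarith
    exact_mod_cast this

/-- The invariant `Diagram.Trace` of a class of diagrams. -/
def DL.Trace {n : ℕ} (x : DL n) (a k : Fin (n + 1)) : Prop :=
  Quot.lift (fun d : Diagram n => d.Trace a k) (fun _ _ h => propext h.trace) x

theorem DL.trace_mk {n : ℕ} (d : Diagram n) (a k : Fin (n + 1)) :
    (DL.mk d).Trace a k ↔ d.Trace a k := Iff.rfl

theorem DL.trace_one {n : ℕ} (a k : Fin (n + 1)) : (1 : DL n).Trace a k ↔ k ≤ a := by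
  rw [DL.one_def, DL.trace_mk, trivialDiagram, trace_straight]
  exact ⟨fun ⟨i, h1, h2⟩ => le_trans h2 h1, fun h => ⟨a, le_rfl, h⟩⟩

theorem DL.trace_mul_elem {n : ℕ} (x : DL n) (i : Fin n) (a k : Fin (n + 1)) :
    (x * elem i).Trace a k ↔
      ∃ b, x.Trace a b ∧ ∃ c ≤ b, k ≤ Equiv.swap i.castSucc i.succ c := by
  obtain ⟨d, rfl⟩ := DL.exists_mk x
  rw [elem, DL.mk_mul_mk, DL.trace_mk, Diagram.trace_comp]
  simp only [elementary, trace_straight, DL.trace_mk]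

/-! ### Normal forms in `L_n` -/

theorem gen_idem {n : ℕ} (i : Fin n) : gen i * gen i = gen i :=
  PresentedMonoid.mk_eq_mk_of_rel (HKRel.idem i)

theorem gen_comm {n : ℕ} (i j : Fin n) (h : (j : ℕ) + 1 < i) : gen i * gen j = gen j * gen i :=
  PresentedMonoid.mk_eq_mk_of_rel (HKRel.comm i j h)

theorem gen_braid {n : ℕ} (i j : Fin n) (h : (j : ℕ) = i + 1) :
    gen i * gen j * gen i = gen j * gen i * gen j :=
  PresentedMonoid.mk_eq_mk_of_rel (HKRel.braid i j h)

theorem gen_kiselman {n : ℕ} (i j : Fin n) (h : (j : ℕ) = i + 1) :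
    gen j * gen i * gen j = gen i * gen j :=
  PresentedMonoid.mk_eq_mk_of_rel (HKRel.kiselman i j h)

theorem LMonoid.induction {n : ℕ} {p : LMonoid n → Prop} (x : LMonoid n) (one : p 1)
    (mul_gen : ∀ x i, p x → p (x * gen i)) : p x := by
  have hx : x ∈ Submonoid.closure (Set.range (PresentedMonoid.of (HKRel n))) := by
    rw [PresentedMonoid.closure_range_of]
    trivial
  induction hx using Submonoid.closure_induction_right with
  | one => exact one
  | mul_right x _ y hy ih =>
    obtain ⟨i, rfl⟩ := hy
    exact mul_gen x i ih

/-- The generators of `L_n`, indexed by all natural numbers; the superfluous ones are trivial. -/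
def genNat (n i : ℕ) : LMonoid n := if h : i < n then gen ⟨i, h⟩ else 1

theorem genNat_val {n : ℕ} (i : Fin n) : genNat n i = gen i := dif_pos i.2

theorem genNat_idem (n i : ℕ) : genNat n i * genNat n i = genNat n i := by
  unfold genNat
  split_ifs
  · exact gen_idem _
  · exact one_mul 1

theorem genNat_comm (n : ℕ) {i j : ℕ} (h : j + 1 < i) : Commute (genNat n i) (genNat n j) := by
  unfold genNat
  split_ifs
  · exact gen_comm _ _ h
  all_goals simp

theorem genNat_left (n i : ℕ) :
    genNat n i * genNat n (i + 1) * genNat n i = genNat n i * genNat n (i + 1) := by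
  by_cases h : i + 1 < n
  · have h' : i < n := by omega
    simp only [genNat, dif_pos h, dif_pos h']
    rw [gen_braid _ _ rfl, gen_kiselman _ _ rfl]
  · have h1 : genNat n (i + 1) = 1 := dif_neg h
    rw [h1, mul_one, genNat_idem]

theorem genNat_right (n i : ℕ) :
    genNat n (i + 1) * genNat n i * genNat n (i + 1) = genNat n i * genNat n (i + 1) := by
  by_cases h : i + 1 < n
  · have h' : i < n := by omega
    simp only [genNat, dif_pos h, dif_pos h']
    rw [gen_kiselman _ _ rfl]
  · have h1 : genNat n (i + 1) = 1 := dif_neg h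
    rw [h1, mul_one, one_mul, mul_one]

/-- The product of `m` generators with consecutive indices, starting with the index `a`. -/
def run (n a : ℕ) : ℕ → LMonoid n
  | 0 => 1
  | m + 1 => run n a m * genNat n (a + m)

theorem run_zero (n a : ℕ) : run n a 0 = 1 := rfl

theorem run_succ (n a m : ℕ) : run n a (m + 1) = run n a m * genNat n (a + m) := rfl

theorem commute_run (n : ℕ) {a m c : ℕ} (h : a + m < c) : Commute (genNat n c) (run n a m) := by
  induction m with
  | zero => exact Commute.one_right _
  | succ m ih => exact (ih (by omega)).mul_right (genNat_comm n (by omega))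

theorem run_mul_gen (n : ℕ) {b m c : ℕ} (h1 : b ≤ c) (h2 : c < b + m) :
    run n b m * genNat n c = run n b m := by
  induction m with
  | zero => omega
  | succ m ih =>
    rcases Nat.lt_or_ge c (b + m) with h | h
    · rcases Nat.lt_or_ge (c + 1) (b + m) with h' | h'
      · rw [run_succ, mul_assoc, (genNat_comm n h').eq, ← mul_assoc, ih h]
      · obtain ⟨m, rfl⟩ : ∃ m', m = m' + 1 := ⟨m - 1, by omega⟩
        obtain rfl : c = b + m := by omega
        rw [run_succ, run_succ, mul_assoc, mul_assoc, ← mul_assoc (genNat n (b + m)),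
          ← add_assoc b m 1, genNat_left, ← mul_assoc]
    · obtain rfl : c = b + m := by omega
      rw [run_succ, mul_assoc, genNat_idem]

theorem gen_mul_run (n : ℕ) {b m c : ℕ} (h1 : b ≤ c) (h2 : c < b + m) :
    genNat n c * run n b m = run n b m := by
  induction m with
  | zero => omega
  | succ m ih =>
    rcases Nat.lt_or_ge c (b + m) with h | h
    · rw [run_succ, ← mul_assoc, ih h]
    · obtain rfl : c = b + m := by omega
      rcases m with _ | m
      · simp only [run, one_mul]
        exact genNat_idem n _
      · rw [run_succ, run_succ, ← mul_assoc, ← mul_assoc, (commute_run n (by omega)).eq,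
          mul_assoc, mul_assoc, ← mul_assoc (genNat n _), ← add_assoc b m 1, genNat_right, mul_assoc]

theorem run_mul_run (n : ℕ) {a m' b m : ℕ} (h1 : b ≤ a) (h2 : a + m' ≤ b + m) :
    run n b m * run n a m' = run n b m := by
  induction m' with
  | zero => exact mul_one _
  | succ m' ih =>
    rw [run_succ, ← mul_assoc, ih (by omega), run_mul_gen n (by omega) (by omega)]

theorem run_mul_run' (n : ℕ) {a m' b m : ℕ} (h1 : b ≤ a) (h2 : a + m' ≤ b + m) :
    run n a m' * run n b m = run n b m := by
  induction m' with
  | zero => exact one_mul _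
  | succ m' ih =>
    rw [run_succ, mul_assoc, gen_mul_run n (by omega) (by omega), ih (by omega)]

/-- The normal form attached to a weakly increasing sequence `y` with `y k ≤ k`: for the places
`k = M - 1, …, 1, 0`, in this order, the entry at the place `y k` is propagated to the place `k`. -/
def normalForm (n : ℕ) (y : ℕ → ℕ) : ℕ → LMonoid n
  | 0 => 1
  | M + 1 => run n (y M) (M - y M) * normalForm n y M

theorem normalForm_congr (n : ℕ) {y y' : ℕ → ℕ} {M : ℕ} (h : ∀ k < M, y k = y' k) :
    normalForm n y M = normalForm n y' M := by
  induction M with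
  | zero => rfl
  | succ M ih =>
    simp only [normalForm]
    rw [h M (Nat.lt_succ_self M), ih fun k hk => h k (hk.trans (Nat.lt_succ_self M))]

theorem commute_normalForm (n : ℕ) {y : ℕ → ℕ} (hy : ∀ k, y k ≤ k) {M c : ℕ} (h : M ≤ c) :
    Commute (genNat n c) (normalForm n y M) := by
  induction M with
  | zero => exact Commute.one_right _
  | succ M ih =>
    refine Commute.mul_right (commute_run n ?_) (ih (by omega))
    have := hy M
    omega

/-- The factors for the places below `i` commute with the generator, which the factor for the place
`i` absorbs; the factor for the place `i + 1` then absorbs the superfluous generators. -/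
theorem normalForm_mul_gen (n : ℕ) {y : ℕ → ℕ} (hm : Monotone y) (hy : ∀ k, y k ≤ k) {i M : ℕ}
    (h : i + 1 < M) : normalForm n y M * genNat n i =
      normalForm n (Function.update y (i + 1) (y i)) M := by
  induction M with
  | zero => omega
  | succ M ih =>
    rcases Nat.lt_or_ge (i + 1) M with h' | h'
    · simp only [normalForm]
      rw [mul_assoc, ih h', Function.update_of_ne (by omega)]
    · obtain rfl : M = i + 1 := by omega
      have e : run n (y i) (i - y i) * genNat n i = run n (y i) (i + 1 - y i) := by
        have h1 := hy i
        have h2 := run_succ n (y i) (i - y i)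
        rw [Nat.add_sub_cancel' h1] at h2
        rw [← h2]
        congr 1
        omega
      have h1 := hy i
      have h2 := hy (i + 1)
      have h3 : y i ≤ y (i + 1) := hm (Nat.le_succ i)
      simp only [normalForm, Function.update_self, Function.update_of_ne (Nat.succ_ne_self i).symm]
      rw [normalForm_congr n (y := Function.update y (i + 1) (y i)) (y' := y) (M := i)
        fun k hk => Function.update_of_ne (by omega) _ _]
      rw [mul_assoc, mul_assoc, ← (commute_normalForm n hy le_rfl).eq, ← mul_assoc (run n (y i) _),
        e, ← mul_assoc, ← mul_assoc, run_mul_run' n h3 (by omega), run_mul_run n le_rfl (by omega)]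

/-! ### The action on `(1, …, n + 1)` -/

/-- The result of the action of `x` on `(1, 2, …, n + 1)`. -/
def vec {n : ℕ} (x : LMonoid n) : Fin (n + 1) → ℕ := (act n x).unop fun k => (k : ℕ) + 1

theorem phi_eq {n : ℕ} (x : LMonoid n) : phi x = coupleOf (vec x) := rfl

theorem act_one {n : ℕ} (y : Fin (n + 1) → ℕ) : (act n 1).unop y = y := by
  rw [map_one]
  rfl

theorem act_mul_gen {n : ℕ} (x : LMonoid n) (i : Fin n) (y : Fin (n + 1) → ℕ) :
    (act n (x * gen i)).unop y = propagate i ((act n x).unop y) := by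
  rw [map_mul, mul_unop_apply]
  rfl

theorem vec_one {n : ℕ} : vec (1 : LMonoid n) = fun k : Fin (n + 1) => (k : ℕ) + 1 := act_one _

theorem vec_mul_gen {n : ℕ} (x : LMonoid n) (i : Fin n) :
    vec (x * gen i) = propagate i (vec x) := act_mul_gen x i _

theorem propagate_apply {n : ℕ} (i : Fin n) (y : Fin (n + 1) → ℕ) (k : Fin (n + 1)) :
    propagate i y k = if k = i.succ then y i.castSucc else y k := by
  rw [propagate, Function.update_apply]

/-- The sequences that arise from `(1, …, n + 1)` by the action of `L_n`. -/
def Valid {n : ℕ} (y : Fin (n + 1) → ℕ) : Prop :=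
  Monotone y ∧ ∀ k, 1 ≤ y k ∧ y k ≤ (k : ℕ) + 1

theorem valid_vec {n : ℕ} (x : LMonoid n) : Valid (vec x) := by
  induction x using LMonoid.induction with
  | one =>
    rw [vec_one]
    exact ⟨fun i j h => Nat.succ_le_succ h, fun k => ⟨Nat.le_add_left _ _, le_rfl⟩⟩
  | mul_gen x i ih =>
    rw [vec_mul_gen]
    obtain ⟨hm, hy⟩ := ih
    refine ⟨fun j k hjk => ?_, fun k => ?_⟩
    · rw [propagate_apply, propagate_apply]
      rw [Fin.le_def] at hjk
      split_ifs with h1 h2 h2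
      · exact le_rfl
      · refine hm (Fin.le_def.2 ?_)
        rw [h1] at hjk
        simp at hjk ⊢
        omega
      · refine hm (Fin.le_def.2 ?_)
        rw [h2] at hjk
        have : j.val ≠ i.val + 1 := fun h => h1 (Fin.ext (by simpa using h))
        simp at hjk ⊢
        omega
      · exact hm hjk
    · rw [propagate_apply]
      split_ifs with h1
      · have := hy i.castSucc
        rw [h1]
        simp at this ⊢
        omega
      · exact hy k

/-- A sequence indexed by `Fin (n + 1)` with values starting at `1`, as a sequence of natural
numbers with values starting at `0`. -/
def shift {n : ℕ} (y : Fin (n + 1) → ℕ) (k : ℕ) : ℕ := if h : k < n + 1 then y ⟨k, h⟩ - 1 else k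

theorem shift_propagate {n : ℕ} (i : Fin n) (y : Fin (n + 1) → ℕ) :
    shift (propagate i y) = Function.update (shift y) (i + 1) (shift y i) := by
  funext k
  have hi : (i : ℕ) < n + 1 := by omega
  rw [Function.update_apply]
  unfold shift
  by_cases hk : k < n + 1
  · simp only [dif_pos hk, dif_pos hi, propagate_apply, Fin.ext_iff, Fin.val_succ]
    split_ifs
    · rfl
    · rfl
  · rw [if_neg (by omega), dif_neg hk, dif_neg hk]

theorem Valid.shift {n : ℕ} {y : Fin (n + 1) → ℕ} (h : Valid y) :
    Monotone (shift y) ∧ ∀ k, HeckeKiselman.shift y k ≤ k := by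
  have hle : ∀ k, HeckeKiselman.shift y k ≤ k := by
    intro k
    unfold HeckeKiselman.shift
    split_ifs with hk
    · have := (h.2 ⟨k, hk⟩).2
      simp only at this
      omega
    · exact le_rfl
  refine ⟨fun j k hjk => ?_, hle⟩
  by_cases hk : k < n + 1
  · have hj : j < n + 1 := by omega
    have : y ⟨j, hj⟩ ≤ y ⟨k, hk⟩ := h.1 hjk
    simp only [HeckeKiselman.shift, dif_pos hj, dif_pos hk]
    omega
  · refine (hle j).trans ?_
    simp only [HeckeKiselman.shift, dif_neg hk]
    exact hjk

/-- Every element of `L_n` is determined by the result of its action on `(1, …, n + 1)`. -/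
theorem eq_normalForm {n : ℕ} (x : LMonoid n) : x = normalForm n (shift (vec x)) (n + 1) := by
  induction x using LMonoid.induction with
  | one =>
    have h : ∀ M, M ≤ n + 1 → normalForm n (shift (vec (1 : LMonoid n))) M = 1 := by
      intro M
      induction M with
      | zero => exact fun _ => rfl
      | succ M ih =>
        intro hM
        simp only [normalForm]
        have : shift (vec (1 : LMonoid n)) M = M := by
          rw [vec_one]
          simp [shift]
        rw [this, Nat.sub_self, run_zero, one_mul, ih (by omega)]
    exact (h _ le_rfl).symm
  | mul_gen x i ih =>
    obtain ⟨hm, hy⟩ := (valid_vec x).shift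
    rw [vec_mul_gen, shift_propagate, ← normalForm_mul_gen n hm hy (by omega), ← ih, genNat_val]

theorem vec_injective {n : ℕ} : Function.Injective (vec (n := n)) := by
  intro x x' h
  rw [eq_normalForm x, eq_normalForm x', h]

/-- The sequence attached to `x` can be read off from the diagram of `x`. -/
theorem trace_eps {n : ℕ} (x : LMonoid n) (a k : Fin (n + 1)) :
    (eps n x).Trace a k ↔ vec x k ≤ (a : ℕ) + 1 := by
  induction x using LMonoid.induction generalizing k with
  | one =>
    rw [map_one, DL.trace_one, vec_one, Fin.le_def]
    exact Nat.succ_le_succ_iff.symm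
  | mul_gen x i ih =>
    rw [map_mul, eps_gen, DL.trace_mul_elem, vec_mul_gen, propagate_apply]
    have hm := (valid_vec x).1
    constructor
    · rintro ⟨b, hb, c, hcb, hk⟩
      rw [ih] at hb
      rw [Fin.le_def, swap_val] at hk
      rw [Fin.le_def] at hcb
      split_ifs with h
      · refine (hm (Fin.le_def.2 ?_)).trans hb
        rw [h] at hk
        simp only [Fin.val_succ, Fin.val_castSucc] at hk ⊢
        split_ifs at hk <;> omega
      · have : k.val ≠ i.val + 1 := fun h' => h (Fin.ext (by simpa using h'))
        refine (hm (Fin.le_def.2 ?_)).trans hb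
        split_ifs at hk <;> omega
    · intro h
      split_ifs at h with h'
      · refine ⟨i.castSucc, (ih _).2 h, i.castSucc, le_rfl, ?_⟩
        rw [h', Equiv.swap_apply_left]
      · have : k.val ≠ i.val + 1 := fun h'' => h' (Fin.ext (by simpa using h''))
        refine ⟨k, (ih _).2 h, k, le_rfl, ?_⟩
        rw [Fin.le_def, swap_val]
        split_ifs <;> omega

theorem vec_eq_of_trace {n : ℕ} {y y' : Fin (n + 1) → ℕ} (hy : Valid y) (hy' : Valid y')
    (h : ∀ a k : Fin (n + 1), y k ≤ (a : ℕ) + 1 ↔ y' k ≤ (a : ℕ) + 1) : y = y' := by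
  have key : ∀ {y y' : Fin (n + 1) → ℕ}, Valid y →
      (∀ a k : Fin (n + 1), y k ≤ (a : ℕ) + 1 ↔ y' k ≤ (a : ℕ) + 1) → ∀ k, y' k ≤ y k := by
    intro y y' hy h k
    have h1 := hy.2 k
    have h2 := (h ⟨y k - 1, by omega⟩ k).1 (by simp only; omega)
    simp only at h2
    omega
  exact funext fun k => le_antisymm (key hy' (fun a k => (h a k).symm) k) (key hy h k)

theorem eps_injective (n : ℕ) : Function.Injective (eps n) := by
  intro x x' h
  refine vec_injective (vec_eq_of_trace (valid_vec x) (valid_vec x') fun a k => ?_)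
  rw [← trace_eps, ← trace_eps, h]

/-! ### Excedances of `321`-avoiding permutations -/

theorem Avoids321.lt_of_excedance {m : ℕ} {s : Equiv.Perm (Fin m)} (hs : Avoids321 s) {i j : Fin m}
    (hi : i < s i) (hj : j < i) : s j < s i := by
  by_contra hc
  have hc : s i < s j := lt_of_le_of_ne (not_lt.1 hc) (s.injective.ne hj.ne')
  -- everything above `i` is sent above `s i`, as is `j`: there is not enough room
  have hmap : Finset.image s (insert j (Finset.Ici i)) ⊆ Finset.Ici (s i) := by
    intro x hx
    obtain ⟨k, hk, rfl⟩ := Finset.mem_image.1 hx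
    rw [Finset.mem_insert, Finset.mem_Ici] at hk
    rw [Finset.mem_Ici]
    rcases hk with rfl | hk
    · exact hc.le
    · by_contra hlt
      have hik : i < k := lt_of_le_of_ne hk fun h => hlt (by rw [h])
      exact hs ⟨j, i, k, hj, hik, hc, not_le.1 hlt⟩
  have hcard := Finset.card_le_card hmap
  rw [Finset.card_image_of_injective _ s.injective,
    Finset.card_insert_of_notMem (by simpa using hj), Fin.card_Ici, Fin.card_Ici] at hcard
  rw [Fin.lt_def] at hi
  omega

theorem Avoids321.lt_of_not_excedance {m : ℕ} {s : Equiv.Perm (Fin m)} (hs : Avoids321 s)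
    {i j : Fin m} (hi : s i ≤ i) (hj : i < j) : s i < s j := by
  by_contra hc
  have hc : s j < s i := lt_of_le_of_ne (not_lt.1 hc) (s.injective.ne hj.ne')
  have hmap : Finset.image s (insert j (Finset.Iic i)) ⊆ Finset.Iic (s i) := by
    intro x hx
    obtain ⟨k, hk, rfl⟩ := Finset.mem_image.1 hx
    rw [Finset.mem_insert, Finset.mem_Iic] at hk
    rw [Finset.mem_Iic]
    rcases hk with rfl | hk
    · exact hc.le
    · by_contra hlt
      have hik : k < i := lt_of_le_of_ne hk fun h => hlt (by rw [h])
      exact hs ⟨k, i, j, hik, hj, not_le.1 hlt, hc⟩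
  have hcard := Finset.card_le_card hmap
  rw [Finset.card_image_of_injective _ s.injective,
    Finset.card_insert_of_notMem (by simpa using hj), Fin.card_Iic, Fin.card_Iic] at hcard
  rw [Fin.le_def] at hi
  omega

/-- A `321`-avoiding permutation is determined by its excedances, since it is increasing on the other
indices. -/
theorem Avoids321.eq_of_excedances {m : ℕ} {s s' : Equiv.Perm (Fin m)} (hs : Avoids321 s)
    (hs' : Avoids321 s') (h : ∀ i, i < s i → s' i = s i) (h' : ∀ i, i < s' i → s i = s' i) :
    s = s' := by
  by_contra hne
  -- compare the permutations at the first index at which they differ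
  obtain ⟨i₀, hi₀⟩ : ∃ i, s i ≠ s' i := by
    by_contra hc
    push Not at hc
    exact hne (Equiv.ext hc)
  obtain ⟨i, hi, hmin⟩ := WellFounded.has_min (wellFounded_lt (α := Fin m))
    {i | s i ≠ s' i} ⟨i₀, hi₀⟩
  have hmin' : ∀ j < i, s j = s' j := fun j hj => by
    by_contra hc
    exact hmin j hc hj
  have key : ∀ {s s' : Equiv.Perm (Fin m)}, Avoids321 s' → s' i ≤ i → (∀ j < i, s j = s' j) →
      ¬ s i < s' i := by
    intro s s' hs' hle hmin hlt
    obtain ⟨j, hj⟩ := s'.surjective (s i)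
    rcases lt_trichotomy j i with hji | rfl | hji
    · rw [← hmin j hji] at hj
      exact hji.ne (s.injective hj)
    · exact hlt.ne hj.symm
    · have := hs'.lt_of_not_excedance hle hji
      rw [hj] at this
      exact this.asymm hlt
  have e : s i ≤ i := not_lt.1 fun hlt => hi (h i hlt).symm
  have e' : s' i ≤ i := not_lt.1 fun hlt => hi (h' i hlt)
  rcases lt_or_gt_of_ne hi with hlt | hlt
  · exact key hs' e' hmin' hlt
  · exact key hs e (fun j hj => (hmin' j hj).symm) hlt

/-- Prescribed excedances are extended by the order isomorphism between the other indices and the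
other values; the counts show that it produces no further excedance. -/
theorem exists_perm_of_excedances {m k : ℕ} {a b : Fin k → Fin m} (ha : StrictMono a)
    (hb : StrictMono b) (hab : ∀ t, a t < b t) :
    ∃ s : Equiv.Perm (Fin m), Avoids321 s ∧ (∀ i, i < s i ↔ i ∈ Set.range a) ∧
      ∀ t, s (a t) = b t := by
  classical
  let e₁ : {i // i ∈ Set.range a} ≃ {i // i ∈ Set.range b} :=
    (Equiv.ofInjective a ha.injective).symm.trans (Equiv.ofInjective b hb.injective)
  have hcard : Fintype.card {i // ¬ i ∈ Set.range b} = Fintype.card {i // ¬ i ∈ Set.range a} := by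
    rw [Fintype.card_subtype_compl, Fintype.card_subtype_compl, Fintype.card_congr e₁]
  let e₂ : {i // ¬ i ∈ Set.range a} ≃o {i // ¬ i ∈ Set.range b} :=
    (Fintype.orderIsoFinOfCardEq _ rfl).symm.trans (Fintype.orderIsoFinOfCardEq _ hcard)
  let s : Equiv.Perm (Fin m) := Equiv.subtypeCongr e₁ e₂.toEquiv
  have hsa : ∀ t, s (a t) = b t := by
    intro t
    have h1 : s (a t) = e₁ ⟨a t, t, rfl⟩ := by
      simp only [s, Equiv.subtypeCongr, Equiv.trans_apply,
        Equiv.sumCompl_symm_apply_of_pos (p := fun i => i ∈ Set.range a) ⟨t, rfl⟩]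
      rfl
    have h2 : (Equiv.ofInjective a ha.injective).symm ⟨a t, t, rfl⟩ = t := by
      rw [Equiv.symm_apply_eq]
      rfl
    rw [h1]
    simp only [e₁, Equiv.trans_apply, h2]
    rfl
  have hsc : ∀ i (hi : i ∉ Set.range a), s i = e₂ ⟨i, hi⟩ := by
    intro i hi
    simp only [s, Equiv.subtypeCongr, Equiv.trans_apply,
      Equiv.sumCompl_symm_apply_of_neg (p := fun i => i ∈ Set.range a) hi]
    rfl
  have hmono : ∀ i j, i ∉ Set.range a → j ∉ Set.range a → i < j → s i < s j := by
    intro i j hi hj hij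
    rw [hsc i hi, hsc j hj]
    exact e₂.strictMono (show (⟨i, hi⟩ : {i // ¬ i ∈ Set.range a}) < ⟨j, hj⟩ from hij)
  have hle : ∀ i, i ∉ Set.range a → s i ≤ i := by
    intro c hc
    by_contra hlt
    have hlt := not_le.1 hlt
    have hmap : Finset.image s (Finset.Ici c) ⊆ Finset.Ioi c := by
      intro x hx
      obtain ⟨i, hi, rfl⟩ := Finset.mem_image.1 hx
      rw [Finset.mem_Ici] at hi
      rw [Finset.mem_Ioi]
      by_cases hia : i ∈ Set.range a
      · obtain ⟨t, rfl⟩ := hia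
        rw [hsa]
        exact hi.trans_lt (hab t)
      · rcases eq_or_lt_of_le hi with rfl | hi
        · exact hlt
        · exact hlt.trans (hmono _ _ hc hia hi)
    have hcard := Finset.card_le_card hmap
    rw [Finset.card_image_of_injective _ s.injective, Fin.card_Ici, Fin.card_Ioi] at hcard
    omega
  refine ⟨s, ?_, fun i => ?_, hsa⟩
  · have hmono' : ∀ i j, i ∈ Set.range a → j ∈ Set.range a → i < j → s i < s j := by
      rintro _ _ ⟨t, rfl⟩ ⟨u, rfl⟩ htu
      rw [hsa, hsa]
      exact hb (ha.lt_iff_lt.1 htu)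
    rintro ⟨i, j, k, hij, hjk, h1, h2⟩
    by_cases hi : i ∈ Set.range a <;> by_cases hj : j ∈ Set.range a <;>
      by_cases hk : k ∈ Set.range a
    · exact (hmono' i j hi hj hij).asymm h1
    · exact (hmono' i j hi hj hij).asymm h1
    · exact (hmono' i k hi hk (hij.trans hjk)).asymm (h2.trans h1)
    · exact (hmono j k hj hk hjk).asymm h2
    · exact (hmono' j k hj hk hjk).asymm h2
    · exact (hmono i k hi hk (hij.trans hjk)).asymm (h2.trans h1)
    · exact (hmono i j hi hj hij).asymm h1
    · exact (hmono i j hi hj hij).asymm h1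
  · constructor
    · intro hi
      by_contra hc
      exact (hle i hc).not_gt hi
    · rintro ⟨t, rfl⟩
      rw [hsa]
      exact hab t

/-! ### The permutation of an element of `L_n` -/

/-- For each place `k`, the sequence `y` gives the smallest `i` with `k ≤ s i`. -/
def Represents {n : ℕ} (s : Equiv.Perm (Fin (n + 1))) (y : Fin (n + 1) → ℕ) : Prop :=
  ∀ a k : Fin (n + 1), y k ≤ (a : ℕ) + 1 ↔ ∃ i ≤ a, k ≤ s i

/-- Multiplication by a generator `x_(i+1)` exchanges the values `i` and `i + 1` of the permutation,
unless they are inverted already. -/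
theorem exists_represents {n : ℕ} (x : LMonoid n) : ∃ s, Represents s (vec x) := by
  induction x using LMonoid.induction with
  | one =>
    refine ⟨1, fun a k => ?_⟩
    rw [vec_one]
    simp only [Equiv.Perm.coe_one, id, add_le_add_iff_right]
    exact ⟨fun h => ⟨a, le_rfl, h⟩, fun ⟨i, h1, h2⟩ => Fin.le_def.1 (h2.trans h1)⟩
  | mul_gen x i ih =>
    obtain ⟨s, hs⟩ := ih
    rw [vec_mul_gen]
    have hval : ∀ p : Fin (n + 1), s p = i.castSucc ↔ p = s.symm i.castSucc := fun p =>
      (Equiv.eq_symm_apply s).symm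
    rcases lt_or_gt_of_ne (s.symm.injective.ne (Fin.castSucc_lt_succ (i := i)).ne) with hlt | hlt
    · refine ⟨s.trans (Equiv.swap i.castSucc i.succ), fun a k => ?_⟩
      rw [propagate_apply]
      split_ifs with hk
      · rw [hs]
        constructor
        · rintro ⟨p, hp, hle⟩
          by_cases h1 : s p = i.succ
          · refine ⟨s.symm i.castSucc, hlt.le.trans ?_, ?_⟩
            · rwa [← h1, Equiv.symm_apply_apply]
            · simp [hk]
          · refine ⟨p, hp, ?_⟩
            have h1' : (s p).val ≠ i.val + 1 := fun h => h1 (Fin.ext (by simpa using h))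
            rw [Fin.le_def] at hle ⊢
            rw [hk, Equiv.trans_apply, swap_val]
            simp only [Fin.val_succ, Fin.val_castSucc] at hle ⊢
            split_ifs <;> omega
        · rintro ⟨p, hp, hle⟩
          refine ⟨p, hp, ?_⟩
          rw [Fin.le_def] at hle ⊢
          rw [hk, Equiv.trans_apply, swap_val] at hle
          simp only [Fin.val_succ, Fin.val_castSucc] at hle ⊢
          split_ifs at hle <;> omega
      · rw [hs]
        have hk' : k.val ≠ i.val + 1 := fun h => hk (Fin.ext (by simpa using h))
        refine exists_congr fun p => and_congr_right fun _ => ?_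
        rw [Fin.le_def, Fin.le_def, Equiv.trans_apply, swap_val]
        split_ifs <;> omega
    · refine ⟨s, fun a k => ?_⟩
      rw [propagate_apply]
      split_ifs with hk
      · rw [hs]
        constructor
        · rintro ⟨p, hp, hle⟩
          by_cases h1 : s p = i.castSucc
          · refine ⟨s.symm i.succ, hlt.le.trans ?_, ?_⟩
            · rwa [← h1, Equiv.symm_apply_apply]
            · simp [hk]
          · refine ⟨p, hp, ?_⟩
            have h1' : (s p).val ≠ i.val := fun h => h1 (Fin.ext (by simpa using h))
            rw [Fin.le_def] at hle ⊢
            rw [hk]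
            simp only [Fin.val_succ, Fin.val_castSucc] at hle ⊢
            omega
        · rintro ⟨p, hp, hle⟩
          exact ⟨p, hp, (hk ▸ (Fin.castSucc_lt_succ (i := i)).le).trans hle⟩
      · exact hs a k

/-- Exchanging the two smaller values of a `321`-pattern does not change the represented sequence;
as the exchange increases the sum of the `i * s i`, the pattern can be removed. -/
theorem exists_avoids321_represents {n : ℕ} (x : LMonoid n) :
    ∃ s, Avoids321 s ∧ Represents s (vec x) := by
  classical
  obtain ⟨s, hs, hmax⟩ := Set.exists_max_image
    {s : Equiv.Perm (Fin (n + 1)) | Represents s (vec x)}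
    (fun s => ∑ i : Fin (n + 1), ((i : ℕ) : ℤ) * ((s i : ℕ) : ℤ)) (Set.toFinite _)
    (exists_represents x)
  refine ⟨s, ?_, hs⟩
  rintro ⟨i, j, k, hij, hjk, h1, h2⟩
  let s' : Equiv.Perm (Fin (n + 1)) := (Equiv.swap j k).trans s
  have hj : s' j = s k := by simp [s']
  have hk : s' k = s j := by simp [s']
  have ho : ∀ p, p ≠ j → p ≠ k → s' p = s p := fun p h1 h2 => by
    simp [s', Equiv.swap_apply_of_ne_of_ne h1 h2]
  have hs' : Represents s' (vec x) := by
    intro a q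
    rw [hs a q]
    have key : ∀ {t t' : Equiv.Perm (Fin (n + 1))}, t' i = t i → t j < t i → t k < t i →
        (∀ p, p ≠ j → p ≠ k → t' p = t p) → (∃ p ≤ a, q ≤ t p) → ∃ p ≤ a, q ≤ t' p := by
      rintro t t' hi hji hki ho ⟨p, hp, hq⟩
      by_cases hpj : p = j
      · exact ⟨i, hij.le.trans (hpj ▸ hp), hi ▸ hq.trans (hpj ▸ hji.le)⟩
      · by_cases hpk : p = k
        · exact ⟨i, (hij.trans hjk).le.trans (hpk ▸ hp), hi ▸ hq.trans (hpk ▸ hki.le)⟩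
        · exact ⟨p, hp, (ho p hpj hpk).symm ▸ hq⟩
    have hi := ho i hij.ne (hij.trans hjk).ne
    exact ⟨key hi h1 (h2.trans h1) ho, key hi.symm (by rw [hj, hi]; exact h2.trans h1)
      (by rw [hk, hi]; exact h1) fun p hpj hpk => (ho p hpj hpk).symm⟩
  have hle := hmax s' hs'
  have hsum : (∑ p : Fin (n + 1), ((p : ℕ) : ℤ) * ((s' p : ℕ) : ℤ)) -
      ∑ p : Fin (n + 1), ((p : ℕ) : ℤ) * ((s p : ℕ) : ℤ) =
        ((k : ℕ) - (j : ℕ) : ℤ) * ((s j : ℕ) - (s k : ℕ) : ℤ) := by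
    rw [← Finset.sum_sub_distrib, Finset.sum_eq_add j k hjk.ne]
    · rw [hj, hk]
      ring
    · rintro p - ⟨hpj, hpk⟩
      rw [ho p hpj hpk, sub_self]
    · simp
    · simp
  have p1 : (0 : ℤ) < (k : ℕ) - (j : ℕ) := sub_pos.2 (by exact_mod_cast hjk)
  have p2 : (0 : ℤ) < (s j : ℕ) - (s k : ℕ) := sub_pos.2 (by exact_mod_cast h2)
  have := mul_pos p1 p2
  linarith

/-! ### Sequence couples -/

theorem eq_of_pairwise_fst {l l' : List (ℕ × ℕ)} (h : l.Pairwise fun p q => p.1 < q.1)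
    (h' : l'.Pairwise fun p q => p.1 < q.1) (hm : ∀ p, p ∈ l ↔ p ∈ l') : l = l' := by
  have hnd : ∀ {l : List (ℕ × ℕ)}, (l.Pairwise fun p q => p.1 < q.1) → l.Nodup := fun h =>
    h.imp fun hpq heq => hpq.ne (by rw [heq])
  exact List.Perm.eq_of_pairwise (fun a b _ _ hab hba => absurd hab hba.asymm) h h'
    ((List.perm_ext_iff_of_nodup (hnd h) (hnd h')).2 hm)

theorem unzip_injective {l l' : List (ℕ × ℕ)} (h : l.unzip = l'.unzip) : l = l' := by
  rw [← List.zip_unzip l, h, List.zip_unzip]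

/-- The pairs `(a, b)` read off from a sequence. -/
def pairs {n : ℕ} (y : Fin (n + 1) → ℕ) : List (ℕ × ℕ) :=
  (((Finset.univ.image y).sort (· ≤ ·)).map fun a =>
    (a, (Finset.univ.filter fun j => y j = a).sup fun j => (j : ℕ) + 1)).filter
      fun c => c.1 ≠ c.2

theorem coupleOf_eq {n : ℕ} (y : Fin (n + 1) → ℕ) : coupleOf y = (pairs y).unzip := rfl

theorem pairwise_pairs {n : ℕ} (y : Fin (n + 1) → ℕ) :
    (pairs y).Pairwise fun p q => p.1 < q.1 := by
  refine List.Pairwise.filter _ ?_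
  rw [List.pairwise_map]
  exact (Finset.sortedLT_sort _).pairwise

theorem mem_pairs {n : ℕ} {y : Fin (n + 1) → ℕ} {p : ℕ × ℕ} :
    p ∈ pairs y ↔ ∃ j : Fin (n + 1), p = (y j, (j : ℕ) + 1) ∧ (∀ j', y j' = y j → j' ≤ j) ∧
      y j ≠ (j : ℕ) + 1 := by
  have hsup : ∀ j : Fin (n + 1), (∀ j', y j' = y j → j' ≤ j) →
      ((Finset.univ.filter fun j' => y j' = y j).sup fun j => (j : ℕ) + 1) = (j : ℕ) + 1 := by
    intro j hj
    refine le_antisymm (Finset.sup_le fun j' hj' => ?_) ?_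
    · exact Nat.succ_le_succ (hj j' (Finset.mem_filter.1 hj').2)
    · exact Finset.le_sup (f := fun j : Fin (n + 1) => (j : ℕ) + 1)
        (Finset.mem_filter.2 ⟨Finset.mem_univ j, rfl⟩)
  unfold pairs
  simp only [ne_eq, decide_not, List.mem_filter, List.mem_map, Finset.mem_sort, Finset.mem_image,
    Finset.mem_univ, true_and, exists_exists_eq_and, Bool.not_eq_eq_eq_not, Bool.not_true,
    decide_eq_false_iff_not]
  constructor
  · rintro ⟨⟨j₀, rfl⟩, hne⟩
    obtain ⟨j, hj, hmax⟩ := Finset.exists_max_image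
      (Finset.univ.filter fun j => y j = y j₀) id ⟨j₀, by simp⟩
    simp only [Finset.mem_filter, Finset.mem_univ, true_and, id] at hj hmax
    have hmax' : ∀ j', y j' = y j → j' ≤ j := fun j' hj' => hmax j' (hj'.trans hj)
    rw [← hj] at hne ⊢
    rw [hsup j hmax'] at hne ⊢
    exact ⟨j, rfl, hmax', hne⟩
  · rintro ⟨j, rfl, hj, hne⟩
    exact ⟨⟨j, by rw [hsup j hj]⟩, hne⟩

/-- The pairs `(a, b)` read off from a permutation. -/
def rightPairs {n : ℕ} (s : Equiv.Perm (Fin (n + 1))) : List (ℕ × ℕ) :=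
  ((List.finRange (n + 1)).filter fun i => i < s i).map
    fun i : Fin (n + 1) => ((i : ℕ) + 1, (s i : ℕ) + 1)

theorem rightCouple_eq {n : ℕ} (s : Equiv.Perm (Fin (n + 1))) :
    rightCouple s = (rightPairs s).unzip := by
  simp only [rightCouple, rightPairs, List.unzip_eq_map, List.map_map, List.bind_eq_flatMap,
    List.pure_def, ← List.map_eq_flatMap]
  rfl

theorem pairwise_rightPairs {n : ℕ} (s : Equiv.Perm (Fin (n + 1))) :
    (rightPairs s).Pairwise fun p q => p.1 < q.1 := by
  unfold rightPairs
  rw [List.pairwise_map]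
  refine List.Pairwise.filter _ ((List.sortedLT_finRange _).pairwise.imp fun h => ?_)
  exact Nat.succ_lt_succ h

theorem mem_rightPairs {n : ℕ} {s : Equiv.Perm (Fin (n + 1))} {p : ℕ × ℕ} :
    p ∈ rightPairs s ↔ ∃ i, i < s i ∧ p = ((i : ℕ) + 1, (s i : ℕ) + 1) := by
  simp only [rightPairs, List.mem_map, List.mem_filter, List.mem_finRange, true_and,
    decide_eq_true_eq, eq_comm (b := p)]

/-- `φ` and `ρ` give the same couple, as the excedances of a `321`-avoiding permutation are its
left-to-right maxima `i` with `s i ≠ i`. -/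
theorem coupleOf_eq_rightCouple {n : ℕ} {s : Equiv.Perm (Fin (n + 1))} (hs : Avoids321 s)
    {y : Fin (n + 1) → ℕ} (hy : Valid y) (h : Represents s y) : coupleOf y = rightCouple s := by
  rw [coupleOf_eq, rightCouple_eq]
  congr 1
  refine eq_of_pairwise_fst (pairwise_pairs y) (pairwise_rightPairs s) fun p => ?_
  -- `y k = i + 1` when `i` is the first index with `k ≤ s i`
  have val : ∀ k i : Fin (n + 1), y k = (i : ℕ) + 1 ↔ k ≤ s i ∧ ∀ i' < i, s i' < k := by
    intro k i
    constructor
    · intro hk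
      have hlt : ∀ i' < i, s i' < k := by
        intro i' hi'
        by_contra hc
        have := (h i' k).2 ⟨i', le_rfl, not_lt.1 hc⟩
        rw [Fin.lt_def] at hi'
        omega
      obtain ⟨i', hi', hk'⟩ := (h i k).1 hk.le
      refine ⟨?_, hlt⟩
      rcases eq_or_lt_of_le hi' with rfl | hi'
      · exact hk'
      · exact absurd hk' (hlt i' hi').not_ge
    · rintro ⟨h1, h2⟩
      refine le_antisymm ((h i k).2 ⟨i, le_rfl, h1⟩) ?_
      by_contra hc
      have hk := hy.2 k
      obtain ⟨i', hi', hk'⟩ := (h ⟨y k - 1, by omega⟩ k).1 (by simp only; omega)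
      refine (h2 i' (lt_of_le_of_lt hi' ?_)).not_ge hk'
      rw [Fin.lt_def]
      simp only
      omega
  rw [mem_pairs, mem_rightPairs]
  constructor
  · rintro ⟨j, rfl, hmax, hne⟩
    have hj := hy.2 j
    obtain ⟨i, hi⟩ : ∃ i : Fin (n + 1), y j = (i : ℕ) + 1 :=
      ⟨⟨y j - 1, by omega⟩, by simp only; omega⟩
    obtain ⟨h1, h2⟩ := (val j i).1 hi
    have h3 : y (s i) = (i : ℕ) + 1 := (val _ _).2 ⟨le_rfl, fun i' hi' => (h2 i' hi').trans_le h1⟩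
    obtain rfl : j = s i := le_antisymm h1 (hmax _ (h3.trans hi.symm))
    refine ⟨i, Fin.lt_def.2 ?_, by rw [hi]⟩
    omega
  · rintro ⟨i, hi, rfl⟩
    have h3 : y (s i) = (i : ℕ) + 1 :=
      (val _ _).2 ⟨le_rfl, fun i' hi' => hs.lt_of_excedance hi hi'⟩
    refine ⟨s i, by rw [h3], fun j' hj' => ((val _ _).1 (hj'.trans h3)).1, ?_⟩
    rw [h3]
    rw [Fin.lt_def] at hi
    omega

theorem coupleOf_mem_II {n : ℕ} {y : Fin (n + 1) → ℕ} (hy : Valid y) : coupleOf y ∈ II n := by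
  rw [coupleOf_eq, List.unzip_eq_map]
  have hlt : ∀ p ∈ pairs y, p.1 < p.2 := by
    intro p hp
    obtain ⟨j, rfl, -, hne⟩ := mem_pairs.1 hp
    exact lt_of_le_of_ne (hy.2 j).2 hne
  refine ⟨?_, ?_, ?_, ?_, ?_⟩
  · exact List.pairwise_map.2 (pairwise_pairs y)
  · refine List.pairwise_map.2 ((pairwise_pairs y).imp_of_mem fun {p q} hp hq hpq => ?_)
    obtain ⟨j, rfl, -, -⟩ := mem_pairs.1 hp
    obtain ⟨j', rfl, -, -⟩ := mem_pairs.1 hq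
    simp only at hpq ⊢
    have : j < j' := by
      by_contra hc
      exact (hy.1 (not_lt.1 hc)).not_gt hpq
    exact Nat.succ_lt_succ this
  · rw [List.forall₂_map_left_iff, List.forall₂_map_right_iff, List.forall₂_same]
    exact hlt
  · intro a ha
    obtain ⟨p, hp, rfl⟩ := List.mem_map.1 ha
    obtain ⟨j, rfl, -, -⟩ := mem_pairs.1 hp
    exact (hy.2 j).1
  · intro b hb
    obtain ⟨p, hp, rfl⟩ := List.mem_map.1 hb
    obtain ⟨j, rfl, -, -⟩ := mem_pairs.1 hp
    exact j.2

/-- A sequence is recovered from its couple: `y k` is the smallest number among `k + 1` and the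
`a` belonging to some `b ≥ k + 1`. -/
theorem coupleOf_injOn {n : ℕ} {y y' : Fin (n + 1) → ℕ} (hy : Valid y) (hy' : Valid y')
    (h : coupleOf y = coupleOf y') : y = y' := by
  have hp : pairs y = pairs y' := unzip_injective h
  have key : ∀ {y y' : Fin (n + 1) → ℕ}, Valid y → Valid y' → pairs y = pairs y' →
      ∀ k, y' k ≤ y k := by
    intro y y' hy hy' hp k
    obtain ⟨j, hj, hmax⟩ := Finset.exists_max_image
      (Finset.univ.filter fun j => y j = y k) id ⟨k, by simp⟩
    simp only [Finset.mem_filter, Finset.mem_univ, true_and, id] at hj hmax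
    have hkj : k ≤ j := hmax k rfl
    by_cases hne : y j = (j : ℕ) + 1
    · have h1 := (hy.2 k).2
      have h2 := (hy'.2 k).2
      rw [Fin.le_def] at hkj
      omega
    · have hmem : (y j, (j : ℕ) + 1) ∈ pairs y' :=
        hp ▸ mem_pairs.2 ⟨j, rfl, fun j' hj' => hmax j' (hj'.trans hj), hne⟩
      obtain ⟨j', heq, -, -⟩ := mem_pairs.1 hmem
      simp only [Prod.mk.injEq, add_left_inj] at heq
      obtain rfl : j = j' := Fin.ext heq.2
      rw [← hj, heq.1]
      exact hy'.1 hkj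
  exact funext fun k => le_antisymm (key hy' hy hp.symm k) (key hy hy' hp k)

theorem rightCouple_injOn {n : ℕ} {s s' : Equiv.Perm (Fin (n + 1))} (hs : Avoids321 s)
    (hs' : Avoids321 s') (h : rightCouple s = rightCouple s') : s = s' := by
  rw [rightCouple_eq, rightCouple_eq] at h
  have hp := unzip_injective h
  have key : ∀ {s s' : Equiv.Perm (Fin (n + 1))}, rightPairs s = rightPairs s' →
      ∀ i, i < s i → s' i = s i := by
    intro s s' hp i hi
    have hmem : ((i : ℕ) + 1, (s i : ℕ) + 1) ∈ rightPairs s' :=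
      hp ▸ mem_rightPairs.2 ⟨i, hi, rfl⟩
    obtain ⟨i', -, heq⟩ := mem_rightPairs.1 hmem
    simp only [Prod.mk.injEq, add_left_inj] at heq
    obtain rfl : i = i' := Fin.ext heq.1
    exact Fin.ext heq.2.symm
  exact hs.eq_of_excedances hs' (key hp) (key hp.symm)

theorem exists_rightCouple {n : ℕ} {c : List ℕ × List ℕ} (hc : c ∈ II n) :
    ∃ s : Equiv.Perm (Fin (n + 1)), Avoids321 s ∧ rightCouple s = c := by
  obtain ⟨l, l'⟩ := c
  obtain ⟨h1, h2, h3, h4, h5⟩ := hc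
  simp only at h1 h2 h3 h4 h5
  have hlen := h3.length_eq
  have hlt : ∀ t (ht : t < l.length), l[t] < l'[t]'(hlen ▸ ht) := fun t ht =>
    List.Forall₂.get h3 ht (hlen ▸ ht)
  have hb : ∀ t (ht : t < l.length), l'[t]'(hlen ▸ ht) ≤ n + 1 := fun t ht =>
    h5 _ (List.getElem_mem _)
  have ha : ∀ t (ht : t < l.length), 1 ≤ l[t] := fun t ht => h4 _ (List.getElem_mem _)
  let a : Fin l.length → Fin (n + 1) := fun t => ⟨l[t] - 1, by
    have := hlt t t.2
    have := hb t t.2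
    simp only [Fin.getElem_fin]
    omega⟩
  let b : Fin l.length → Fin (n + 1) := fun t => ⟨l'[(t : ℕ)]'(hlen ▸ t.2) - 1, by
    have := hb t t.2
    omega⟩
  have hav : ∀ t, (a t : ℕ) + 1 = l[(t : ℕ)] := fun t => by
    have := ha t t.2
    simp only [a, Fin.getElem_fin]
    omega
  have hbv : ∀ t, (b t : ℕ) + 1 = l'[(t : ℕ)]'(hlen ▸ t.2) := fun t => by
    have := ha t t.2
    have := hlt t t.2
    simp only [b]
    omega
  have hamono : StrictMono a := fun t u htu => by
    rw [Fin.lt_def, ← Nat.succ_lt_succ_iff]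
    exact (hav t).trans_lt ((List.pairwise_iff_getElem.1 h1 t u t.2 u.2 htu).trans_eq (hav u).symm)
  have hbmono : StrictMono b := fun t u htu => by
    rw [Fin.lt_def, ← Nat.succ_lt_succ_iff]
    exact (hbv t).trans_lt ((List.pairwise_iff_getElem.1 h2 t u (hlen ▸ t.2) (hlen ▸ u.2)
      htu).trans_eq (hbv u).symm)
  have hablt : ∀ t, a t < b t := fun t => by
    rw [Fin.lt_def, ← Nat.succ_lt_succ_iff]
    exact (hav t).trans_lt ((hlt t t.2).trans_eq (hbv t).symm)
  obtain ⟨s, hs, hexc, hsa⟩ := exists_perm_of_excedances hamono hbmono hablt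
  refine ⟨s, hs, ?_⟩
  rw [rightCouple_eq, ← List.unzip_zip hlen]
  congr 1
  refine eq_of_pairwise_fst (pairwise_rightPairs s) ?_ fun p => ?_
  · have : ((l.zip l').map Prod.fst).Pairwise (· < ·) := by
      rwa [List.map_fst_zip hlen.le]
    exact List.pairwise_map.1 this
  · rw [mem_rightPairs]
    constructor
    · rintro ⟨i, hi, rfl⟩
      obtain ⟨t, rfl⟩ := (hexc i).1 hi
      rw [hsa, hav, hbv, ← List.getElem_zip (h := by simp [← hlen])]
      exact List.getElem_mem _
    · intro hp
      obtain ⟨t, ht, rfl⟩ := List.mem_iff_getElem.1 hp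
      have ht' : t < l.length := by
        rw [List.length_zip] at ht
        omega
      refine ⟨a ⟨t, ht'⟩, (hexc _).2 ⟨_, rfl⟩, ?_⟩
      rw [hsa, hav, hbv, List.getElem_zip]

/-! ### A linear time program for `φ` -/

/-- A program computing `φ`. Cell `0` holds the bound `n + 2`, cell `1` the number of letters still
to be read, cell `2` a letter or a loop variable, cell `3` a pointer, cell `6` the constant `0`
(for testing against zero), and the cell `j + 8` holds the `j`-th entry
of the sequence, `1 ≤ j ≤ n + 1`. The cell `n + 10` keeps the value `0`, which differs from all
entries and marks the end of the sequence. The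
instructions `5`–`9` fill in `(1, …, n + 1)`, the instructions `11`–`25` apply the letters, and the
instructions `28`–`37` output the pairs, in the order of the places. -/
def program : List Instr :=
  [.read 0, .inc 0, .inc 0, .inc 2, .const 3 9,
   .jumpEq 2 0 10, .store 3 2, .inc 2, .inc 3, .jumpEq 0 0 5,
   .read 1,
   .jumpEq 1 6 26, .dec 1, .read 2,
   .inc 2, .inc 2, .inc 2, .inc 2, .inc 2, .inc 2, .inc 2, .inc 2,
   .load 4 2, .inc 2, .store 2 4, .jumpEq 0 0 11,
   .const 2 1, .const 3 9,
   .jumpEq 2 0 38, .load 4 3, .inc 3, .load 5 3, .jumpEq 4 5 36, .jumpEq 4 2 36,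
   .write 4, .write 2, .inc 2, .jumpEq 0 0 28]

/-- The program leads from `c` to `c'` in at most `T` steps. -/
def Reaches (c c' : Config) (T : ℕ) : Prop := ∃ t ≤ T, (step program)^[t] c = c'

theorem Reaches.trans {c c' c'' : Config} {T T' : ℕ} (h : Reaches c c' T) (h' : Reaches c' c'' T') :
    Reaches c c'' (T + T') := by
  obtain ⟨t, ht, rfl⟩ := h
  obtain ⟨t', ht', rfl⟩ := h'
  exact ⟨t' + t, by omega, Function.iterate_add_apply _ _ _ _⟩

theorem Reaches.mono {c c' : Config} {T T' : ℕ} (h : Reaches c c' T) (hT : T ≤ T') :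
    Reaches c c' T' := by
  obtain ⟨t, ht, rfl⟩ := h
  exact ⟨t, ht.trans hT, rfl⟩

/-- The memory `m` holds the bound `N`, the constant `0`, and the array `Y`. -/
structure Stores (m : ℕ → ℕ) (N : ℕ) (Y : ℕ → ℕ) : Prop where
  bound : m 0 = N
  zero : m 6 = 0
  array : ∀ j, m (j + 8) = Y j

/-- The loop filling in the places from `v` on. -/
theorem reaches_init {N : ℕ} (inp out : List ℕ) (d : ℕ) : ∀ {m : ℕ → ℕ} {Y : ℕ → ℕ} {v : ℕ},
    Stores m N Y → m 2 = v → m 3 = v + 8 → v + d = N →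
    ∃ m', Stores m' N (fun j => if v ≤ j ∧ j < N then j else Y j) ∧
      Reaches ⟨5, m, inp, out⟩ ⟨10, m', inp, out⟩ (5 * d + 1) := by
  induction d with
  | zero =>
    intro m Y v hm h2 h3 hv
    refine ⟨m, ⟨hm.bound, hm.zero, fun j => ?_⟩, 1, le_rfl, ?_⟩
    · rw [if_neg (by omega), hm.array]
    · simp [step, program, Instr.exec, hm.bound, h2, ← hv]
  | succ d ih =>
    intro m Y v hm h2 h3 hv
    have hne : v ≠ N := by omega
    obtain ⟨m', hm', hr⟩ := ih (v := v + 1) (Y := Function.update Y v v)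
      (m := Function.update (Function.update (Function.update m (v + 8) v) 2 (v + 1)) 3 (v + 1 + 8))
      ⟨by simp [hm.bound], by simp [hm.zero], fun j => by
        by_cases hj : j = v <;> simp [hm.array, hj]⟩
      (by simp) (by simp) (by omega)
    refine ⟨m', ⟨hm'.bound, hm'.zero, fun j => ?_⟩, ?_⟩
    · rw [hm'.array]
      by_cases hj : j = v
      · simp [hj, show v < N by omega]
      · rw [Function.update_of_ne hj]
        congr 1
        exact propext (by omega)
    · refine (Reaches.trans ⟨5, le_rfl, ?_⟩ hr).mono (by omega)
      simp [step, program, Instr.exec, hm.bound, h2, h3, hne]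

/-- The effect of the letter `c` on the array. -/
def applyLetter (Y : ℕ → ℕ) (c : ℕ) : ℕ → ℕ := Function.update Y (c + 1) (Y c)

/-- The loop applying the letters. Reading a letter `c` and adding `8` gives the address of the `c`-th
entry. -/
theorem reaches_letters {N : ℕ} (out : List ℕ) (w : List ℕ) : ∀ {m : ℕ → ℕ} {Y : ℕ → ℕ},
    Stores m N Y → m 1 = w.length →
    ∃ m' inp, Stores m' N (w.foldl applyLetter Y) ∧
      Reaches ⟨11, m, w, out⟩ ⟨26, m', inp, out⟩ (15 * w.length + 1) := by
  induction w with
  | nil =>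
    intro m Y hm h1
    refine ⟨m, [], hm, 1, le_rfl, ?_⟩
    simp [step, program, Instr.exec, hm.zero, h1]
  | cons c w ih =>
    intro m Y hm h1
    obtain ⟨m', inp, hm', hr⟩ := ih (Y := applyLetter Y c)
      (m := Function.update (Function.update (Function.update (Function.update m
        1 w.length) 4 (Y c)) 2 (c + 9)) (c + 9) (Y c))
      ⟨by simp [hm.bound], by simp [hm.zero], fun j => by
        by_cases hj : j = c + 1 <;> simp [applyLetter, hm.array, hj]⟩
      (by simp)
    refine ⟨m', inp, hm', (Reaches.trans ⟨15, le_rfl, ?_⟩ hr).mono ?_⟩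
    · simp [step, program, Instr.exec, hm.zero, h1, hm.array]
      funext a
      simp only [Function.update_apply]
      split_ifs <;> rfl
    · rw [List.length_cons]
      omega

/-- The loop writing the output for the places from `k` on. -/
theorem reaches_output {N : ℕ} (Y : ℕ → ℕ) (inp : List ℕ) (d : ℕ) :
    ∀ {m : ℕ → ℕ} {k : ℕ} {out : List ℕ},
    Stores m N Y → m 2 = k → m 3 = k + 8 → k + d = N →
    ∃ m', Reaches ⟨28, m, inp, out⟩ ⟨38, m', inp, out ++ (List.range' k d).flatMap
      fun k => if Y k ≠ Y (k + 1) ∧ Y k ≠ k then [Y k, k] else []⟩ (10 * d + 1) := by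
  induction d with
  | zero =>
    intro m k out hm h2 h3 hk
    refine ⟨m, 1, le_rfl, ?_⟩
    simp [step, program, Instr.exec, hm.bound, h2, ← hk]
  | succ d ih =>
    intro m k out hm h2 h3 hk
    have hne : k ≠ N := by omega
    have e1 := hm.array k
    have e2 : m (k + 9) = Y (k + 1) := by rw [← hm.array]
    obtain ⟨m', hr⟩ := ih (k := k + 1)
      (m := Function.update (Function.update (Function.update (Function.update m
        4 (Y k)) 3 (k + 9)) 5 (Y (k + 1))) 2 (k + 1))
      (out := out ++ if Y k ≠ Y (k + 1) ∧ Y k ≠ k then [Y k, k] else [])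
      ⟨by simp [hm.bound], by simp [hm.zero], fun j => by simp [hm.array]⟩
      (by simp) (by simp) (by omega)
    refine ⟨m', ?_⟩
    rw [List.range'_succ, List.flatMap_cons, ← List.append_assoc]
    refine Reaches.mono (Reaches.trans (T := 10) ?_ hr) (by omega)
    by_cases c1 : Y k = Y (k + 1)
    · refine ⟨7, by omega, ?_⟩
      simp [step, program, Instr.exec, hm.bound, h2, h3, hne, e1, e2, c1]
    · by_cases c2 : Y k = k
      · have c3 : k ≠ Y (k + 1) := fun h => c1 (c2.trans h)
        refine ⟨8, by omega, ?_⟩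
        simp [step, program, Instr.exec, hm.bound, h2, h3, hne, e1, e2, c2, c3]
      · refine ⟨10, by omega, ?_⟩
        simp [step, program, Instr.exec, hm.bound, h2, h3, hne, e1, e2, c1, c2]

/-- The array holding the sequence `y` in the places `1, …, n + 1`. -/
def arrayOf {n : ℕ} (y : Fin (n + 1) → ℕ) (j : ℕ) : ℕ :=
  if h : 1 ≤ j ∧ j ≤ n + 1 then y ⟨j - 1, by omega⟩ else 0

theorem arrayOf_succ {n : ℕ} (y : Fin (n + 1) → ℕ) (k : Fin (n + 1)) :
    arrayOf y (k + 1) = y k := by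
  rw [arrayOf, dif_pos ⟨by omega, by omega⟩]
  rfl

theorem applyLetter_arrayOf {n : ℕ} (y : Fin (n + 1) → ℕ) (i : Fin n) :
    applyLetter (arrayOf y) (i + 1) = arrayOf (propagate i y) := by
  funext j
  rw [applyLetter]
  by_cases hj : 1 ≤ j ∧ j ≤ n + 1
  · obtain ⟨k, rfl⟩ : ∃ k : Fin (n + 1), j = k + 1 := ⟨⟨j - 1, by omega⟩, by simp only; omega⟩
    have h := arrayOf_succ y i.castSucc
    rw [Fin.val_castSucc] at h
    rw [arrayOf_succ, propagate_apply, h]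
    by_cases hk : k = i.succ
    · rw [if_pos hk, hk, Fin.val_succ, Function.update_self]
    · have hk' : (k : ℕ) + 1 ≠ (i : ℕ) + 1 + 1 := fun h => hk (Fin.ext (by simpa using h))
      rw [if_neg hk, Function.update_of_ne hk', arrayOf_succ]
  · rw [Function.update_of_ne (by omega), arrayOf, arrayOf, dif_neg hj, dif_neg hj]

theorem vec_wordValue {n : ℕ} (w : List (Fin n)) :
    arrayOf (vec (wordValue w)) = (w.map fun i : Fin n => (i : ℕ) + 1).foldl applyLetter
      (arrayOf fun k : Fin (n + 1) => (k : ℕ) + 1) := by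
  induction w using List.reverseRecOn with
  | nil =>
    rw [show wordValue [] = (1 : LMonoid n) from rfl, vec_one]
    rfl
  | append_singleton w i ih =>
    rw [show wordValue (w ++ [i]) = wordValue w * gen i by simp [wordValue], vec_mul_gen,
      ← applyLetter_arrayOf, ih, List.map_append, List.foldl_append]
    rfl

theorem flatMap_ite {p : ℕ → Prop} [DecidablePred p] (f : ℕ → ℕ × ℕ) (l : List ℕ) :
    (l.flatMap fun k => if p k then [(f k).1, (f k).2] else []) =
      ((l.filter fun k => p k).map f).flatMap fun c => [c.1, c.2] := by
  induction l with
  | nil => rfl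
  | cons k l ih =>
    rw [List.flatMap_cons, ih]
    by_cases h : p k <;> simp [h]

/-- As the sequence is weakly increasing, its rightmost occurrences of values are the places where it
differs from the next entry, and they are met in increasing order of the values. -/
theorem encodeCouple_coupleOf {n : ℕ} {y : Fin (n + 1) → ℕ} (hy : Valid y) :
    encodeCouple (coupleOf y) = (List.range' 1 (n + 1)).flatMap fun k =>
      if arrayOf y k ≠ arrayOf y (k + 1) ∧ arrayOf y k ≠ k then [arrayOf y k, k] else [] := by
  have hle : ∀ k k', 1 ≤ k → k ≤ k' → k' ≤ n + 1 → arrayOf y k ≤ arrayOf y k' := by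
    intro k k' h1 h2 h3
    rw [arrayOf, arrayOf, dif_pos ⟨h1, h2.trans h3⟩, dif_pos ⟨h1.trans h2, h3⟩]
    exact hy.1 (Fin.le_def.2 (Nat.sub_le_sub_right h2 1))
  have hlast : arrayOf y (n + 2) = 0 := dif_neg (by omega)
  rw [flatMap_ite (p := fun k => arrayOf y k ≠ arrayOf y (k + 1) ∧ arrayOf y k ≠ k)
    fun k => (arrayOf y k, k)]
  rw [encodeCouple, coupleOf_eq]
  have hz : (pairs y).unzip.1.zip (pairs y).unzip.2 = pairs y := List.zip_unzip _
  rw [hz]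
  congr 1
  refine eq_of_pairwise_fst (pairwise_pairs y) ?_ fun p => ?_
  · rw [List.pairwise_map]
    refine ((List.pairwise_lt_range' (s := 1) (n := n + 1)).filter _).imp_of_mem ?_
    intro k k' hk hk' hlt
    simp only [List.mem_filter, List.mem_range'_1, decide_eq_true_eq] at hk hk'
    exact (lt_of_le_of_ne (hle k (k + 1) hk.1.1 (by omega) (by omega)) hk.2.1).trans_le
      (hle (k + 1) k' (by omega) hlt (by omega))
  · simp only [mem_pairs, List.mem_map, List.mem_filter, List.mem_range'_1, decide_eq_true_eq]
    constructor
    · rintro ⟨j, rfl, hmax, hne⟩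
      refine ⟨j + 1, ⟨⟨by omega, by omega⟩, ?_, ?_⟩, by rw [arrayOf_succ]⟩
      · rw [arrayOf_succ]
        intro heq
        rcases Nat.lt_or_ge ((j : ℕ) + 1) (n + 1) with hj | hj
        · have h := hmax ⟨j + 1, hj⟩ ((arrayOf_succ y ⟨j + 1, hj⟩).symm.trans heq.symm)
          rw [Fin.le_def] at h
          simp only at h
          omega
        · have h0 := (hy.2 j).1
          rw [show (j : ℕ) + 1 + 1 = n + 2 by omega, hlast] at heq
          omega
      · rwa [arrayOf_succ]
    · rintro ⟨k, ⟨⟨hk, hk'⟩, hne, hne'⟩, rfl⟩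
      obtain ⟨j, rfl⟩ : ∃ j : Fin (n + 1), k = j + 1 := ⟨⟨k - 1, by omega⟩, by simp only; omega⟩
      rw [arrayOf_succ] at hne hne'
      refine ⟨j, by rw [arrayOf_succ], fun j' hj' => ?_, hne'⟩
      by_contra hlt
      rw [not_le, Fin.lt_def] at hlt
      have h1 := hle (j + 1) (j + 1 + 1) (by omega) (by omega) (by omega)
      have h2 := hle (j + 1 + 1) (j' + 1) (by omega) (by omega) (by omega)
      rw [arrayOf_succ] at h1 h2
      omega

theorem encodeWord_eq {n : ℕ} (w : List (Fin n)) :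
    encodeWord w = n :: w.length :: w.map fun i : Fin n => (i : ℕ) + 1 := by
  simp only [encodeWord, List.bind_eq_flatMap, List.pure_def, ← List.map_eq_flatMap, List.map_map]
  rfl

theorem program_computes_phi {n : ℕ} (w : List (Fin n)) :
    HaltsWithin program (encodeWord w) (encodeCouple (phi (wordValue w)))
      (30 * (max n w.length + 1)) := by
  obtain ⟨m₁, h₁, r₁⟩ := reaches_init (N := n + 2)
    (w.length :: w.map fun i : Fin n => (i : ℕ) + 1) [] (n + 1) (v := 1) (Y := fun _ => 0)
    (m := Function.update (Function.update (Function.update (fun _ => 0) 0 (n + 2)) 2 1) 3 9)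
    ⟨by simp, by simp, fun j => by simp⟩ (by simp) (by simp) (by omega)
  have r₀ : Reaches ⟨0, fun _ => 0, encodeWord w, []⟩ ⟨5, Function.update (Function.update
      (Function.update (fun _ => 0) 0 (n + 2)) 2 1) 3 9,
      w.length :: w.map fun i : Fin n => (i : ℕ) + 1, []⟩ 5 :=
    ⟨5, le_rfl, by rw [encodeWord_eq]; simp [step, program, Instr.exec]⟩
  have e₁ : (fun j => if 1 ≤ j ∧ j < n + 2 then j else 0) =
      arrayOf fun k : Fin (n + 1) => (k : ℕ) + 1 := by
    funext j
    rw [arrayOf]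
    split_ifs
    · simp only
      omega
    · omega
    · omega
    · rfl
  rw [e₁] at h₁
  obtain ⟨m₂, inp, h₂, r₂⟩ := reaches_letters (N := n + 2) [] (w.map fun i : Fin n => (i : ℕ) + 1)
    (m := Function.update m₁ 1 w.length) (Y := arrayOf fun k : Fin (n + 1) => (k : ℕ) + 1)
    ⟨by simp [h₁.bound], by simp [h₁.zero], fun j => by simp [h₁.array]⟩ (by simp)
  rw [← vec_wordValue] at h₂
  obtain ⟨m₃, r₃⟩ := reaches_output (N := n + 2) (arrayOf (vec (wordValue w))) inp (n + 1)
    (k := 1) (out := []) (m := Function.update (Function.update m₂ 2 1) 3 9) ⟨by simp [h₂.bound], by simp [h₂.zero],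
      fun j => by simp [h₂.array]⟩ (by simp) (by simp) (by omega)
  have r₁₂ : Reaches ⟨10, m₁, w.length :: w.map fun i : Fin n => (i : ℕ) + 1, []⟩
      ⟨11, Function.update m₁ 1 w.length, w.map fun i : Fin n => (i : ℕ) + 1, []⟩ 1 :=
    ⟨1, le_rfl, by simp [step, program, Instr.exec]⟩
  have r₂₃ : Reaches ⟨26, m₂, inp, []⟩
      ⟨28, Function.update (Function.update m₂ 2 1) 3 9, inp, []⟩ 2 :=
    ⟨2, le_rfl, by simp [step, program, Instr.exec]⟩
  rw [List.nil_append, ← encodeCouple_coupleOf (valid_vec _), ← phi_eq] at r₃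
  obtain ⟨t, ht, hr⟩ := ((((r₀.trans r₁).trans r₁₂).trans r₂).trans r₂₃).trans r₃
  rw [List.length_map] at ht
  refine ⟨t, by omega, ?_⟩
  rw [hr]
  exact ⟨le_rfl, rfl⟩

/-! ### The bijections -/

theorem represents_of_eps_eq {n : ℕ} {x : LMonoid n} {s : Equiv.Perm (Fin (n + 1))}
    {hs : Avoids321 s} (h : eps n x = DL.mk (straight s hs)) : Represents s (vec x) := by
  intro a k
  rw [← trace_eps, h]
  exact (DL.trace_mk _ a k).trans (trace_straight hs a k)

theorem phi_eq_of_eps_eq {n : ℕ} {x : LMonoid n} {w : WL n} (h : eps n x = iota w) :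
    phi x = rightCouple (webPerm w) := by
  rw [eq_straightWeb w, iota_straightWeb] at h
  exact coupleOf_eq_rightCouple (webPerm_avoids321 w) (valid_vec x) (represents_of_eps_eq h)

theorem rightCouple_webPerm_mem (n : ℕ) (w : WL n) : rightCouple (webPerm w) ∈ II n := by
  obtain ⟨x, hx⟩ := eps_surjective n (iota w)
  rw [← phi_eq_of_eps_eq hx]
  exact coupleOf_mem_II (valid_vec x)

theorem rightCouple_webPerm_injective (n : ℕ) :
    Function.Injective fun w : WL n => rightCouple (webPerm w) := fun w w' h =>
  webPerm_injective (rightCouple_injOn (webPerm_avoids321 w) (webPerm_avoids321 w') h)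

theorem iota_injective (n : ℕ) : Function.Injective (iota (n := n)) := by
  intro w w' h
  obtain ⟨x, hx⟩ := eps_surjective n (iota w)
  exact rightCouple_webPerm_injective n
    ((phi_eq_of_eps_eq hx).symm.trans (phi_eq_of_eps_eq (hx.trans h)))

theorem iota_surjective (n : ℕ) : Function.Surjective (iota (n := n)) := by
  intro d
  obtain ⟨x, rfl⟩ := eps_surjective n d
  obtain ⟨s, hs, h⟩ := exists_avoids321_represents x
  obtain ⟨x', hx'⟩ := straight_mem_range_eps hs
  refine ⟨straightWeb s hs, ?_⟩
  rw [iota_straightWeb, ← hx']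
  congr 1
  refine vec_injective (coupleOf_injOn (valid_vec x') (valid_vec x) ?_)
  rw [coupleOf_eq_rightCouple hs (valid_vec x') (represents_of_eps_eq hx'),
    coupleOf_eq_rightCouple hs (valid_vec x) h]

theorem bijOn_rightCouple_webPerm (n : ℕ) :
    Set.BijOn (fun w : WL n => rightCouple (webPerm w)) Set.univ (II n) := by
  refine ⟨fun w _ => rightCouple_webPerm_mem n w, (rightCouple_webPerm_injective n).injOn,
    fun c hc => ?_⟩
  obtain ⟨s, hs, rfl⟩ := exists_rightCouple hc
  exact ⟨straightWeb s hs, Set.mem_univ _, congrArg rightCouple (webPerm_straightWeb hs)⟩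

theorem bijOn_phi (n : ℕ) : Set.BijOn (phi (n := n)) Set.univ (II n) := by
  refine ⟨fun x _ => coupleOf_mem_II (valid_vec x), fun x _ x' _ h =>
    vec_injective (coupleOf_injOn (valid_vec x) (valid_vec x') h), fun c hc => ?_⟩
  obtain ⟨s, hs, rfl⟩ := exists_rightCouple hc
  obtain ⟨x, hx⟩ := straight_mem_range_eps hs
  exact ⟨x, Set.mem_univ _,
    coupleOf_eq_rightCouple hs (valid_vec x) (represents_of_eps_eq hx)⟩

end HeckeKiselman

theorem theoremT :
    (∀ n : ℕ,
      (∃ _ : Monoid (HeckeKiselman.DL n),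
        (∀ d e : HeckeKiselman.Diagram n,
          HeckeKiselman.DL.mk d * HeckeKiselman.DL.mk e = HeckeKiselman.DL.mk (d.comp e)) ∧
        (1 : HeckeKiselman.DL n) = HeckeKiselman.DL.mk (HeckeKiselman.trivialDiagram n) ∧
        ∃ ε : HeckeKiselman.LMonoid n →* HeckeKiselman.DL n,
          (∀ i : Fin n, ε (HeckeKiselman.gen i) =
            HeckeKiselman.DL.mk (HeckeKiselman.elementary i)) ∧
          Function.Bijective ε ∧
          (∀ (x : HeckeKiselman.LMonoid n) (w : HeckeKiselman.WL n),
            ε x = HeckeKiselman.iota w →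
              HeckeKiselman.phi x =
                HeckeKiselman.rightCouple (HeckeKiselman.webPerm w))) ∧
      Function.Bijective (HeckeKiselman.iota (n := n)) ∧
      (∀ w : HeckeKiselman.WL n, HeckeKiselman.Avoids321 (HeckeKiselman.webPerm w)) ∧
      Set.BijOn (fun w : HeckeKiselman.WL n =>
          HeckeKiselman.rightCouple (HeckeKiselman.webPerm w))
        Set.univ (HeckeKiselman.II n) ∧
      Set.BijOn (HeckeKiselman.phi (n := n)) Set.univ (HeckeKiselman.II n)) ∧
    (∃ (P : List HeckeKiselman.Instr) (C : ℕ), ∀ (n : ℕ) (w : List (Fin n)),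
      HeckeKiselman.HaltsWithin P (HeckeKiselman.encodeWord w)
        (HeckeKiselman.encodeCouple (HeckeKiselman.phi (HeckeKiselman.wordValue w)))
        (C * (max n w.length + 1))) := by
  refine ⟨fun n => ⟨⟨HeckeKiselman.DL.instMonoid n, fun _ _ => rfl, rfl, HeckeKiselman.eps n,
    HeckeKiselman.eps_gen, ⟨HeckeKiselman.eps_injective n, HeckeKiselman.eps_surjective n⟩,
    fun _ _ => HeckeKiselman.phi_eq_of_eps_eq⟩,
    ⟨HeckeKiselman.iota_injective n, HeckeKiselman.iota_surjective n⟩,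
    HeckeKiselman.webPerm_avoids321, HeckeKiselman.bijOn_rightCouple_webPerm n,
    HeckeKiselman.bijOn_phi n⟩,
    HeckeKiselman.program, 30, fun _ w => HeckeKiselman.program_computes_phi w⟩
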